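/- **Setting.** Let $R$ be a commutative ring with unit. Let $X$ be a Hausdorff space with a filtration by closed subspaces $\emptyset=X_{-1}\subseteq X_0\subseteq\dots\subseteq X_{n-1}\subsetneq X_n=X$. The strata are the nonempty connected components of the sets $X_i\setminus X_{i-1}$; a stratum $S\subset X_i\setminus X_{i-1}$ has codimension $\operatorname{codim}S=n-i$, and it is regular if $i=n$ and singular otherwise. Let $\overline p$ be a perversity, i.e. a map from the set of strata to $\mathbb Z\cup\{\pm\infty\}$ which is $0$ on regular strata. *Simplices.* A regular simplex is a continuous map $\sigma\colon\Delta=\Delta_0*\dots*\Delta_n\to X$ on a Euclidean simplex with ordered vertices, the order being compatible with the join decomposition (some $\Delta_i$, $i<n$, may be empty), such that $\sigma^{-1}(X_i)=\Delta_0*\dots*\Delta_i$ for all $i$ and $\Delta_n\neq\emptyset$. A regular face operator is the inclusion of a face of $\Delta$ whose intersection with $\Delta_n$ is nonempty. *Cochains.* Put $\widetilde N^*(\Delta)=N^*(\mathtt c\Delta_0)\otimes\dots\otimes N^*(\mathtt c\Delta_{n-1})\otimes N^*(\Delta_n)$, where $N^*$ denotes simplicial cochains with coefficients in $R$ and $\mathtt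 c\Delta_i$ is the cone, whose apex $\mathtt v_i$ is its last vertex ($\mathtt c\emptyset=\{\mathtt v_i\}$); the differential on $N^*$ is $\delta f=-(-1)^{|f|}f\circ\partial$. The basis elements are ${\bf 1}_{(F,\varepsilon)}={\bf 1}_{(F_0,\varepsilon_0)}\otimes\dots\otimes{\bf 1}_{(F_n,\varepsilon_n)}$, where $F_i$ is a possibly empty face of $\Delta_i$, $(F_i,0)=F_i$, $(F_i,1)=\mathtt cF_i$, $\varepsilon_i=1$ if $F_i=\emptyset$, and $\varepsilon_n=0$. For a set $P$ of regular simplices, a cochain on $P$ is a family $\omega=(\omega_\sigma)_{\sigma\in P}$, $\omega_\sigma\in\widetilde N^*(\Delta)$, compatible with regular face operators between members of $P$; its differential is $(\delta\omega)_\sigma=\delta(\omega_\sigma)$. *Perverse degree.* For $1\le\ell\le n$ let $\|{\bf 1}_{(F,\varepsilon)}\|_\ell=-\infty$ if $\varepsilon_{n-\ell}=1$ and $\|{\bf 1}_{(F,\varepsilon)}\|_\ell=\sum_{i>n-\ell}(\dim F_i+\varepsilon_i)$ if $\varepsilon_{n-\ell}=0$. Let $\|\omega_\sigma\|_\ell$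 be the maximum over the basis elements occurring in $\omega_\sigma$ with nonzero coefficient ($-\infty$ if $\omega_\sigma=0$). For a singular stratum $S$ put $\|\omega\|_S=\sup\{\|\omega_\sigma\|_{\operatorname{codim}S}:\sigma\in P,\ \operatorname{Im}\sigma\cap S\ne\emptyset\}$, and $\|\omega\|_S=0$ for a regular stratum. A $\overline p$-intersection cochain on $P$ is a cochain $\omega$ with $\|\omega\|_S\le\overline p(S)$ and $\|\delta\omega\|_S\le\overline p(S)$ for all strata $S$. These form a complex, denoted $\widetilde N^*_{\overline p}(X;R)$ when $P$ is the set of all regular simplices and, for an open cover $\mathcal U$ of $X$, $\widetilde N^{*,\mathcal U}_{\overline p}(X;R)$ when $P$ is the set of $\mathcal U$-small simplices, i.e. the regular simplices whose image is contained in a member of $\mathcal U$. **Theorem.** Let $\mathcal U$ be an open cover of $X$ and let $\rho_{\mathcal U}\colon\widetilde N^*_{\overline p}(X;R)\to\widetilde N^{*,\mathcal U}_{\overline p}(X;R)$ be the restriction map. 1. There exist a cochain map $\varphi_{\mathcal U}\colon\widetilde N^{*,\mathcal U}_{\overline p}(X;R)\to\widetilde N^*_{\overline p}(X;R)$ and $R$-linear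 maps $\Theta\colon\widetilde N^{*}_{\overline p}(X;R)\to\widetilde N^{*-1}_{\overline p}(X;R)$ such that $$\rho_{\mathcal U}\circ\varphi_{\mathcal U}=\mathrm{id},\qquad \delta\circ\Theta+\Theta\circ\delta=\mathrm{id}-\varphi_{\mathcal U}\circ\rho_{\mathcal U},$$ and such that moreover, for every subset $K\subset X$ and every homogeneous $\omega\in\widetilde N^{*,\mathcal U}_{\overline p}(X;R)$ with $\omega_\sigma=0$ for all $\mathcal U$-small $\sigma$ with $\operatorname{Im}\sigma\cap K=\emptyset$, one has $(\varphi_{\mathcal U}(\omega))_\sigma=0$ for all regular simplices $\sigma$ with $\operatorname{Im}\sigma\cap K=\emptyset$. 2. In particular $\rho_{\mathcal U}$ is a quasi-isomorphism. -/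

import Mathlib

open CategoryTheory

namespace BlownUp

/-! ### Filtered spaces, strata, perversities -/

/-- A filtration `X_0 ⊆ X_1 ⊆ … ⊆ X_n = X` of formal dimension `n` by closed subspaces,
with `X_{n-1} ≠ X_n`. -/
structure Filtration (X : Type*) [TopologicalSpace X] (n : ℕ) where
  level : Fin (n + 1) → Set X
  isClosed_level : ∀ i, IsClosed (level i)
  monotone_level : Monotone level
  level_last : level (Fin.last n) = Set.univ
  regular_nonempty : (⋃ j < Fin.last n, level j) ≠ Set.univ

variable {X : Type*} [TopologicalSpace X] {n : ℕ}

/-- The difference `X_i \ X_{i-1}` (with `X_{-1} = ∅`). -/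
def Filtration.piece (𝓕 : Filtration X n) (i : Fin (n + 1)) : Set X :=
  𝓕.level i \ ⋃ j < i, 𝓕.level j

/-- A stratum: a (nonempty) connected component of some `X_i \ X_{i-1}`; `dim = i` is its
formal dimension. -/
structure Stratum (𝓕 : Filtration X n) where
  carrier : Set X
  dim : Fin (n + 1)
  exists_eq : ∃ x ∈ 𝓕.piece dim, carrier = connectedComponentIn (𝓕.piece dim) x

/-- Regular strata are those of `X_n \ X_{n-1}`; the other strata are singular. -/
def Stratum.IsRegular {𝓕 : Filtration X n} (S : Stratum 𝓕) : Prop :=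
  S.dim = Fin.last n

/-- The set `ℤ ∪ {±∞}`. -/
abbrev ExtInt : Type := WithBot (WithTop ℤ)

/-- A perversity: a map from the strata to `ℤ ∪ {±∞}`, zero on the regular strata. -/
structure Perversity (𝓕 : Filtration X n) where
  toFun : Stratum 𝓕 → ExtInt
  regular : ∀ S : Stratum 𝓕, S.IsRegular → toFun S = 0

/-! ### The blow up of a weighted simplex

A simplex `Δ = [e_0, …, e_m]` with a decomposition `Δ = Δ_0 * … * Δ_n` is encoded by the weight
function `w : Fin (m + 1) → Fin (n + 1)`, where `e_j` is a vertex of `Δ_{w j}`. The blow up is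
`cΔ_0 × … × cΔ_{n-1} × Δ_n`. -/

/-- The vertices of the factors of the blow up: the vertices `e_j` of `Δ`, and, for each `i < n`,
the virtual vertex `v_i`, the apex of `cΔ_i`. In the (lexicographic) order a virtual vertex
comes after all the `e_j`. -/
abbrev Vertex (m n : ℕ) : Type := Fin (m + 1) ⊕ₗ Fin n

/-- The real vertex `e_j`. -/
abbrev realVertex {m : ℕ} (n : ℕ) (j : Fin (m + 1)) : Vertex m n := toLex (Sum.inl j)

/-- The virtual vertex `v_i`. -/
abbrev virtualVertex (m : ℕ) {n : ℕ} (i : Fin n) : Vertex m n := toLex (Sum.inr i)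

/-- The index of the factor of the blow up that a vertex belongs to. -/
def factor {m : ℕ} (w : Fin (m + 1) → Fin (n + 1)) (v : Vertex m n) : Fin (n + 1) :=
  Sum.elim w Fin.castSucc (ofLex v)

/-- For a product `c = c_0 × … × c_n` of nonempty faces of the factors, encoded by the set of all
the vertices of the `c_i`, the dimension of `c_i`. For `c = (F, ε)` this is `dim F_i + ε_i`,
where `ε_i = 1` if and only if `v_i` is a vertex of `c`. -/
def factorDim {m : ℕ} (w : Fin (m + 1) → Fin (n + 1)) (c : Finset (Vertex m n))
    (i : Fin (n + 1)) : ℕ :=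
  (c.filter fun v => factor w v = i).card - 1

/-- `c` is (the set of vertices of) a face of the blow up of dimension `k`. -/
def IsFace {m : ℕ} (w : Fin (m + 1) → Fin (n + 1)) (k : ℕ) (c : Finset (Vertex m n)) : Prop :=
  (∀ i, ∃ v ∈ c, factor w v = i) ∧ ∑ i, factorDim w c i = k

instance {m : ℕ} (w : Fin (m + 1) → Fin (n + 1)) (k : ℕ) : DecidablePred (IsFace w k) :=
  fun c => inferInstanceAs
    (Decidable ((∀ i, ∃ v ∈ c, factor w v = i) ∧ ∑ i, factorDim w c i = k))

/-- The `k`-dimensional faces `(F, ε)` of the blow up. -/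
abbrev Face {m : ℕ} (w : Fin (m + 1) → Fin (n + 1)) (k : ℕ) : Type :=
  {c : Finset (Vertex m n) // IsFace w k c}

/-- The degree `k` part of the blown-up complex
`N^*(cΔ_0) ⊗ … ⊗ N^*(cΔ_{n-1}) ⊗ N^*(Δ_n)` of a weighted simplex, written in the basis of the
elements `1_{(F,ε)}`: the value at a face is the coefficient of the corresponding basis element. -/
abbrev SimplexCochain (R : Type*) {m : ℕ} (w : Fin (m + 1) → Fin (n + 1)) (k : ℕ) : Type _ :=
  Face w k → R

section Simplex

variable {R : Type*} [CommRing R] {m m' : ℕ}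

/-- The coefficient of a cochain at a set of vertices, zero if this set is not a face of
dimension `k`. -/
def coeff {w : Fin (m + 1) → Fin (n + 1)} {k : ℕ} (ω : SimplexCochain R w k)
    (c : Finset (Vertex m n)) : R :=
  if h : IsFace w k c then ω ⟨c, h⟩ else 0

/-- For a vertex `v` of `c = c_0 × … × c_n`, lying in `c_i`, the exponent
`dim c_0 + … + dim c_{i-1} + #{vertices of c_i after v}` of the sign with which `1_c` appears in
the differential of `1_{c - v}`. -/
def signExp (w : Fin (m + 1) → Fin (n + 1)) (c : Finset (Vertex m n)) (v : Vertex m n) : ℕ :=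
  (∑ i ∈ Finset.univ.filter fun i => i < factor w v, factorDim w c i) +
    (c.filter fun u => factor w u = factor w v ∧ v < u).card

/-- The differential of the blown-up complex of a weighted simplex. It is the differential of the
tensor product of the complexes `N^*(cΔ_i)` and `N^*(Δ_n)`, which on each factor is
`δ 1_{[a_0,…,a_p]} = ∑_a 1_{[a_0,…,a_p,a]}`. -/
def simplexDiff (w : Fin (m + 1) → Fin (n + 1)) (k : ℕ) :
    SimplexCochain R w k →ₗ[R] SimplexCochain R w (k + 1) where
  toFun ω c := ∑ v ∈ c.1, (-1) ^ signExp w c.1 v * coeff ω (c.1.erase v)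
  map_add' ω η := by
    funext c
    simp only [Pi.add_apply, ← Finset.sum_add_distrib, ← mul_add]
    refine Finset.sum_congr rfl fun v _ => ?_
    congr 1
    unfold coeff
    split_ifs <;> simp
  map_smul' r ω := by
    funext c
    simp only [Pi.smul_apply, smul_eq_mul, Finset.mul_sum, RingHom.id_apply]
    refine Finset.sum_congr rfl fun v _ => ?_
    unfold coeff
    split_ifs <;> simp; try ring

lemma factorDim_erase (w : Fin (m + 1) → Fin (n + 1)) {c : Finset (Vertex m n)} {v : Vertex m n}
    (hv : v ∈ c) (i : Fin (n + 1)) :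
    factorDim w (c.erase v) i = factorDim w c i - if i = factor w v then 1 else 0 := by
  unfold factorDim
  rw [Finset.filter_erase]
  split_ifs with h
  · rw [Finset.card_erase_of_mem (by simp [hv, h])]
  · rw [Finset.erase_eq_of_notMem (by simp [hv]; tauto)]
    simp

lemma isFace_of_erase {w : Fin (m + 1) → Fin (n + 1)} {k l : ℕ} {c : Finset (Vertex m n)}
    {v : Vertex m n} (hc : IsFace w (k + 1) c) (hv : v ∈ c) (h : IsFace w l (c.erase v)) :
    IsFace w k (c.erase v) := by
  refine ⟨h.1, ?_⟩
  obtain ⟨u, hu, huv⟩ := h.1 (factor w v)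
  have h1 : 1 ≤ factorDim w c (factor w v) := by
    unfold factorDim
    have : 1 < (c.filter fun u => factor w u = factor w v).card := by
      rw [Finset.one_lt_card]
      exact ⟨u, by simp [Finset.mem_of_mem_erase hu, huv], v, by simp [hv],
        Finset.ne_of_mem_erase hu⟩
    omega
  have h2 := hc.2
  rw [← Finset.add_sum_erase _ _ (Finset.mem_univ (factor w v))] at h2 ⊢
  have h3 : ∑ i ∈ Finset.univ.erase (factor w v), factorDim w (c.erase v) i =
      ∑ i ∈ Finset.univ.erase (factor w v), factorDim w c i :=
    Finset.sum_congr rfl fun i hi => by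
      rw [factorDim_erase w hv, if_neg (Finset.ne_of_mem_erase hi)]; rfl
  rw [h3, factorDim_erase w hv, if_pos rfl]
  omega

lemma signExp_lt (w : Fin (m + 1) → Fin (n + 1)) {c : Finset (Vertex m n)} {x y : Vertex m n}
    (hx : x ∈ c) (hy : y ∈ c) (hxy : factor w x < factor w y)
    (hf : ∃ u ∈ c.erase x, factor w u = factor w x) :
    signExp w (c.erase y) x = signExp w c x ∧ signExp w (c.erase x) y + 1 = signExp w c y := by
  unfold signExp
  constructor
  · congr 1
    · refine Finset.sum_congr rfl fun i hi => ?_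
      have : i < factor w x := by simpa using hi
      rw [factorDim_erase w hy, if_neg (by rintro rfl; exact absurd hxy this.asymm)]
      rfl
    · congr 1
      ext u
      simp only [Finset.mem_filter, Finset.mem_erase]
      constructor
      · rintro ⟨⟨_, h⟩, h'⟩; exact ⟨h, h'⟩
      · rintro ⟨h, h'⟩
        exact ⟨⟨by rintro rfl; exact hxy.ne' h'.1, h⟩, h'⟩
  · have h1 : 1 ≤ factorDim w c (factor w x) := by
      obtain ⟨u, hu, huv⟩ := hf
      unfold factorDim
      have : 1 < (c.filter fun u => factor w u = factor w x).card := by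
        rw [Finset.one_lt_card]
        exact ⟨u, by simp [Finset.mem_of_mem_erase hu, huv], x, by simp [hx],
          Finset.ne_of_mem_erase hu⟩
      omega
    have hm : factor w x ∈ Finset.univ.filter fun i => i < factor w y := by simpa using hxy
    rw [← Finset.add_sum_erase _ _ hm, ← Finset.add_sum_erase _ (factorDim w c) hm]
    have h3 : ∑ i ∈ (Finset.univ.filter fun i => i < factor w y).erase (factor w x),
          factorDim w (c.erase x) i =
        ∑ i ∈ (Finset.univ.filter fun i => i < factor w y).erase (factor w x),
          factorDim w c i :=
      Finset.sum_congr rfl fun i hi => by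
        rw [factorDim_erase w hx, if_neg (Finset.ne_of_mem_erase hi)]; rfl
    have h4 : ((c.erase x).filter fun u => factor w u = factor w y ∧ y < u) =
        c.filter fun u => factor w u = factor w y ∧ y < u := by
      ext u
      simp only [Finset.mem_filter, Finset.mem_erase]
      constructor
      · rintro ⟨⟨_, h⟩, h'⟩; exact ⟨h, h'⟩
      · rintro ⟨h, h'⟩
        exact ⟨⟨by rintro rfl; exact hxy.ne h'.1, h⟩, h'⟩
    rw [h3, h4, factorDim_erase w hx, if_pos rfl]
    omega

lemma signExp_eq (w : Fin (m + 1) → Fin (n + 1)) {c : Finset (Vertex m n)} {x y : Vertex m n}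
    (hx : x ∈ c) (hy : y ∈ c) (hxy : factor w x = factor w y) (hlt : x < y) :
    signExp w (c.erase y) x + 1 = signExp w c x ∧ signExp w (c.erase x) y = signExp w c y := by
  unfold signExp
  constructor
  · have h1 : ∑ i ∈ Finset.univ.filter (fun i => i < factor w x), factorDim w (c.erase y) i =
        ∑ i ∈ Finset.univ.filter (fun i => i < factor w x), factorDim w c i :=
      Finset.sum_congr rfl fun i hi => by
        have : i < factor w x := by simpa using hi
        rw [factorDim_erase w hy, if_neg (by rintro rfl; exact absurd hxy this.ne')]; rfl
    have hm : y ∈ c.filter fun u => factor w u = factor w x ∧ x < u := by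
      simp [hy, hxy, hlt]
    rw [h1, Finset.filter_erase, add_assoc, Finset.card_erase_add_one hm]
  · congr 1
    · refine Finset.sum_congr rfl fun i hi => ?_
      have : i < factor w y := by simpa using hi
      rw [factorDim_erase w hx, if_neg (by rintro rfl; exact absurd hxy this.ne)]; rfl
    · congr 1
      ext u
      simp only [Finset.mem_filter, Finset.mem_erase]
      constructor
      · rintro ⟨⟨_, h⟩, h'⟩; exact ⟨h, h'⟩
      · rintro ⟨h, h'⟩
        exact ⟨⟨by rintro rfl; exact absurd h'.2 hlt.asymm, h⟩, h'⟩

lemma sign_swap (w : Fin (m + 1) → Fin (n + 1)) {c : Finset (Vertex m n)} {x y : Vertex m n}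
    (hx : x ∈ c) (hy : y ∈ c) (hxy : x ≠ y)
    (hf : ∀ i, ∃ u ∈ (c.erase x).erase y, factor w u = i) :
    (-1 : R) ^ signExp w c x * (-1) ^ signExp w (c.erase x) y =
      -((-1) ^ signExp w c y * (-1) ^ signExp w (c.erase y) x) := by
  have hfx : ∃ u ∈ c.erase x, factor w u = factor w x := by
    obtain ⟨u, hu, h⟩ := hf (factor w x)
    exact ⟨u, Finset.mem_of_mem_erase hu, h⟩
  have hfy : ∃ u ∈ c.erase y, factor w u = factor w y := by
    obtain ⟨u, hu, h⟩ := hf (factor w y)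
    rw [Finset.erase_right_comm] at hu
    exact ⟨u, Finset.mem_of_mem_erase hu, h⟩
  rcases lt_trichotomy (factor w x) (factor w y) with h | h | h
  · obtain ⟨h1, h2⟩ := signExp_lt w hx hy h hfx
    rw [h1, ← h2, pow_succ]; ring
  · rcases lt_or_gt_of_ne hxy with h' | h'
    · obtain ⟨h1, h2⟩ := signExp_eq w hx hy h h'
      rw [h2, ← h1, pow_succ]; ring
    · obtain ⟨h1, h2⟩ := signExp_eq w hy hx h.symm h'
      rw [h2, ← h1, pow_succ]; ring
  · obtain ⟨h1, h2⟩ := signExp_lt w hy hx h hfy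
    rw [h1, ← h2, pow_succ]; ring

lemma coeff_simplexDiff {w : Fin (m + 1) → Fin (n + 1)} {k : ℕ} (ω : SimplexCochain R w k)
    {c : Finset (Vertex m n)} (hc : IsFace w (k + 2) c) {x : Vertex m n} (hx : x ∈ c) :
    coeff (simplexDiff w k ω) (c.erase x) =
      ∑ y ∈ c.erase x, (-1) ^ signExp w (c.erase x) y * coeff ω ((c.erase x).erase y) := by
  unfold coeff
  split_ifs with h
  · rfl
  · symm
    refine Finset.sum_eq_zero fun y _ => ?_
    rw [dif_neg, mul_zero]
    intro h'
    refine h (isFace_of_erase hc hx (l := ∑ i, factorDim w (c.erase x) i) ⟨fun i => ?_, rfl⟩)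
    obtain ⟨u, hu, hui⟩ := h'.1 i
    exact ⟨u, Finset.mem_of_mem_erase hu, hui⟩

lemma simplexDiff_simplexDiff (w : Fin (m + 1) → Fin (n + 1)) (k : ℕ)
    (ω : SimplexCochain R w k) : simplexDiff w (k + 1) (simplexDiff w k ω) = 0 := by
  funext c
  obtain ⟨c, hc⟩ := c
  change ∑ x ∈ c, (-1) ^ signExp w c x * coeff (simplexDiff w k ω) (c.erase x) = 0
  have h1 : ∀ x ∈ c, (-1) ^ signExp w c x * coeff (simplexDiff w k ω) (c.erase x) =
      ∑ y ∈ c.erase x, (-1) ^ signExp w c x * ((-1) ^ signExp w (c.erase x) y *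
        coeff ω ((c.erase x).erase y)) := fun x hx => by
    rw [coeff_simplexDiff ω hc hx, Finset.mul_sum]
  rw [Finset.sum_congr rfl h1, Finset.sum_sigma']
  refine Finset.sum_involution (fun p _ => ⟨p.2, p.1⟩) ?_ ?_ ?_ ?_
  · rintro ⟨x, y⟩ hp
    simp only [Finset.mem_sigma, Finset.mem_erase] at hp
    obtain ⟨hx, hyx, hy⟩ := hp
    dsimp only
    rw [Finset.erase_right_comm (a := y) (b := x)]
    by_cases hf : ∀ i, ∃ u ∈ (c.erase x).erase y, factor w u = i
    · rw [← mul_assoc, sign_swap w hx hy hyx.symm hf]; ring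
    · have : coeff ω ((c.erase x).erase y) = 0 := dif_neg fun h => hf h.1
      rw [this]; ring
  · rintro ⟨x, y⟩ hp _ he
    simp only [Finset.mem_sigma, Finset.mem_erase] at hp
    simp only [Sigma.mk.injEq, heq_eq_eq] at he
    exact hp.2.1 he.1
  · rintro ⟨x, y⟩ hp
    simp only [Finset.mem_sigma, Finset.mem_erase] at hp ⊢
    exact ⟨hp.2.2, hp.2.1.symm, hp.1⟩
  · rintro ⟨x, y⟩ _
    rfl

/-! ### Face operators -/

/-- The map on vertices induced by a face operator: it fixes the virtual vertices. -/
def vertexMap (n : ℕ) (f : Fin (m' + 1) ↪o Fin (m + 1)) : Vertex m' n ↪ Vertex m n where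
  toFun v := toLex (Sum.map f id (ofLex v))
  inj' := by
    intro a b h
    have := (Sum.map_injective.2 ⟨f.injective, Function.injective_id (α := Fin n)⟩)
      (toLex.injective h)
    exact ofLex.injective this

lemma factor_vertexMap (w : Fin (m + 1) → Fin (n + 1)) (f : Fin (m' + 1) ↪o Fin (m + 1))
    (v : Vertex m' n) : factor w (vertexMap n f v) = factor (fun j => w (f j)) v := by
  rcases v with v | v <;> rfl

lemma vertexMap_lt (f : Fin (m' + 1) ↪o Fin (m + 1)) (u v : Vertex m' n) :
    vertexMap n f u < vertexMap n f v ↔ u < v := by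
  rcases u with u | u <;> rcases v with v | v
  · exact Sum.Lex.inl_lt_inl_iff.trans (f.lt_iff_lt.trans Sum.Lex.inl_lt_inl_iff.symm)
  · exact iff_of_true (Sum.Lex.inl_lt_inr _ _) (Sum.Lex.inl_lt_inr _ _)
  · exact iff_of_false Sum.Lex.not_inr_lt_inl Sum.Lex.not_inr_lt_inl
  · exact Sum.Lex.inr_lt_inr_iff.trans Sum.Lex.inr_lt_inr_iff.symm

lemma factorDim_map (w : Fin (m + 1) → Fin (n + 1)) (f : Fin (m' + 1) ↪o Fin (m + 1))
    (c : Finset (Vertex m' n)) (i : Fin (n + 1)) :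
    factorDim w (c.map (vertexMap n f)) i = factorDim (fun j => w (f j)) c i := by
  unfold factorDim
  rw [Finset.filter_map, Finset.card_map]
  simp only [Function.comp_def, factor_vertexMap]

lemma isFace_map (w : Fin (m + 1) → Fin (n + 1)) (f : Fin (m' + 1) ↪o Fin (m + 1)) (k : ℕ)
    (c : Finset (Vertex m' n)) :
    IsFace w k (c.map (vertexMap n f)) ↔ IsFace (fun j => w (f j)) k c := by
  simp only [IsFace, factorDim_map, Finset.mem_map, exists_exists_and_eq_and, factor_vertexMap]

/-- The map `δ_ℓ^*` on cochains induced by a face operator `f`. It sends `1_{(F,ε)}` to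
`1_{(F,ε)}` if `F` lies in the face, and to `0` otherwise. -/
def pullback (w : Fin (m + 1) → Fin (n + 1)) (f : Fin (m' + 1) ↪o Fin (m + 1)) {k : ℕ}
    (ω : SimplexCochain R w k) : SimplexCochain R (fun j => w (f j)) k :=
  fun c => ω ⟨c.1.map (vertexMap n f), (isFace_map w f k c.1).2 c.2⟩

lemma signExp_map (w : Fin (m + 1) → Fin (n + 1)) (f : Fin (m' + 1) ↪o Fin (m + 1))
    (c : Finset (Vertex m' n)) (v : Vertex m' n) :
    signExp w (c.map (vertexMap n f)) (vertexMap n f v) = signExp (fun j => w (f j)) c v := by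
  unfold signExp
  rw [Finset.filter_map, Finset.card_map]
  simp only [Function.comp_def, factor_vertexMap, factorDim_map, vertexMap_lt]

lemma coeff_map (w : Fin (m + 1) → Fin (n + 1)) (f : Fin (m' + 1) ↪o Fin (m + 1)) {k : ℕ}
    (ω : SimplexCochain R w k) (c : Finset (Vertex m' n)) :
    coeff ω (c.map (vertexMap n f)) = coeff (pullback w f ω) c := by
  unfold coeff
  by_cases h : IsFace (fun j => w (f j)) k c
  · rw [dif_pos h, dif_pos ((isFace_map w f k c).2 h)]; rfl
  · rw [dif_neg h, dif_neg (mt (isFace_map w f k c).1 h)]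

lemma pullback_simplexDiff (w : Fin (m + 1) → Fin (n + 1)) (f : Fin (m' + 1) ↪o Fin (m + 1))
    {k : ℕ} (ω : SimplexCochain R w k) :
    pullback w f (simplexDiff w k ω) = simplexDiff (fun j => w (f j)) k (pullback w f ω) := by
  funext c
  change ∑ v ∈ c.1.map (vertexMap n f), _ = ∑ v ∈ c.1, _
  rw [Finset.sum_map]
  refine Finset.sum_congr rfl fun v _ => ?_
  dsimp only
  rw [signExp_map, ← Finset.map_erase, coeff_map]

/-! ### Perverse degree on a weighted simplex -/

/-- The perverse degree of `1_c`, `c = (F, ε)`, with respect to the index `i = n - ℓ`: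
`-∞` if `ε_i = 1`, and `|(F, ε)|_{> i}` if `ε_i = 0`. -/
def faceDegree (w : Fin (m + 1) → Fin (n + 1)) (i : Fin n) (c : Finset (Vertex m n)) : ExtInt :=
  if virtualVertex m i ∈ c then ⊥
  else (((∑ j ∈ Finset.univ.filter fun j => i.castSucc < j, factorDim w c j : ℕ) : ℤ) :
    WithTop ℤ)

/-- The `ℓ`-perverse degree of a cochain of a weighted simplex, where `i = n - ℓ`: the largest
perverse degree of the basis elements with a nonzero coefficient, `-∞` for the zero cochain. -/
noncomputable def simplexDegree {w : Fin (m + 1) → Fin (n + 1)} {k : ℕ} (i : Fin n)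
    (ω : SimplexCochain R w k) : ExtInt :=
  ⨆ (c : Face w k) (_ : ω c ≠ 0), faceDegree w i c.1

end Simplex

/-! ### Filtered singular simplices -/

/-- A regular filtered singular simplex `σ : Δ = Δ_0 * … * Δ_n → X`: the vertices of `Δ` are
ordered compatibly with the decomposition, `σ⁻¹(X_i) = Δ_0 * … * Δ_i`, and `Δ_n ≠ ∅`. -/
structure RegularSimplex (𝓕 : Filtration X n) where
  dim : ℕ
  map : C(stdSimplex ℝ (Fin (dim + 1)), X)
  weight : Fin (dim + 1) → Fin (n + 1)
  monotone_weight : Monotone weight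
  map_mem_level : ∀ (i : Fin (n + 1)) (x : stdSimplex ℝ (Fin (dim + 1))),
    map x ∈ 𝓕.level i ↔ ∀ j, x j ≠ 0 → weight j ≤ i
  regular : ∃ j, weight j = Fin.last n

variable {𝓕 : Filtration X n}

/-- The image of a simplex. -/
def RegularSimplex.image (σ : RegularSimplex 𝓕) : Set X := Set.range σ.map

lemma map_apply_ne_zero {m m' : ℕ} (f : Fin (m' + 1) ↪o Fin (m + 1))
    (x : stdSimplex ℝ (Fin (m' + 1))) (j : Fin (m + 1)) :
    stdSimplex.map f x j ≠ 0 ↔ ∃ i, f i = j ∧ x i ≠ 0 := by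
  rw [stdSimplex.map_coe, FunOnFinite.linearMap_apply_apply]
  rw [Ne, Finset.sum_eq_zero_iff_of_nonneg fun i _ => stdSimplex.zero_le x i]
  simp

/-- The regular face `σ ∘ f` of a regular simplex. -/
noncomputable def RegularSimplex.face (σ : RegularSimplex 𝓕) {m' : ℕ} (f : Fin (m' + 1) ↪o Fin (σ.dim + 1))
    (hf : ∃ j, σ.weight (f j) = Fin.last n) : RegularSimplex 𝓕 where
  dim := m'
  map := σ.map.comp ⟨stdSimplex.map f, stdSimplex.continuous_map f⟩
  weight j := σ.weight (f j)
  monotone_weight := σ.monotone_weight.comp f.monotone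
  map_mem_level i x := by
    refine (σ.map_mem_level i (stdSimplex.map f x)).trans ?_
    simp only [map_apply_ne_zero]
    constructor
    · exact fun h j hj => h _ ⟨j, rfl, hj⟩
    · rintro h _ ⟨j, rfl, hj⟩
      exact h j hj
  regular := hf

/-- The `𝒰`-small simplices: regular simplices with image contained in a member of `𝒰`. -/
def small (𝓕 : Filtration X n) (𝒰 : Set (Set X)) : Set (RegularSimplex 𝓕) :=
  {σ | ∃ U ∈ 𝒰, σ.image ⊆ U}

/-! ### The blown-up complexes

They are defined relative to a set `P` of regular simplices, which will be the set of all regular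
simplices, or the set of all `𝒰`-small ones. -/

section Cochains

variable (R : Type*) [CommRing R]

/-- The blown-up cochains of degree `k` on the simplices of `P`: families `(ω_σ)_{σ ∈ P}`,
compatible with the regular face operators. -/
def cochains (P : Set (RegularSimplex 𝓕)) (k : ℕ) :
    Submodule R (∀ σ : P, SimplexCochain R σ.1.weight k) where
  carrier := {ω | ∀ (σ : P) (m' : ℕ) (f : Fin (m' + 1) ↪o Fin (σ.1.dim + 1))
    (hf : ∃ j, σ.1.weight (f j) = Fin.last n) (hP : σ.1.face f hf ∈ P),
    pullback σ.1.weight f (ω σ) = ω ⟨σ.1.face f hf, hP⟩}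
  add_mem' {ω η} hω hη σ m' f hf hP := by
    have h1 := hω σ m' f hf hP
    have h2 := hη σ m' f hf hP
    rw [Pi.add_apply, Pi.add_apply, ← h1, ← h2]
    rfl
  zero_mem' _ _ _ _ _ := rfl
  smul_mem' r ω hω σ m' f hf hP := by
    have h1 := hω σ m' f hf hP
    rw [Pi.smul_apply, Pi.smul_apply, ← h1]
    rfl

variable {R}

/-- The differential `(δω)_σ = δ(ω_σ)`. -/
def diff (P : Set (RegularSimplex 𝓕)) (k : ℕ) : cochains R P k →ₗ[R] cochains R P (k + 1) where
  toFun ω := ⟨fun σ => simplexDiff σ.1.weight k (ω.1 σ), fun σ m' f hf hP => by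
    dsimp only
    rw [pullback_simplexDiff, ω.2 σ m' f hf hP]
    rfl⟩
  map_add' ω η := by
    ext1; funext σ; exact map_add (simplexDiff σ.1.weight k) (ω.1 σ) (η.1 σ)
  map_smul' r ω := by
    ext1; funext σ; exact map_smul (simplexDiff σ.1.weight k) r (ω.1 σ)

lemma diff_diff (P : Set (RegularSimplex 𝓕)) (k : ℕ) (ω : cochains R P k) :
    diff P (k + 1) (diff P k ω) = 0 := by
  ext1; funext σ; exact simplexDiff_simplexDiff _ _ _

/-- The perverse degree `‖ω‖_S` along a singular stratum `S`: the supremum of the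
`codim S`-perverse degrees of the `ω_σ`, for the simplices `σ` meeting `S`. By convention,
`‖ω‖_S = 0` for a regular stratum. -/
noncomputable def perverseDegree {P : Set (RegularSimplex 𝓕)} {k : ℕ} (ω : cochains R P k)
    (S : Stratum 𝓕) : ExtInt :=
  open Classical in
  if h : S.dim = Fin.last n then 0
  else ⨆ (σ : P) (_ : (σ.1.image ∩ S.carrier).Nonempty), simplexDegree (S.dim.castPred h) (ω.1 σ)

/-- A cochain is `p`-allowable if `‖ω‖ ≤ p`. -/
def IsAllowable (p : Perversity 𝓕) {P : Set (RegularSimplex 𝓕)} {k : ℕ}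
    (ω : cochains R P k) : Prop :=
  ∀ S : Stratum 𝓕, perverseDegree ω S ≤ p.toFun S

lemma isAllowable_iff (p : Perversity 𝓕) {P : Set (RegularSimplex 𝓕)} {k : ℕ}
    (ω : cochains R P k) :
    IsAllowable p ω ↔ ∀ (S : Stratum 𝓕) (h : S.dim ≠ Fin.last n) (σ : P),
      (σ.1.image ∩ S.carrier).Nonempty → ∀ c : Face σ.1.weight k, ω.1 σ c ≠ 0 →
        faceDegree σ.1.weight (S.dim.castPred h) c.1 ≤ p.toFun S := by
  unfold IsAllowable
  refine forall_congr' fun S => ?_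
  unfold perverseDegree
  split_ifs with h
  · simp [h, p.regular S h]
  · simp only [simplexDegree, iSup_le_iff, ne_eq, h, not_false_eq_true, forall_true_left]

variable (R)

/-- The `p`-intersection cochains of degree `k`: those with `ω` and `δω` allowable. -/
def intersectionCochains (p : Perversity 𝓕) (P : Set (RegularSimplex 𝓕)) (k : ℕ) :
    Submodule R (cochains R P k) where
  carrier := {ω | IsAllowable p ω ∧ IsAllowable p (diff P k ω)}
  add_mem' {ω η} hω hη := by
    have key : ∀ {k : ℕ} (a b : cochains R P k), IsAllowable p a → IsAllowable p b →
        IsAllowable p (a + b) := by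
      intro k a b ha hb
      rw [isAllowable_iff] at ha hb ⊢
      intro S h σ hσ c hc
      by_cases h0 : a.1 σ c = 0
      · refine hb S h σ hσ c fun h1 => hc ?_
        change a.1 σ c + b.1 σ c = 0
        rw [h0, h1, add_zero]
      · exact ha S h σ hσ c h0
    refine ⟨key _ _ hω.1 hη.1, ?_⟩
    rw [map_add]
    exact key _ _ hω.2 hη.2
  zero_mem' := by
    have key : ∀ k : ℕ, IsAllowable p (0 : cochains R P k) := fun k =>
      (isAllowable_iff p _).2 fun S h σ hσ c hc => absurd rfl hc
    refine ⟨key k, ?_⟩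
    rw [map_zero]
    exact key _
  smul_mem' r ω hω := by
    have key : ∀ {k : ℕ} (a : cochains R P k), IsAllowable p a → IsAllowable p (r • a) := by
      intro k a ha
      rw [isAllowable_iff] at ha ⊢
      intro S h σ hσ c hc
      refine ha S h σ hσ c fun h1 => hc ?_
      change r * a.1 σ c = 0
      rw [h1, mul_zero]
    refine ⟨key _ hω.1, ?_⟩
    rw [map_smul]
    exact key _ hω.2

/-- The differential of the complex of `p`-intersection cochains. -/
def intersectionDiff (p : Perversity 𝓕) (P : Set (RegularSimplex 𝓕)) (k : ℕ) :
    intersectionCochains R p P k →ₗ[R] intersectionCochains R p P (k + 1) :=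
  (diff P k).restrict fun ω hω => ⟨hω.2, by
    rw [diff_diff]; exact (intersectionCochains R p P (k + 2)).zero_mem.1⟩

/-- The cochain complex of `p`-intersection cochains on the simplices of `P`. -/
def intersectionComplex (p : Perversity 𝓕) (P : Set (RegularSimplex 𝓕)) :
    CochainComplex (ModuleCat R) ℕ :=
  CochainComplex.of (fun k => ModuleCat.of R (intersectionCochains R p P k))
    (fun k => ModuleCat.ofHom (intersectionDiff R p P k)) fun k => by
      refine ModuleCat.hom_ext (LinearMap.ext fun ω => Subtype.ext ?_)
      exact diff_diff P k ω.1

lemma intersectionComplex_d (p : Perversity 𝓕) (P : Set (RegularSimplex 𝓕)) (k : ℕ) :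
    (intersectionComplex R p P).d k (k + 1) = ModuleCat.ofHom (intersectionDiff R p P k) :=
  CochainComplex.of_d (fun k => ModuleCat.of R (intersectionCochains R p P k))
    (fun k => ModuleCat.ofHom (intersectionDiff R p P k)) k

/-- Restriction of cochains to a smaller set of simplices. -/
def restrictCochains {P Q : Set (RegularSimplex 𝓕)} (h : P ⊆ Q) (k : ℕ) :
    cochains R Q k →ₗ[R] cochains R P k where
  toFun ω := ⟨fun σ => ω.1 ⟨σ.1, h σ.2⟩, fun σ m' f hf hP => ω.2 ⟨σ.1, h σ.2⟩ m' f hf (h hP)⟩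
  map_add' _ _ := rfl
  map_smul' _ _ := rfl

lemma IsAllowable.restrict {p : Perversity 𝓕} {P Q : Set (RegularSimplex 𝓕)} (h : P ⊆ Q)
    {k : ℕ} {ω : cochains R Q k} (hω : IsAllowable p ω) :
    IsAllowable p (restrictCochains R h k ω) := by
  rw [isAllowable_iff] at hω ⊢
  exact fun S hS σ => hω S hS ⟨σ.1, h σ.2⟩

/-- Restriction of `p`-intersection cochains, as a map of complexes. -/
def restrict (p : Perversity 𝓕) {P Q : Set (RegularSimplex 𝓕)} (h : P ⊆ Q) :
    intersectionComplex R p Q ⟶ intersectionComplex R p P :=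
  CochainComplex.ofHom
    (fun k => ModuleCat.ofHom ((restrictCochains R h k).restrict fun _ hω =>
      ⟨hω.1.restrict R h, hω.2.restrict R h⟩))
    fun k => by
      rw [intersectionComplex_d, intersectionComplex_d]; rfl

/-- The complex of `p`-intersection cochains of `X`. -/
abbrev blownUpComplex (p : Perversity 𝓕) : CochainComplex (ModuleCat R) ℕ :=
  intersectionComplex R p Set.univ

/-- The complex of `𝒰`-small `p`-intersection cochains of `X`. -/
abbrev smallComplex (p : Perversity 𝓕) (𝒰 : Set (Set X)) : CochainComplex (ModuleCat R) ℕ :=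
  intersectionComplex R p (small 𝓕 𝒰)

/-- The restriction map from `p`-intersection cochains to `𝒰`-small ones. -/
abbrev restrictSmall (p : Perversity 𝓕) (𝒰 : Set (Set X)) :
    blownUpComplex R p ⟶ smallComplex R p 𝒰 :=
  restrict R p (Set.subset_univ _)

variable {R}

/-- The value `ω_σ` of an element of the complex of `p`-intersection cochains. -/
def value {p : Perversity 𝓕} {P : Set (RegularSimplex 𝓕)} {k : ℕ}
    (ω : (intersectionComplex R p P).X k) (σ : RegularSimplex 𝓕) (hσ : σ ∈ P) :
    SimplexCochain R σ.weight k :=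
  (show intersectionCochains R p P k from ω).1.1 ⟨σ, hσ⟩

end Cochains

end BlownUp

/-! By compatibility with faces, a cochain is the same thing as a function on cells, a cell being a
regular simplex together with the set `E` of those `i` whose apex `v_i` is used; every index outside
`E` must be the weight of some vertex. After the sign change `twist`, the tensor product
differential becomes the simplicial coboundary of the join of the simplex with the simplex on `E`
(`diff_fromCells`), so affine chains act on the simplex while `E` is kept fixed. Allowability says
that the function vanishes on the forbidden cells. An operator on functions on cells therefore
preserves allowability if its value at `c` only involves cells `Below` `c`: inside the image of `c`,
without new apexes, and, for each `i` that is not an apex of `c`, with at least as many vertices and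
apexes beyond `i` (`Cell.IsForbidden.of_below`).

The classical argument takes a number `N c` of subdivisions that makes `c` small, the homotopy
operator `T` from the identity to the `N c`-th subdivision, and `Φ = id - δT - Tδ`. Then `Φ f c` is
the value of `f` on the `N c`-th subdivision of `c`, plus corrections on the faces `c'` of `c` that
come from the homotopies between subdivisions `N c'` and `N c` (`subdivOp_apply`). Subdividing does
not increase the number of vertices of weight at most `i`, and a homotopy adds one vertex in all, so
the subdivision and `T` respect `Below`. The corrections need not: a face may lose a vertex beyond
`i` and the homotopy may add one of weight at most `i`.

The remedy is to work in stages `t = 0, …, n`. Stage `t` subdivides relative to the face of weight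
less than `t`, and its number of subdivisions is decided by the part of the simplex up to a level `≥
t` that is not an apex. For `i < t` the homotopy adds its vertex beyond `i`, which makes up for the
one lost. For `i ≥ t`, if `c'` has lost a vertex or apex beyond `i`, any number of subdivisions that
is good for `c'` is good for `c`, so there is no correction
(`Cell.Face.degreeAbove_le_of_not_good`).

Stage `t` passes from cells whose part of weight at most some non-apex `i ≥ t - 1` is small to the
same condition with `i ≥ t` (`partlySmall_of_good`). If `t > 0` and the cell is not yet small in the
new sense, then `t - 1` is not an apex. Hence every legal piece has a vertex of weight `t - 1`, and
it is enough to control pieces that meet the face of weight less than `t`. That face lies in one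
member of the cover, and by compactness so does a neighbourhood of it (`exists_goodAt_succ`). For `t
= 0` the Lebesgue number lemma is used.

The composite of all stages (`exists_subdivision`) is homotopic to the identity, fixes the values at
small cells and depends on these values alone. So it can be applied to a small cochain extended by
zero, and this gives the extension map (`exists_extension`). The inclusion of images in `Below`
gives the statement about supports. -/

namespace BlownUp

/-! ### Ordered chains and relative barycentric subdivision -/

section Chains

variable (R : Type*) [CommRing R] {P P' : Type*}

/-- Chains on ordered `q`-tuples of points. -/
abbrev TupleChain (P : Type*) (q : ℕ) : Type _ := (Fin q → P) →₀ R

/-- Append a vertex to a tuple. -/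
abbrev snoc {q : ℕ} (v : Fin q → P) (b : P) : Fin (q + 1) → P :=
  Fin.snoc (α := fun _ => P) v b

/-- The first vertices of a tuple. -/
abbrev initTuple {q : ℕ} (v : Fin (q + 1) → P) : Fin q → P :=
  Fin.init (α := fun _ => P) v

/-- The cone operator, which appends a last vertex. -/
noncomputable def cone (b : P) (q : ℕ) : TupleChain R P q →ₗ[R] TupleChain R P (q + 1) :=
  Finsupp.lmapDomain R R fun v => snoc v b

/-- The boundary of a tuple, the sign of a face being given by the number of vertices after the
omitted one. -/
noncomputable def tupleBoundary : ∀ q : ℕ, (Fin (q + 1) → P) → TupleChain R P q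
  | 0, v => Finsupp.single (initTuple v) 1
  | q + 1, v => Finsupp.single (initTuple v) 1 -
      cone R (v (Fin.last _)) q (tupleBoundary q (initTuple v))

/-- The boundary operator. -/
noncomputable def boundary (q : ℕ) : TupleChain R P (q + 1) →ₗ[R] TupleChain R P q :=
  Finsupp.linearCombination R (tupleBoundary R q)

@[simp] lemma cone_single (b : P) {q : ℕ} (v : Fin q → P) (r : R) :
    cone R b q (Finsupp.single v r) = Finsupp.single (snoc v b) r := by
  simp [cone, Finsupp.lmapDomain_apply]

@[simp] lemma boundary_single {q : ℕ} (v : Fin (q + 1) → P) :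
    boundary R q (Finsupp.single v 1) = tupleBoundary R q v := by
  simp [boundary]

/-- Chains are indexed by the number of vertices, so degree `0` is the empty tuple and the complex
is augmented; the cone formula has no second term there. -/
lemma boundary_cone_zero (b : P) (x : TupleChain R P 0) : boundary R 0 (cone R b 0 x) = x := by
  induction x using Finsupp.induction_linear with
  | zero => simp
  | add x y hx hy => rw [map_add, map_add, hx, hy]
  | single v r =>
    rw [← mul_one r, ← smul_eq_mul, ← Finsupp.smul_single, map_smul, map_smul, cone_single,
      boundary_single, tupleBoundary, initTuple, snoc, Fin.init_snoc]

/-- Counting signs from the last vertex makes this formula free of signs depending on the degree; it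
is the recursion that defines `tupleBoundary`. -/
lemma boundary_cone (b : P) {q : ℕ} (x : TupleChain R P (q + 1)) :
    boundary R (q + 1) (cone R b (q + 1) x) = x - cone R b q (boundary R q x) := by
  induction x using Finsupp.induction_linear with
  | zero => simp
  | add x y hx hy => simp only [map_add, hx, hy]; abel
  | single v r =>
    rw [← mul_one r, ← smul_eq_mul, ← Finsupp.smul_single]
    simp only [map_smul, ← smul_sub]
    congr 1
    rw [cone_single, boundary_single, boundary_single, tupleBoundary, initTuple, snoc,
      Fin.init_snoc, Fin.snoc_last]

/-- Induction on chains, over the single tuples. -/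
lemma tupleChain_induction {q : ℕ} {M : Type*} [AddCommGroup M] [Module R M]
    {F G : TupleChain R P q →ₗ[R] M}
    (h : ∀ v, F (Finsupp.single v 1) = G (Finsupp.single v 1)) : F = G :=
  Finsupp.lhom_ext' fun v => LinearMap.ext_ring (h v)

lemma snoc_initTuple {q : ℕ} (v : Fin (q + 1) → P) :
    snoc (initTuple v) (v (Fin.last q)) = v := Fin.snoc_init_self (α := fun _ => P) v

lemma boundary_boundary {q : ℕ} (x : TupleChain R P (q + 2)) :
    boundary R q (boundary R (q + 1) x) = 0 := by
  induction q with
  | zero =>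
    suffices h : boundary R 0 ∘ₗ boundary R 1 = (0 : TupleChain R P 2 →ₗ[R] _) from
      LinearMap.congr_fun h x
    refine tupleChain_induction R fun v => ?_
    rw [LinearMap.comp_apply, ← snoc_initTuple v, ← cone_single, boundary_cone, map_sub,
      boundary_cone_zero, sub_self, LinearMap.zero_apply]
  | succ q ih =>
    suffices h : boundary R (q + 1) ∘ₗ boundary R (q + 2) = (0 : TupleChain R P (q + 3) →ₗ[R] _) from
      LinearMap.congr_fun h x
    refine tupleChain_induction R fun v => ?_
    rw [LinearMap.comp_apply, ← snoc_initTuple v, ← cone_single, boundary_cone, map_sub,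
      boundary_cone, ih, map_zero, sub_zero, sub_self, LinearMap.zero_apply]

lemma initTuple_comp_succAbove {q : ℕ} (v : Fin (q + 2) → P) (j : Fin (q + 1)) :
    snoc (initTuple v ∘ j.succAbove) (v (Fin.last _)) = v ∘ j.castSucc.succAbove := by
  funext k
  refine Fin.lastCases ?_ (fun k => ?_) k
  · simp [snoc, Fin.succAbove_of_le_castSucc, Fin.le_last]
  · simp [snoc, initTuple, Fin.init, Fin.castSucc_succAbove_castSucc]

/-- The closed formula for the boundary. -/
lemma tupleBoundary_eq_sum {q : ℕ} (v : Fin (q + 1) → P) :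
    tupleBoundary R q v =
      ∑ j : Fin (q + 1), (-1 : R) ^ (q - j : ℕ) • Finsupp.single (v ∘ j.succAbove) 1 := by
  induction q with
  | zero => simp [tupleBoundary, initTuple, Function.comp_def, Subsingleton.elim _ (0 : Fin 1)]
  | succ q ih =>
    rw [tupleBoundary, ih, Fin.sum_univ_castSucc (n := q + 1), map_sum]
    simp only [map_smul, cone_single, initTuple_comp_succAbove]
    have h0 : v ∘ (Fin.last (q + 1)).succAbove = initTuple v := by
      funext k; simp [initTuple, Fin.init]
    rw [h0, sub_eq_neg_add, ← Finset.sum_neg_distrib]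
    congr 1
    · refine Finset.sum_congr rfl fun j _ => ?_
      rw [Fin.val_castSucc, show q + 1 - (j : ℕ) = (q - j) + 1 by omega, pow_succ, mul_neg_one, neg_smul]
    · simp

/-- A notion of barycentre together with the class of points that are kept when subdividing. -/
structure SubdivisionData (P : Type*) where
  bary : ∀ {q : ℕ}, (Fin (q + 1) → P) → P
  old : P → Prop

variable (S : SubdivisionData P)

open Classical in
/-- Barycentric subdivision relative to the simplices all of whose vertices are old. -/
noncomputable def subdiv : ∀ q : ℕ, TupleChain R P q →ₗ[R] TupleChain R P q
  | 0 => LinearMap.id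
  | q + 1 => Finsupp.linearCombination R fun v =>
      if ∀ j, S.old (v j) then Finsupp.single v 1
      else cone R (S.bary v) q (subdiv q (tupleBoundary R q v))

open Classical in
/-- The natural homotopy between the identity and the subdivision. -/
noncomputable def subdivHomotopy : ∀ q : ℕ, TupleChain R P q →ₗ[R] TupleChain R P (q + 1)
  | 0 => 0
  | q + 1 => Finsupp.linearCombination R fun v =>
      if ∀ j, S.old (v j) then 0
      else cone R (S.bary v) (q + 1)
        (Finsupp.single v 1 - subdivHomotopy q (tupleBoundary R q v))

variable {S}

lemma subdiv_single_of_old {q : ℕ} {v : Fin q → P} (h : ∀ j, S.old (v j)) :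
    subdiv R S q (Finsupp.single v 1) = Finsupp.single v 1 := by
  cases q with
  | zero => rfl
  | succ q => rw [subdiv, Finsupp.linearCombination_single, one_smul, if_pos h]

lemma subdiv_single {q : ℕ} {v : Fin (q + 1) → P} (h : ¬ ∀ j, S.old (v j)) :
    subdiv R S (q + 1) (Finsupp.single v 1) =
      cone R (S.bary v) q (subdiv R S q (tupleBoundary R q v)) := by
  rw [subdiv, Finsupp.linearCombination_single, one_smul, if_neg h]

lemma subdivHomotopy_single_of_old {q : ℕ} {v : Fin q → P} (h : ∀ j, S.old (v j)) :
    subdivHomotopy R S q (Finsupp.single v 1) = 0 := by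
  cases q with
  | zero => rfl
  | succ q => rw [subdivHomotopy, Finsupp.linearCombination_single, one_smul, if_pos h]

lemma subdivHomotopy_single {q : ℕ} {v : Fin (q + 1) → P} (h : ¬ ∀ j, S.old (v j)) :
    subdivHomotopy R S (q + 1) (Finsupp.single v 1) = cone R (S.bary v) (q + 1)
        (Finsupp.single v 1 - subdivHomotopy R S q (tupleBoundary R q v)) := by
  rw [subdivHomotopy, Finsupp.linearCombination_single, one_smul, if_neg h]

lemma subdiv_tupleBoundary_of_old {q : ℕ} {v : Fin (q + 1) → P} (h : ∀ j, S.old (v j)) :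
    subdiv R S q (tupleBoundary R q v) = tupleBoundary R q v := by
  rw [tupleBoundary_eq_sum, map_sum]
  refine Finset.sum_congr rfl fun j _ => ?_
  rw [map_smul, subdiv_single_of_old R (v := v ∘ j.succAbove) fun k => h _]

lemma subdivHomotopy_tupleBoundary_of_old {q : ℕ} {v : Fin (q + 1) → P}
    (h : ∀ j, S.old (v j)) : subdivHomotopy R S q (tupleBoundary R q v) = 0 := by
  rw [tupleBoundary_eq_sum, map_sum]
  refine Finset.sum_eq_zero fun j _ => ?_
  rw [map_smul, subdivHomotopy_single_of_old R (v := v ∘ j.succAbove) fun k => h _,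
    smul_zero]

/-- For a tuple `v` that is not old, the cone formula leaves `sd ∂v` minus a cone on `∂ sd ∂v`, and
the latter is `sd ∂∂v = 0` by induction. Old tuples have only old faces, and all of these are left
alone. -/
lemma boundary_subdiv {q : ℕ} (x : TupleChain R P (q + 1)) :
    boundary R q (subdiv R S (q + 1) x) = subdiv R S q (boundary R q x) := by
  induction q with
  | zero =>
    suffices h : boundary R 0 ∘ₗ subdiv R S 1 = subdiv R S 0 ∘ₗ boundary R 0 from
      LinearMap.congr_fun h x
    refine tupleChain_induction R fun v => ?_
    simp only [LinearMap.comp_apply, boundary_single]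
    by_cases h : ∀ j, S.old (v j)
    · rw [subdiv_single_of_old R h, boundary_single, subdiv_tupleBoundary_of_old R h]
    · rw [subdiv_single R h, boundary_cone_zero]
  | succ q ih =>
    suffices h : boundary R (q + 1) ∘ₗ subdiv R S (q + 2) = subdiv R S (q + 1) ∘ₗ boundary R (q + 1) from
      LinearMap.congr_fun h x
    refine tupleChain_induction R fun v => ?_
    simp only [LinearMap.comp_apply, boundary_single]
    by_cases h : ∀ j, S.old (v j)
    · rw [subdiv_single_of_old R h, boundary_single, subdiv_tupleBoundary_of_old R h]
    · rw [subdiv_single R h, boundary_cone, ih, ← boundary_single, boundary_boundary, map_zero,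
        map_zero, sub_zero]

lemma boundary_subdivHomotopy_zero (x : TupleChain R P 0) :
    boundary R 0 (subdivHomotopy R S 0 x) = x - subdiv R S 0 x := by
  simp [subdivHomotopy, subdiv]

lemma boundary_subdivHomotopy {q : ℕ} (x : TupleChain R P (q + 1)) :
    boundary R (q + 1) (subdivHomotopy R S (q + 1) x) +
      subdivHomotopy R S q (boundary R q x) = x - subdiv R S (q + 1) x := by
  -- The inductive step only needs `∂H∂v = ∂v - sd ∂v`: this is the trivial degree `0` identity at
  -- the start, and afterwards the induction hypothesis together with `∂∂ = 0`.
  have key : ∀ q, (∀ v : Fin (q + 1) → P,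
      boundary R q (subdivHomotopy R S q (tupleBoundary R q v)) =
        tupleBoundary R q v - subdiv R S q (tupleBoundary R q v)) →
      ∀ x : TupleChain R P (q + 1), boundary R (q + 1) (subdivHomotopy R S (q + 1) x) +
      subdivHomotopy R S q (boundary R q x) = x - subdiv R S (q + 1) x := by
    intro q hq x
    suffices h : boundary R (q + 1) ∘ₗ subdivHomotopy R S (q + 1) +
        subdivHomotopy R S q ∘ₗ boundary R q = LinearMap.id - subdiv R S (q + 1) from
      LinearMap.congr_fun h x
    refine tupleChain_induction R fun v => ?_
    simp only [LinearMap.add_apply, LinearMap.sub_apply, LinearMap.comp_apply, LinearMap.id_apply,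
      boundary_single]
    by_cases h : ∀ j, S.old (v j)
    · rw [subdiv_single_of_old R h, subdivHomotopy_single_of_old R h,
        subdivHomotopy_tupleBoundary_of_old R h, map_zero, sub_self, add_zero]
    · rw [subdiv_single R h, subdivHomotopy_single R h, boundary_cone, map_sub, hq,
        boundary_single, sub_sub_cancel]
      abel
  induction q with
  | zero => exact key 0 (fun v => boundary_subdivHomotopy_zero R _) x
  | succ q ih =>
    refine key _ (fun v => ?_) x
    rw [← ih, ← boundary_single, boundary_boundary, map_zero, add_zero]

/-! #### Naturality -/

variable {S' : SubdivisionData P'}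

/-- The map on chains induced by a map on points. -/
noncomputable def pushforward (h : P → P') (q : ℕ) : TupleChain R P q →ₗ[R] TupleChain R P' q :=
  Finsupp.lmapDomain R R fun v => h ∘ v

@[simp] lemma pushforward_single (h : P → P') {q : ℕ} (v : Fin q → P) (r : R) :
    pushforward R h q (Finsupp.single v r) = Finsupp.single (h ∘ v) r := by
  simp [pushforward, Finsupp.lmapDomain_apply]

lemma pushforward_cone (h : P → P') (b : P) {q : ℕ} (x : TupleChain R P q) :
    pushforward R h (q + 1) (cone R b q x) = cone R (h b) q (pushforward R h q x) := by
  suffices H : pushforward R h (q + 1) ∘ₗ cone R b q = cone R (h b) q ∘ₗ pushforward R h q from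
    LinearMap.congr_fun H x
  refine tupleChain_induction R fun v => ?_
  simp only [LinearMap.comp_apply, cone_single, pushforward_single, snoc, Fin.comp_snoc]

lemma pushforward_tupleBoundary (h : P → P') {q : ℕ} (v : Fin (q + 1) → P) :
    pushforward R h q (tupleBoundary R q v) = tupleBoundary R q (h ∘ v) := by
  simp only [tupleBoundary_eq_sum, map_sum, map_smul, pushforward_single, Function.comp_assoc]

/-- A map compatible with barycentres and old points. -/
structure IsSubdivisionMap (S : SubdivisionData P) (S' : SubdivisionData P') (h : P → P') :
    Prop where
  bary : ∀ {q : ℕ} (v : Fin (q + 1) → P), h (S.bary v) = S'.bary (h ∘ v)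
  old : ∀ x, S'.old (h x) ↔ S.old x

/-- Naturality allows the operators to be defined on the vertices of a standard simplex and then
evaluated on any affine simplex, in particular on faces. -/
lemma pushforward_subdiv {h : P → P'} (hh : IsSubdivisionMap S S' h) {q : ℕ}
    (x : TupleChain R P q) :
    pushforward R h q (subdiv R S q x) = subdiv R S' q (pushforward R h q x) := by
  induction q with
  | zero => rfl
  | succ q ih =>
    suffices H : pushforward R h (q + 1) ∘ₗ subdiv R S (q + 1) =
        subdiv R S' (q + 1) ∘ₗ pushforward R h (q + 1) from LinearMap.congr_fun H x
    refine tupleChain_induction R fun v => ?_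
    simp only [LinearMap.comp_apply, pushforward_single]
    by_cases hv : ∀ j, S.old (v j)
    · rw [subdiv_single_of_old R hv, pushforward_single,
        subdiv_single_of_old R (v := h ∘ v) fun j => (hh.old _).2 (hv j)]
    · rw [subdiv_single R hv, pushforward_cone, ih, pushforward_tupleBoundary, hh.bary,
        subdiv_single R (v := h ∘ v) fun H => hv fun j => (hh.old _).1 (H j)]

lemma pushforward_subdivHomotopy {h : P → P'} (hh : IsSubdivisionMap S S' h) {q : ℕ}
    (x : TupleChain R P q) : pushforward R h (q + 1) (subdivHomotopy R S q x) =
      subdivHomotopy R S' q (pushforward R h q x) := by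
  induction q with
  | zero => simp [subdivHomotopy]
  | succ q ih =>
    suffices H : pushforward R h (q + 2) ∘ₗ subdivHomotopy R S (q + 1) =
        subdivHomotopy R S' (q + 1) ∘ₗ pushforward R h (q + 1) from LinearMap.congr_fun H x
    refine tupleChain_induction R fun v => ?_
    simp only [LinearMap.comp_apply, pushforward_single]
    by_cases hv : ∀ j, S.old (v j)
    · rw [subdivHomotopy_single_of_old R hv, map_zero,
        subdivHomotopy_single_of_old R (v := h ∘ v) fun j => (hh.old _).2 (hv j)]
    · rw [subdivHomotopy_single R hv, pushforward_cone, map_sub, ih, pushforward_tupleBoundary,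
        hh.bary, pushforward_single,
        subdivHomotopy_single R (v := h ∘ v) fun H => hv fun j => (hh.old _).1 (H j)]

/-! #### Iteration -/

/-- The iterated subdivision. -/
noncomputable def iterSubdiv (S : SubdivisionData P) (M q : ℕ) :
    TupleChain R P q →ₗ[R] TupleChain R P q := (subdiv R S q) ^ M

/-- The homotopy between the identity and the `M`-th subdivision. -/
noncomputable def iterHomotopy (S : SubdivisionData P) (M q : ℕ) :
    TupleChain R P q →ₗ[R] TupleChain R P (q + 1) :=
  ∑ k ∈ Finset.range M, subdivHomotopy R S q ∘ₗ iterSubdiv R S k q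

lemma iterSubdiv_succ (M : ℕ) {q : ℕ} (x : TupleChain R P q) :
    iterSubdiv R S (M + 1) q x = subdiv R S q (iterSubdiv R S M q x) := by
  rw [iterSubdiv, pow_succ', Module.End.mul_apply]; rfl

lemma boundary_iterSubdiv (M : ℕ) {q : ℕ} (x : TupleChain R P (q + 1)) :
    boundary R q (iterSubdiv R S M (q + 1) x) = iterSubdiv R S M q (boundary R q x) := by
  induction M with
  | zero => rfl
  | succ M ih => rw [iterSubdiv_succ, boundary_subdiv, ih, iterSubdiv_succ]

lemma boundary_iterHomotopy (M : ℕ) {q : ℕ} (x : TupleChain R P (q + 1)) :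
    boundary R (q + 1) (iterHomotopy R S M (q + 1) x) + iterHomotopy R S M q (boundary R q x) =
      x - iterSubdiv R S M (q + 1) x := by
  simp only [iterHomotopy, LinearMap.sum_apply, LinearMap.comp_apply, map_sum,
    ← Finset.sum_add_distrib, ← boundary_iterSubdiv, boundary_subdivHomotopy]
  simp only [← iterSubdiv_succ]
  rw [Finset.sum_range_sub' (fun k => iterSubdiv R S k (q + 1) x)]
  rfl

lemma pushforward_iterSubdiv {h : P → P'} (hh : IsSubdivisionMap S S' h) (M : ℕ) {q : ℕ}
    (x : TupleChain R P q) :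
    pushforward R h q (iterSubdiv R S M q x) = iterSubdiv R S' M q (pushforward R h q x) := by
  induction M with
  | zero => rfl
  | succ M ih => rw [iterSubdiv_succ, pushforward_subdiv R hh, ih, iterSubdiv_succ]

lemma pushforward_iterHomotopy {h : P → P'} (hh : IsSubdivisionMap S S' h) (M : ℕ) {q : ℕ}
    (x : TupleChain R P q) : pushforward R h (q + 1) (iterHomotopy R S M q x) =
      iterHomotopy R S' M q (pushforward R h q x) := by
  simp only [iterHomotopy, LinearMap.sum_apply, LinearMap.comp_apply, map_sum,
    pushforward_subdivHomotopy R hh, pushforward_iterSubdiv R hh]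

/-! #### The tuples occurring in a subdivision -/

variable (S)

/-- The tuples that can occur in the subdivision of a tuple. -/
inductive SubdivPiece : ∀ {q : ℕ}, (Fin q → P) → (Fin q → P) → Prop
  | of_old {q : ℕ} (v : Fin q → P) (h : ∀ j, S.old (v j)) : SubdivPiece v v
  | cone {q : ℕ} (v : Fin (q + 1) → P) (j : Fin (q + 1)) (u : Fin q → P)
      (h : ¬ ∀ j, S.old (v j)) (hu : SubdivPiece (v ∘ j.succAbove) u) :
      SubdivPiece v (snoc u (S.bary v))

/-- The tuples that can occur in the homotopy between a tuple and its subdivision. -/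
inductive HomotopyPiece : ∀ {q : ℕ}, (Fin q → P) → (Fin (q + 1) → P) → Prop
  | base {q : ℕ} (v : Fin (q + 1) → P) (h : ¬ ∀ j, S.old (v j)) :
      HomotopyPiece v (snoc v (S.bary v))
  | cone {q : ℕ} (v : Fin (q + 1) → P) (j : Fin (q + 1)) (u : Fin (q + 1) → P)
      (h : ¬ ∀ j, S.old (v j)) (hu : HomotopyPiece (v ∘ j.succAbove) u) :
      HomotopyPiece v (snoc u (S.bary v))

/-- The tuples that can occur in the `M`-th subdivision of a tuple. -/
def IterPiece : ∀ (_ : ℕ) {q : ℕ}, (Fin q → P) → (Fin q → P) → Prop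
  | 0, _, v, u => u = v
  | M + 1, _, v, u => ∃ v', IterPiece M v v' ∧ SubdivPiece S v' u

variable {S}

lemma cone_mem_supported (b : P) {q : ℕ} {x : TupleChain R P q} {A : Set (Fin q → P)}
    {B : Set (Fin (q + 1) → P)} (hx : x ∈ Finsupp.supported R R A)
    (h : ∀ v ∈ A, snoc v b ∈ B) : cone R b q x ∈ Finsupp.supported R R B := by
  rw [Finsupp.mem_supported] at hx ⊢
  classical
  intro u hu
  obtain ⟨v, hv, rfl⟩ := Finset.mem_image.1 (Finsupp.mapDomain_support hu)
  exact h v (hx hv)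

lemma map_tupleBoundary_mem_supported {q l : ℕ} (F : TupleChain R P q →ₗ[R] TupleChain R P l)
    (v : Fin (q + 1) → P) {A : Set (Fin l → P)}
    (h : ∀ j : Fin (q + 1), F (Finsupp.single (v ∘ j.succAbove) 1) ∈ Finsupp.supported R R A) :
    F (tupleBoundary R q v) ∈ Finsupp.supported R R A := by
  rw [tupleBoundary_eq_sum, map_sum]
  refine Submodule.sum_mem _ fun j _ => ?_
  rw [map_smul]
  exact Submodule.smul_mem _ _ (h j)

lemma map_mem_supported {q l : ℕ} (F : TupleChain R P q →ₗ[R] TupleChain R P l)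
    {A : Set (Fin q → P)} {B : Set (Fin l → P)} {x : TupleChain R P q}
    (hx : x ∈ Finsupp.supported R R A)
    (h : ∀ v ∈ A, F (Finsupp.single v 1) ∈ Finsupp.supported R R B) :
    F x ∈ Finsupp.supported R R B := by
  rw [Finsupp.supported_eq_span_single] at hx
  have : Submodule.span R ((fun v => Finsupp.single v (1 : R)) '' A) ≤
      (Finsupp.supported R R B).comap F := by
    rw [Submodule.span_le]
    rintro _ ⟨v, hv, rfl⟩
    exact h v hv
  exact this hx

/-- Coefficients are forgotten here: weights, counts and mesh are then studied by induction on the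
pieces, without chains. -/
lemma subdiv_mem_supported {q : ℕ} (v : Fin q → P) :
    subdiv R S q (Finsupp.single v 1) ∈ Finsupp.supported R R {u | SubdivPiece S v u} := by
  induction q with
  | zero => exact Finsupp.single_mem_supported R _ (SubdivPiece.of_old v fun j => j.elim0)
  | succ q ih =>
    by_cases h : ∀ j, S.old (v j)
    · rw [subdiv_single_of_old R h]
      exact Finsupp.single_mem_supported R _ (SubdivPiece.of_old v h)
    · rw [subdiv_single R h]
      refine cone_mem_supported R _ (A := {u | ∃ j, SubdivPiece S (v ∘ Fin.succAbove j) u})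
        (map_tupleBoundary_mem_supported R _ v fun j => ?_) ?_
      · exact Finsupp.supported_mono
          (show {u | SubdivPiece S (v ∘ j.succAbove) u} ⊆
            {u | ∃ j, SubdivPiece S (v ∘ Fin.succAbove j) u} from fun u hu => ⟨j, hu⟩) (ih _)
      · rintro u ⟨j, hu⟩
        exact SubdivPiece.cone v j u h hu

lemma subdivHomotopy_mem_supported {q : ℕ} (v : Fin q → P) :
    subdivHomotopy R S q (Finsupp.single v 1) ∈
      Finsupp.supported R R {u | HomotopyPiece S v u} := by
  induction q with
  | zero => exact Submodule.zero_mem _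
  | succ q ih =>
    by_cases h : ∀ j, S.old (v j)
    · rw [subdivHomotopy_single_of_old R h]
      exact Submodule.zero_mem _
    · rw [subdivHomotopy_single R h]
      refine cone_mem_supported R _
        (A := {u | u = v ∨ ∃ j, HomotopyPiece S (v ∘ Fin.succAbove j) u})
        (Submodule.sub_mem _ (Finsupp.single_mem_supported R _ (Or.inl rfl))
          (map_tupleBoundary_mem_supported R _ v fun j => ?_)) ?_
      · exact Finsupp.supported_mono (fun u hu => Or.inr ⟨j, hu⟩) (ih _)
      · rintro u (rfl | ⟨j, hu⟩)
        · exact HomotopyPiece.base u h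
        · exact HomotopyPiece.cone v j u h hu

lemma iterSubdiv_mem_supported (M : ℕ) {q : ℕ} (v : Fin q → P) :
    iterSubdiv R S M q (Finsupp.single v 1) ∈ Finsupp.supported R R {u | IterPiece S M v u} := by
  induction M with
  | zero => exact Finsupp.single_mem_supported R _ rfl
  | succ M ih =>
    rw [iterSubdiv_succ]
    refine map_mem_supported R _ ih fun u hu => ?_
    exact Finsupp.supported_mono
      (show {u' | SubdivPiece S u u'} ⊆ {u | IterPiece S (M + 1) v u} from fun u' hu' => ⟨u, hu, hu'⟩)
      (subdiv_mem_supported R u)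

end Chains

end BlownUp

namespace BlownUp

/-! ### Affine simplices in a weighted simplex -/

section Affine

/-- The standard simplex of dimension `m`. -/
abbrev Spx (m : ℕ) : Type := stdSimplex ℝ (Fin (m + 1))

variable {m q l n : ℕ}

/-- `x` lies in the convex hull of the tuple `v`. -/
def Spanned (v : Fin q → Spx m) (x : Spx m) : Prop :=
  ∃ y : Fin q → ℝ, (∀ k, 0 ≤ y k) ∧ ∑ k, y k = 1 ∧ ∀ j, x j = ∑ k, y k * v k j

lemma spanned_apply (v : Fin q → Spx m) (k : Fin q) : Spanned v (v k) :=
  ⟨Pi.single k 1, fun l => by by_cases h : l = k <;> simp [h],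
    by simp, fun j => by simp [Pi.single_apply]⟩

lemma Spanned.trans {u : Fin l → Spx m} {v : Fin q → Spx m} {x : Spx m} (hx : Spanned v x)
    (hv : ∀ k, Spanned u (v k)) : Spanned u x := by
  obtain ⟨y, hy0, hy1, hy⟩ := hx
  choose z hz0 hz1 hz using hv
  refine ⟨fun a => ∑ k, y k * z k a,
    fun a => Finset.sum_nonneg fun k _ => mul_nonneg (hy0 k) (hz0 k a), ?_, fun j => ?_⟩
  · rw [Finset.sum_comm]
    simp only [← Finset.mul_sum, hz1, mul_one, hy1]
  · rw [hy]
    simp only [hz, Finset.mul_sum, Finset.sum_mul]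
    rw [Finset.sum_comm]
    simp only [mul_assoc]

/-- The affine map of standard simplices with prescribed values at the vertices. -/
noncomputable def aff (v : Fin (q + 1) → Spx m) (y : Spx q) : Spx m :=
  ⟨fun j => ∑ k, y k * v k j,
    fun j => Finset.sum_nonneg fun k _ =>
      mul_nonneg (stdSimplex.zero_le y k) (stdSimplex.zero_le (v k) j), by
    rw [Finset.sum_comm]
    simp only [← Finset.mul_sum, stdSimplex.sum_eq_one, mul_one]⟩

lemma aff_apply (v : Fin (q + 1) → Spx m) (y : Spx q) (j : Fin (m + 1)) :
    aff v y j = ∑ k, y k * v k j := rfl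

lemma continuous_aff (v : Fin (q + 1) → Spx m) : Continuous (aff v) := by
  refine Continuous.subtype_mk (continuous_pi fun j => continuous_finsetSum _ fun k _ => ?_) _
  exact ((continuous_apply k).comp continuous_subtype_val).mul continuous_const

lemma aff_vertex (v : Fin (q + 1) → Spx m) (k : Fin (q + 1)) :
    aff v (stdSimplex.vertex k) = v k := by
  ext j
  simp [aff_apply, Pi.single_apply]

lemma aff_aff (v : Fin (q + 1) → Spx m) (u : Fin (l + 1) → Spx q) (y : Spx l) :
    aff v (aff u y) = aff (aff v ∘ u) y := by
  ext j
  simp only [aff_apply, Function.comp_apply, Finset.sum_mul, Finset.mul_sum]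
  rw [Finset.sum_comm]
  simp only [mul_assoc]

lemma spanned_aff (v : Fin (q + 1) → Spx m) (y : Spx q) : Spanned v (aff v y) :=
  ⟨y, stdSimplex.zero_le y, stdSimplex.sum_eq_one y, aff_apply v y⟩

/-- The tuple of all vertices. -/
def vertices (m : ℕ) : Fin (m + 1) → Spx m := fun j => stdSimplex.vertex j

lemma aff_vertices_comp (f : Fin (q + 1) → Fin (m + 1)) (y : Spx q) :
    aff (vertices m ∘ f) y = stdSimplex.map f y := by
  ext j
  rw [aff_apply, stdSimplex.map_coe, FunOnFinite.linearMap_apply_apply]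
  simp [vertices, Pi.single_apply, Finset.sum_filter, eq_comm]

lemma aff_vertices (y : Spx m) : aff (vertices m) y = y := by
  have := aff_vertices_comp (id : Fin (m + 1) → Fin (m + 1)) y
  rwa [stdSimplex.map_id_apply] at this

lemma aff_comp_vertices (v : Fin (q + 1) → Spx m) : aff v ∘ vertices q = v :=
  funext fun k => aff_vertex v k

lemma Spanned.map {v : Fin q → Spx m} {x : Spx m} (h : Spanned v x) (u : Fin (m + 1) → Spx l) :
    Spanned (aff u ∘ v) (aff u x) := by
  obtain ⟨y, hy0, hy1, hy⟩ := h
  refine ⟨y, hy0, hy1, fun j => ?_⟩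
  simp only [aff_apply, Function.comp_apply, hy, Finset.sum_mul, Finset.mul_sum]
  rw [Finset.sum_comm]
  simp only [mul_assoc]

variable (w : Fin (m + 1) → Fin (n + 1))

/-- The weight of a point: the largest weight of a vertex of its carrier. -/
noncomputable def wt (x : Spx m) : Fin (n + 1) := (Finset.univ.filter fun j => x j ≠ 0).sup w

variable {w}

lemma wt_le_iff {x : Spx m} {i : Fin (n + 1)} : wt w x ≤ i ↔ ∀ j, x j ≠ 0 → w j ≤ i := by
  simp [wt, Finset.sup_le_iff]

lemma exists_apply_ne_zero (x : Spx m) : ∃ j, x j ≠ 0 := by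
  by_contra! h
  have := stdSimplex.sum_eq_one x
  simp [h] at this

lemma exists_weight_eq_wt (x : Spx m) : ∃ j, x j ≠ 0 ∧ w j = wt w x := by
  obtain ⟨j, hj, h⟩ := Finset.exists_mem_eq_sup (Finset.univ.filter fun j => x j ≠ 0)
    (by obtain ⟨j, hj⟩ := exists_apply_ne_zero x; exact ⟨j, by simpa using hj⟩) w
  exact ⟨j, by simpa using hj, h.symm⟩

lemma wt_vertices (j : Fin (m + 1)) : wt w (vertices m j) = w j := by
  refine eq_of_forall_ge_iff fun i => ?_
  simp [wt_le_iff, vertices, Pi.single_apply]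

/-- Nonnegative terms cannot cancel, so the carrier of a convex combination is the union of the
carriers of the points that have a nonzero coefficient. -/
lemma wt_le_iff_of_eq_sum {v : Fin q → Spx m} {x : Spx m} {y : Fin q → ℝ} (hy0 : ∀ k, 0 ≤ y k)
    (hy : ∀ j, x j = ∑ k, y k * v k j) {i : Fin (n + 1)} :
    wt w x ≤ i ↔ ∀ k, y k ≠ 0 → wt w (v k) ≤ i := by
  simp only [wt_le_iff, hy]
  have h : ∀ j, ∑ k, y k * v k j ≠ 0 ↔ ∃ k, y k ≠ 0 ∧ v k j ≠ 0 := fun j => by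
    rw [Ne, Finset.sum_eq_zero_iff_of_nonneg fun k _ =>
      mul_nonneg (hy0 k) (stdSimplex.zero_le (v k) j)]
    simp
  simp only [h]
  exact ⟨fun H k hk j hj => H j ⟨k, hk, hj⟩, fun H j ⟨k, hk, hj⟩ => H k hk j hj⟩

lemma wt_aff_le_iff {v : Fin (q + 1) → Spx m} {y : Spx q} {i : Fin (n + 1)} :
    wt w (aff v y) ≤ i ↔ ∀ k, y k ≠ 0 → wt w (v k) ≤ i :=
  wt_le_iff_of_eq_sum (stdSimplex.zero_le y) (aff_apply v y)

lemma wt_aff (v : Fin (q + 1) → Spx m) (y : Spx q) :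
    wt w (aff v y) = wt (fun k => wt w (v k)) y :=
  eq_of_forall_ge_iff fun _ => wt_aff_le_iff.trans wt_le_iff.symm

lemma Spanned.wt_le {v : Fin q → Spx m} {x : Spx m} (h : Spanned v x) {i : Fin (n + 1)}
    (hv : ∀ k, wt w (v k) ≤ i) : wt w x ≤ i := by
  obtain ⟨y, hy0, -, hy⟩ := h
  exact (wt_le_iff_of_eq_sum hy0 hy).2 fun k _ => hv k

/-! ### Relative barycentric subdivision and its effect on weights. -/

variable (w)

/-- Barycentric subdivision relative to the face of the vertices of weight less than `t`. -/
noncomputable def relData (t : ℕ) : SubdivisionData (Spx m) where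
  bary v := aff v stdSimplex.barycenter
  old x := (wt w x : ℕ) < t

lemma isSubdivisionMap_aff (t : ℕ) (v : Fin (q + 1) → Spx m) :
    IsSubdivisionMap (relData (fun k => wt w (v k)) t) (relData w t) (aff v) where
  bary u := aff_aff v u _
  old x := by simp [relData, wt_aff]

variable {w} {t : ℕ}

lemma barycenter_pos (k : Fin (q + 1)) : 0 < (stdSimplex.barycenter : Spx q) k := by
  change (0 : ℝ) < (Fintype.card (Fin (q + 1)) : ℝ)⁻¹
  positivity

/-- All coordinates of the barycentre are positive, so its weight is the largest weight in the
tuple. -/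
lemma wt_bary_le_iff {v : Fin (q + 1) → Spx m} {i : Fin (n + 1)} :
    wt w ((relData w t).bary v) ≤ i ↔ ∀ k, wt w (v k) ≤ i := by
  change wt w (aff v _) ≤ i ↔ _
  rw [wt_aff_le_iff]
  exact ⟨fun h k => h k (barycenter_pos k).ne', fun h k _ => h k⟩

lemma wt_le_wt_bary (v : Fin (q + 1) → Spx m) (k : Fin (q + 1)) :
    wt w (v k) ≤ wt w ((relData w t).bary v) := wt_bary_le_iff.1 le_rfl k

lemma exists_wt_eq_wt_bary (v : Fin (q + 1) → Spx m) :
    ∃ k, wt w (v k) = wt w ((relData w t).bary v) := by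
  change ∃ k, wt w (v k) = wt w (aff v _)
  rw [wt_aff]
  obtain ⟨k, -, hk⟩ := exists_weight_eq_wt (w := fun k => wt w (v k)) (stdSimplex.barycenter : Spx q)
  exact ⟨k, hk⟩

/-! #### Properties of the pieces of a subdivision -/

lemma forall_snoc {P : Type*} {v : Fin q → P} {b : P} {p : P → Prop} :
    (∀ k, p (snoc v b k)) ↔ (∀ k, p (v k)) ∧ p b := by
  rw [Fin.forall_fin_succ']
  simp [snoc]

lemma monotone_snoc {u : Fin q → Spx m} {b : Spx m} (hu : Monotone (wt w ∘ u))
    (hb : ∀ k, wt w (u k) ≤ wt w b) : Monotone (wt w ∘ snoc u b) := by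
  intro a
  refine Fin.lastCases (fun c hc => ?_) (fun a c => ?_) a
  · rw [Fin.last_le_iff.1 hc]
  · refine Fin.lastCases (fun _ => ?_) (fun c hc => ?_) c
    · simpa [snoc] using hb a
    · simpa [snoc] using hu (Fin.castSucc_le_castSucc_iff.1 hc)

lemma Spanned.of_face {v : Fin (q + 1) → Spx m} {j : Fin (q + 1)} {x : Spx m}
    (h : Spanned (v ∘ j.succAbove) x) : Spanned v x :=
  h.trans fun _ => spanned_apply v _

lemma SubdivPiece.spanned {v u : Fin q → Spx m} (h : SubdivPiece (relData w t) v u) :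
    ∀ k, Spanned v (u k) := by
  induction h with
  | of_old v h => exact spanned_apply v
  | cone v j u h hu ih => exact forall_snoc.2 ⟨fun k => (ih k).of_face, spanned_aff v _⟩

lemma HomotopyPiece.spanned {v : Fin q → Spx m} {u : Fin (q + 1) → Spx m}
    (h : HomotopyPiece (relData w t) v u) : ∀ k, Spanned v (u k) := by
  induction h with
  | base v h => exact forall_snoc.2 ⟨spanned_apply v, spanned_aff v _⟩
  | cone v j u h hu ih => exact forall_snoc.2 ⟨fun k => (ih k).of_face, spanned_aff v _⟩

/-- The barycentre has the largest weight, and the cone operator appends it last; so the vertex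
order stays compatible with the filtration. -/
lemma SubdivPiece.monotone {v u : Fin q → Spx m} (h : SubdivPiece (relData w t) v u)
    (hv : Monotone (wt w ∘ v)) : Monotone (wt w ∘ u) := by
  induction h with
  | of_old v h => exact hv
  | cone v j u h hu ih =>
    exact monotone_snoc (ih (hv.comp (Fin.strictMono_succAbove j).monotone)) fun k =>
      (hu.spanned k).of_face.wt_le fun k => wt_le_wt_bary v k

lemma HomotopyPiece.monotone {v : Fin q → Spx m} {u : Fin (q + 1) → Spx m}
    (h : HomotopyPiece (relData w t) v u) (hv : Monotone (wt w ∘ v)) : Monotone (wt w ∘ u) := by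
  induction h with
  | base v h => exact monotone_snoc hv (wt_le_wt_bary v)
  | cone v j u h hu ih =>
    exact monotone_snoc (ih (hv.comp (Fin.strictMono_succAbove j).monotone)) fun k =>
      (hu.spanned k).of_face.wt_le fun k => wt_le_wt_bary v k

/-- A weight missing from a tuple is missing from all its pieces: illegal tuples only produce
illegal pieces. -/
lemma SubdivPiece.exists_wt_eq {v u : Fin q → Spx m} (h : SubdivPiece (relData w t) v u) :
    ∀ k, ∃ l, wt w (v l) = wt w (u k) := by
  induction h with
  | of_old v h => exact fun k => ⟨k, rfl⟩
  | cone v j u h hu ih =>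
    exact (forall_snoc (p := fun x => ∃ l, wt w (v l) = wt w x)).2
      ⟨fun k => let ⟨l, hl⟩ := ih k; ⟨_, hl⟩, exists_wt_eq_wt_bary v⟩

lemma HomotopyPiece.exists_wt_eq {v : Fin q → Spx m} {u : Fin (q + 1) → Spx m}
    (h : HomotopyPiece (relData w t) v u) : ∀ k, ∃ l, wt w (v l) = wt w (u k) := by
  induction h with
  | base v h =>
    exact (forall_snoc (p := fun x => ∃ l, wt w (v l) = wt w x)).2
      ⟨fun k => ⟨k, rfl⟩, exists_wt_eq_wt_bary v⟩
  | cone v j u h hu ih =>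
    exact (forall_snoc (p := fun x => ∃ l, wt w (v l) = wt w x)).2
      ⟨fun k => let ⟨l, hl⟩ := ih k; ⟨_, hl⟩, exists_wt_eq_wt_bary v⟩

/-- The number of entries of weight at most `i`. -/
noncomputable def countLE (w : Fin (m + 1) → Fin (n + 1)) (i : Fin (n + 1)) (v : Fin q → Spx m) :
    ℕ := ∑ k, if wt w (v k) ≤ i then 1 else 0

lemma countLE_snoc (i : Fin (n + 1)) (v : Fin q → Spx m) (b : Spx m) :
    countLE w i (snoc v b) = countLE w i v + if wt w b ≤ i then 1 else 0 := by
  rw [countLE, Fin.sum_univ_castSucc]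
  simp [countLE, snoc]

lemma countLE_face (i : Fin (n + 1)) (v : Fin (q + 1) → Spx m) (j : Fin (q + 1)) :
    countLE w i v = (if wt w (v j) ≤ i then 1 else 0) + countLE w i (v ∘ j.succAbove) := by
  simp [countLE, Fin.sum_univ_succAbove _ j]

lemma countLE_face_le (i : Fin (n + 1)) (v : Fin (q + 1) → Spx m) (j : Fin (q + 1)) :
    countLE w i (v ∘ j.succAbove) ≤ countLE w i v := by
  rw [countLE_face i v j]; omega

lemma countLE_le (i : Fin (n + 1)) (v : Fin q → Spx m) : countLE w i v ≤ q := by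
  refine (Finset.sum_le_card_nsmul Finset.univ _ 1 fun k _ => ?_).trans (by simp)
  split_ifs <;> simp

lemma countLE_eq {i : Fin (n + 1)} {v : Fin q → Spx m} (h : ∀ k, wt w (v k) ≤ i) :
    countLE w i v = q := by
  simp [countLE, h]

/-- If the last barycentre has weight at most `i`, then so does all of `v`, and the bound is the
number of vertices. Otherwise the barycentre does not count and induction on a face applies. Since
the total number of vertices is unchanged, the number beyond `i` does not drop. -/
lemma SubdivPiece.countLE_le {v u : Fin q → Spx m} (h : SubdivPiece (relData w t) v u)
    (i : Fin (n + 1)) : countLE w i u ≤ countLE w i v := by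
  induction h with
  | of_old v h => exact le_rfl
  | cone v j u h hu ih =>
    by_cases hb : wt w ((relData w t).bary v) ≤ i
    · rw [countLE_eq (wt_bary_le_iff.1 hb)]
      exact BlownUp.countLE_le _ _
    · rw [countLE_snoc, if_neg hb]
      exact ih.trans (countLE_face_le i v j)

/-- There is one vertex more in all and at most one more of weight at most `i`, so again the number
beyond `i` does not drop. -/
lemma HomotopyPiece.countLE_le {v : Fin q → Spx m} {u : Fin (q + 1) → Spx m}
    (h : HomotopyPiece (relData w t) v u) (i : Fin (n + 1)) :
    countLE w i u ≤ countLE w i v + 1 := by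
  induction h with
  | base v h => rw [countLE_snoc]; split_ifs <;> omega
  | cone v j u h hu ih =>
    by_cases hb : wt w ((relData w t).bary v) ≤ i
    · rw [countLE_eq (wt_bary_le_iff.1 hb)]
      exact BlownUp.countLE_le _ _
    · rw [countLE_snoc, if_neg hb]
      exact ih.trans (by simpa using countLE_face_le i v j)

/-- Every barycentre that is added belongs to a tuple with a vertex of weight at least `t > i`, so
it lies beyond `i`: below the level of the stage the homotopy gains a vertex beyond `i`. -/
lemma HomotopyPiece.countLE_le_of_lt {v : Fin q → Spx m} {u : Fin (q + 1) → Spx m}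
    (h : HomotopyPiece (relData w t) v u) {i : Fin (n + 1)} (hi : (i : ℕ) < t) :
    countLE w i u ≤ countLE w i v := by
  have key : ∀ {q : ℕ} {v : Fin (q + 1) → Spx m} (_ : ¬ ∀ j, (relData w t).old (v j)),
      ¬ wt w ((relData w t).bary v) ≤ i := fun h hb =>
    h fun k => lt_of_le_of_lt (Fin.le_def.1 (wt_bary_le_iff.1 hb k)) hi
  induction h with
  | base v h => rw [countLE_snoc, if_neg (key h), add_zero]
  | cone v j u h hu ih =>
    rw [countLE_snoc, if_neg (key h), add_zero]
    exact ih.trans (countLE_face_le i v j)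

/-! ### Mesh of the relative subdivisions, measured in the coordinates of weight at least `t`. -/

/-- Two points are `ε`-close in the coordinates of weight at least `t`. -/
def Close (w : Fin (m + 1) → Fin (n + 1)) (t : ℕ) (ε : ℝ) (x y : Spx m) : Prop :=
  ∀ j, t ≤ (w j : ℕ) → |x j - y j| ≤ ε

lemma Close.symm {ε : ℝ} {x y : Spx m} (h : Close w t ε x y) : Close w t ε y x := fun j hj => by
  rw [abs_sub_comm]; exact h j hj

lemma Close.mono {ε ε' : ℝ} {x y : Spx m} (h : Close w t ε x y) (hε : ε ≤ ε') :
    Close w t ε' x y := fun j hj => (h j hj).trans hε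

lemma Spanned.close {v : Fin q → Spx m} {x y : Spx m} {ε : ℝ} (hx : Spanned v x)
    (h : ∀ k, Close w t ε (v k) y) : Close w t ε x y := by
  obtain ⟨z, hz0, hz1, hz⟩ := hx
  intro j hj
  have h1 : x j - y j = ∑ k, z k * (v k j - y j) := by
    simp only [mul_sub, Finset.sum_sub_distrib, ← Finset.sum_mul, hz1, one_mul, hz]
  rw [h1]
  calc |∑ k, z k * (v k j - y j)| ≤ ∑ k, |z k * (v k j - y j)| := Finset.abs_sum_le_sum_abs _ _
    _ ≤ ∑ k, z k * ε := Finset.sum_le_sum fun k _ => by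
        rw [abs_mul, abs_of_nonneg (hz0 k)]
        exact mul_le_mul_of_nonneg_left (h k j hj) (hz0 k)
    _ = ε := by rw [← Finset.sum_mul, hz1, one_mul]

/-- The usual factor `q/(q+1)`: of the `q + 1` differences averaged by the barycentre, the one with
`v l` itself is zero. -/
lemma close_bary {v : Fin (q + 1) → Spx m} {ε : ℝ} (h : ∀ k l, Close w t ε (v k) (v l))
    (l : Fin (q + 1)) :
    Close w t ((1 - 1 / (q + 1 : ℝ)) * ε) ((relData w t).bary v) (v l) := by
  intro j hj
  have hb : (relData w t).bary v j = ∑ k, (q + 1 : ℝ)⁻¹ * v k j := by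
    change ∑ k, (Fintype.card (Fin (q + 1)) : ℝ)⁻¹ * v k j = _
    simp
  have hq : (0 : ℝ) < q + 1 := by positivity
  have h1 : (relData w t).bary v j - v l j =
      (q + 1 : ℝ)⁻¹ * ∑ k ∈ Finset.univ.erase l, (v k j - v l j) := by
    rw [hb, ← Finset.mul_sum, Finset.sum_erase _ (sub_self _), Finset.sum_sub_distrib]
    simp
    field_simp
  rw [h1, abs_mul, abs_of_nonneg (by positivity)]
  have h2 : |∑ k ∈ Finset.univ.erase l, (v k j - v l j)| ≤ q * ε := by
    refine (Finset.abs_sum_le_sum_abs _ _).trans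
      ((Finset.sum_le_card_nsmul _ _ ε fun k _ => h k l j hj).trans ?_)
    simp
  calc (q + 1 : ℝ)⁻¹ * _ ≤ (q + 1 : ℝ)⁻¹ * (q * ε) :=
        mul_le_mul_of_nonneg_left h2 (by positivity)
    _ = _ := by field_simp; ring

/-- One bound `N` on the number of vertices of weight at most `i` serves all faces, so the
contraction factor stays the same along the induction. Vertices of larger weight play no part,
because a barycentre of weight at most `i` comes from a tuple of weight at most `i`. -/
lemma SubdivPiece.close {v u : Fin q → Spx m} (h : SubdivPiece (relData w t) v u)
    {i : Fin (n + 1)} {N : ℕ} (hN : 1 ≤ N) {ε : ℝ} (hε : 0 ≤ ε) (hc : countLE w i v ≤ N)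
    (hv : ∀ a b, wt w (v a) ≤ i → wt w (v b) ≤ i → Close w t ε (v a) (v b)) :
    ∀ a b, wt w (u a) ≤ i → wt w (u b) ≤ i →
      Close w t ((1 - 1 / (N : ℝ)) * ε) (u a) (u b) := by
  have hN' : (1 : ℝ) ≤ N := by exact_mod_cast hN
  have h0 : 0 ≤ (1 - 1 / (N : ℝ)) * ε := by
    refine mul_nonneg ?_ hε
    rw [sub_nonneg, div_le_one (by linarith)]
    exact hN'
  induction h with
  | of_old v h =>
    intro a b _ _ j hj
    -- Old points have no coordinates of weight `≥ t`. So the part that is never subdivided has mesh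
    -- zero.
    have hz : ∀ k, v k j = 0 := fun k => by
      by_contra hne
      have h1 : w j ≤ wt w (v k) := wt_le_iff.1 le_rfl j hne
      exact absurd (lt_of_le_of_lt (Fin.le_def.1 h1) (h k)) (by omega)
    simpa [hz] using h0
  | @cone q v j u h hu ih =>
    have hu' := ih ((countLE_face_le i v j).trans hc) fun a b => hv _ _
    -- Here the whole tuple has weight at most `i`, so its length `q + 1` is the count bounded by
    -- `N`.
    have hb : wt w ((relData w t).bary v) ≤ i → ∀ a,
        Close w t ((1 - 1 / (N : ℝ)) * ε) (u a) ((relData w t).bary v) := by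
      intro hb a
      have hle := wt_bary_le_iff.1 hb
      rw [countLE_eq hle] at hc
      have hqN : (q + 1 : ℝ) ≤ N := by exact_mod_cast hc
      refine ((hu.spanned a).of_face).close fun k => ?_
      refine ((close_bary (fun k l => hv k l (hle k) (hle l)) k).symm).mono ?_
      refine mul_le_mul_of_nonneg_right ?_ hε
      have : 1 / (N : ℝ) ≤ 1 / (q + 1 : ℝ) :=
        one_div_le_one_div_of_le (by positivity) hqN
      linarith
    intro a b
    refine Fin.lastCases ?_ (fun a => ?_) a <;> refine Fin.lastCases ?_ (fun b => ?_) b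
    · intro _ _ j _
      simpa using h0
    · intro h1 _
      simpa [snoc] using (hb (by simpa [snoc] using h1) b).symm
    · intro _ h1
      simpa [snoc] using hb (by simpa [snoc] using h1) a
    · simpa [snoc] using hu' a b

/-! #### Pieces of iterated subdivisions -/

lemma IterPiece.monotone {M : ℕ} {v u : Fin q → Spx m} (h : IterPiece (relData w t) M v u)
    (hv : Monotone (wt w ∘ v)) : Monotone (wt w ∘ u) := by
  induction M generalizing u with
  | zero => obtain rfl : u = v := h; exact hv
  | succ M ih =>
    obtain ⟨v', h1, h2⟩ := h
    exact h2.monotone (ih h1)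

lemma IterPiece.exists_wt_eq {M : ℕ} {v u : Fin q → Spx m} (h : IterPiece (relData w t) M v u) :
    ∀ k, ∃ l, wt w (v l) = wt w (u k) := by
  induction M generalizing u with
  | zero => obtain rfl : u = v := h; exact fun k => ⟨k, rfl⟩
  | succ M ih =>
    obtain ⟨v', h1, h2⟩ := h
    intro k
    obtain ⟨l, hl⟩ := h2.exists_wt_eq k
    rw [← hl]
    exact ih h1 l

lemma IterPiece.countLE_le {M : ℕ} {v u : Fin q → Spx m} (h : IterPiece (relData w t) M v u)
    (i : Fin (n + 1)) : countLE w i u ≤ countLE w i v := by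
  induction M generalizing u with
  | zero => obtain rfl : u = v := h; exact le_rfl
  | succ M ih =>
    obtain ⟨v', h1, h2⟩ := h
    exact (h2.countLE_le i).trans (ih h1)

lemma IterPiece.close {M : ℕ} {v u : Fin q → Spx m} (h : IterPiece (relData w t) M v u)
    {i : Fin (n + 1)} {N : ℕ} (hN : 1 ≤ N) {ε : ℝ} (hε : 0 ≤ ε) (hc : countLE w i v ≤ N)
    (hv : ∀ a b, wt w (v a) ≤ i → wt w (v b) ≤ i → Close w t ε (v a) (v b)) :
    ∀ a b, wt w (u a) ≤ i → wt w (u b) ≤ i →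
      Close w t ((1 - 1 / (N : ℝ)) ^ M * ε) (u a) (u b) := by
  induction M generalizing u with
  | zero => obtain rfl : u = v := h; simpa using hv
  | succ M ih =>
    obtain ⟨v', h1, h2⟩ := h
    have hN' : (1 : ℝ) ≤ N := by exact_mod_cast hN
    have h0 : 0 ≤ 1 - 1 / (N : ℝ) := by
      rw [sub_nonneg, div_le_one (by linarith)]
      exact hN'
    rw [pow_succ', mul_assoc]
    exact h2.close hN (by positivity) ((h1.countLE_le i).trans hc) (ih h1)

end Affine

end BlownUp

namespace BlownUp

variable {X : Type*} [TopologicalSpace X] {n : ℕ} {𝓕 : Filtration X n}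

/-! ### Cells of blown-up simplices and functions on them -/

section Cells

/-- The composite of a regular simplex with an affine simplex. -/
noncomputable abbrev RegularSimplex.comp (σ : RegularSimplex 𝓕) {q : ℕ}
    (v : Fin (q + 1) → Spx σ.dim) (hm : Monotone (wt σ.weight ∘ v))
    (hr : ∃ k, wt σ.weight (v k) = Fin.last n) : RegularSimplex 𝓕 where
  dim := q
  map := σ.map.comp ⟨aff v, continuous_aff v⟩
  weight k := wt σ.weight (v k)
  monotone_weight := hm
  map_mem_level i x := by
    refine (σ.map_mem_level i (aff v x)).trans ?_
    rw [← wt_le_iff, wt_aff_le_iff]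
  regular := hr

/-- The dimension is a field, so equality involves transport; in the applications the dimensions
agree definitionally and the casts disappear. -/
lemma RegularSimplex.eq_of_map_eq {σ τ : RegularSimplex 𝓕} (h : σ.dim = τ.dim)
    (hm : ∀ x : Spx τ.dim, σ.map (h ▸ x) = τ.map x)
    (hw : ∀ j : Fin (τ.dim + 1), σ.weight (h ▸ j) = τ.weight j) : σ = τ := by
  obtain ⟨d, m, w, _, _, _⟩ := σ
  obtain ⟨d', m', w', _, _, _⟩ := τ
  dsimp only at h
  subst h
  obtain rfl : m = m' := ContinuousMap.ext hm
  obtain rfl : w = w' := funext hw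
  rfl

lemma RegularSimplex.comp_vertices (σ : RegularSimplex 𝓕) (hm hr) :
    σ.comp (vertices σ.dim) hm hr = σ :=
  RegularSimplex.eq_of_map_eq rfl (fun x => congrArg σ.map (aff_vertices x))
    fun j => wt_vertices j

lemma RegularSimplex.comp_comp (σ : RegularSimplex 𝓕) {q l : ℕ} (v : Fin (q + 1) → Spx σ.dim)
    (hm hr) (u : Fin (l + 1) → Spx q) (hm' hr' hm'' hr'') :
    (σ.comp v hm hr).comp u hm' hr' = σ.comp (aff v ∘ u) hm'' hr'' :=
  RegularSimplex.eq_of_map_eq rfl (fun x => congrArg σ.map (aff_aff v u x))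
    fun j => (wt_aff v (u j)).symm

/-- The indices of the factors of a face of a blow up that do not contain the apex. -/
def Marked (E : Finset (Fin n)) (i : Fin (n + 1)) : Prop := ∀ e ∈ E, e.castSucc ≠ i

lemma marked_last (E : Finset (Fin n)) : Marked E (Fin.last n) :=
  fun _ _ => (Fin.castSucc_lt_last _).ne

lemma Marked.mono {E E' : Finset (Fin n)} {i : Fin (n + 1)} (h : Marked E i) (hE : E' ⊆ E) :
    Marked E' i := fun _ he => h _ (hE he)

lemma marked_castSucc {E : Finset (Fin n)} {i : Fin n} : Marked E i.castSucc ↔ i ∉ E :=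
  ⟨fun h hi => h i hi rfl, fun h _ he hei => h (Fin.castSucc_injective n hei ▸ he)⟩

variable (𝓕) in
/-- A cell: a regular simplex together with the set of those `i` for which the apex `v_i` is
used, that is, a face of a blow up which contains all the vertices of the simplex. -/
structure Cell where
  simplex : RegularSimplex 𝓕
  apexes : Finset (Fin n)
  legal : ∀ i, Marked apexes i → ∃ j, simplex.weight j = i

/-- The condition that an affine simplex and a set of apexes define a cell. -/
structure IsLegal {m q : ℕ} (w : Fin (m + 1) → Fin (n + 1)) (E : Finset (Fin n))
    (v : Fin q → Spx m) : Prop where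
  monotone : Monotone (wt w ∘ v)
  exists_wt_eq : ∀ i, Marked E i → ∃ k, wt w (v k) = i

/-- The cell defined by an affine simplex and a set of apexes. -/
noncomputable abbrev Cell.ofTuple (σ : RegularSimplex 𝓕) (E : Finset (Fin n)) {q : ℕ}
    (v : Fin (q + 1) → Spx σ.dim) (h : IsLegal σ.weight E v) : Cell 𝓕 where
  simplex := σ.comp v h.1 (h.2 _ (marked_last E))
  apexes := E
  legal := h.2

lemma Cell.isLegal_vertices (c : Cell 𝓕) :
    IsLegal c.simplex.weight c.apexes (vertices c.simplex.dim) where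
  monotone := by
    have : wt c.simplex.weight ∘ vertices c.simplex.dim = c.simplex.weight :=
      funext fun j => wt_vertices j
    rw [this]
    exact c.simplex.monotone_weight
  exists_wt_eq i hi := by
    obtain ⟨j, hj⟩ := c.legal i hi
    exact ⟨j, (wt_vertices j).trans hj⟩

lemma RegularSimplex.monotone_wt_vertices (σ : RegularSimplex 𝓕) :
    Monotone (wt σ.weight ∘ vertices σ.dim) := by
  have : wt σ.weight ∘ vertices σ.dim = σ.weight := funext fun j => wt_vertices j
  rw [this]
  exact σ.monotone_weight

@[ext] lemma Cell.ext {c c' : Cell 𝓕} (h : c.simplex = c'.simplex) (h' : c.apexes = c'.apexes) :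
    c = c' := by
  cases c; cases c'; cases h; cases h'; rfl

lemma Cell.ofTuple_vertices (σ : RegularSimplex 𝓕) (E : Finset (Fin n))
    (h : IsLegal σ.weight E (vertices σ.dim)) (h') :
    Cell.ofTuple σ E (vertices σ.dim) h = ⟨σ, E, h'⟩ :=
  Cell.ext (σ.comp_vertices _ _) rfl

lemma isLegal_comp_iff {m q l : ℕ} {w : Fin (m + 1) → Fin (n + 1)} {E : Finset (Fin n)}
    {v : Fin (q + 1) → Spx m} {u : Fin l → Spx q} :
    IsLegal (fun k => wt w (v k)) E u ↔ IsLegal w E (aff v ∘ u) := by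
  have : wt (fun k => wt w (v k)) ∘ u = wt w ∘ aff v ∘ u := funext fun k => (wt_aff v (u k)).symm
  constructor
  · rintro ⟨h1, h2⟩
    exact ⟨this ▸ h1, fun i hi => let ⟨k, hk⟩ := h2 i hi; ⟨k, (wt_aff v (u k)).trans hk⟩⟩
  · rintro ⟨h1, h2⟩
    exact ⟨this.symm ▸ h1, fun i hi => let ⟨k, hk⟩ := h2 i hi; ⟨k, (wt_aff v (u k)).symm.trans hk⟩⟩

variable {R : Type*} [CommRing R]

open Classical in
/-- The value of a function on cells at an affine simplex, zero if this is not a cell. -/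
noncomputable def val (f : Cell 𝓕 → R) (σ : RegularSimplex 𝓕) (E : Finset (Fin n)) :
    ∀ {q : ℕ}, (Fin q → Spx σ.dim) → R
  | 0, _ => 0
  | _ + 1, v => if h : IsLegal σ.weight E v then f (Cell.ofTuple σ E v h) else 0

variable {f g : Cell 𝓕 → R} {σ : RegularSimplex 𝓕} {E : Finset (Fin n)} {q : ℕ}

lemma val_of_isLegal {v : Fin (q + 1) → Spx σ.dim} (h : IsLegal σ.weight E v) :
    val f σ E v = f (Cell.ofTuple σ E v h) := dif_pos h

lemma val_of_not_isLegal {v : Fin q → Spx σ.dim} (h : ¬ IsLegal σ.weight E v) :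
    val f σ E v = 0 := by
  cases q with
  | zero => rfl
  | succ q => exact dif_neg h

lemma val_eq_zero {v : Fin (q + 1) → Spx σ.dim}
    (h : ∀ h : IsLegal σ.weight E v, f (Cell.ofTuple σ E v h) = 0) : val f σ E v = 0 := by
  by_cases h' : IsLegal σ.weight E v
  · rw [val_of_isLegal h', h h']
  · exact val_of_not_isLegal h'

lemma val_vertices (c : Cell 𝓕) : val f c.simplex c.apexes (vertices _) = f c := by
  rw [val_of_isLegal c.isLegal_vertices, Cell.ofTuple_vertices _ _ _ c.legal]

lemma val_add (v : Fin q → Spx σ.dim) : val (f + g) σ E v = val f σ E v + val g σ E v := by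
  cases q with
  | zero => simp [val]
  | succ q => simp only [val]; split_ifs <;> simp

lemma val_smul (r : R) (v : Fin q → Spx σ.dim) : val (r • f) σ E v = r * val f σ E v := by
  cases q with
  | zero => simp [val]
  | succ q => simp only [val]; split_ifs <;> simp

lemma val_comp {v : Fin (q + 1) → Spx σ.dim} (hm hr) {l : ℕ} (u : Fin l → Spx q) :
    val f (σ.comp v hm hr) E u = val f σ E (aff v ∘ u) := by
  cases l with
  | zero => rfl
  | succ l =>
    by_cases h : IsLegal σ.weight E (aff v ∘ u)
    · rw [val_of_isLegal h, val_of_isLegal (σ := σ.comp v hm hr) (isLegal_comp_iff.2 h)]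
      exact congrArg f (Cell.ext (σ.comp_comp _ _ _ _ _ _ _ _) rfl)
    · rw [val_of_not_isLegal h,
        val_of_not_isLegal (σ := σ.comp v hm hr) (mt isLegal_comp_iff.1 h)]

/-- The evaluation of a function on cells on affine chains. -/
noncomputable def eval (f : Cell 𝓕 → R) (σ : RegularSimplex 𝓕) (E : Finset (Fin n)) (q : ℕ) :
    TupleChain R (Spx σ.dim) q →ₗ[R] R :=
  Finsupp.linearCombination R (val f σ E)

@[simp] lemma eval_single (v : Fin q → Spx σ.dim) :
    eval f σ E q (Finsupp.single v 1) = val f σ E v := by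
  simp [eval]

lemma eval_zero (x : TupleChain R (Spx σ.dim) 0) : eval f σ E 0 x = 0 := by
  have : eval f σ E 0 = 0 := tupleChain_induction R fun v => by rw [eval_single]; rfl
  rw [this, LinearMap.zero_apply]

lemma eval_add (x : TupleChain R (Spx σ.dim) q) :
    eval (f + g) σ E q x = eval f σ E q x + eval g σ E q x := by
  have : eval (f + g) σ E q = eval f σ E q + eval g σ E q :=
    tupleChain_induction R fun v => by simp [val_add]
  rw [this, LinearMap.add_apply]

lemma eval_smul (r : R) (x : TupleChain R (Spx σ.dim) q) :
    eval (r • f) σ E q x = r * eval f σ E q x := by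
  have : eval (r • f) σ E q = r • eval f σ E q :=
    tupleChain_induction R fun v => by simp [val_smul]
  rw [this, LinearMap.smul_apply, smul_eq_mul]

lemma eval_comp {v : Fin (q + 1) → Spx σ.dim} (hm hr) {l : ℕ} (x : TupleChain R (Spx q) l) :
    eval f (σ.comp v hm hr) E l x = eval f σ E l (pushforward R (aff v) l x) := by
  have : eval f (σ.comp v hm hr) E l = eval f σ E l ∘ₗ pushforward R (aff v) l :=
    tupleChain_induction R fun u => by
      simp only [LinearMap.comp_apply, pushforward_single, eval_single]
      rw [← val_comp hm hr]
  rw [this, LinearMap.comp_apply]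

lemma eval_eq_zero {x : TupleChain R (Spx σ.dim) q} {A : Set (Fin q → Spx σ.dim)}
    (hx : x ∈ Finsupp.supported R R A) (h : ∀ v ∈ A, val f σ E v = 0) : eval f σ E q x = 0 := by
  rw [eval, Finsupp.linearCombination_apply]
  refine Finset.sum_eq_zero fun v hv => ?_
  dsimp only
  rw [h v (hx hv), smul_zero]

/-- Two linear maps that agree on the tuples of a set agree on the chains supported there. -/
lemma linearMap_eq_of_mem_supported {P M : Type*} [AddCommGroup M] [Module R M]
    {F G : TupleChain R P q →ₗ[R] M} {A : Set (Fin q → P)} {x : TupleChain R P q}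
    (hx : x ∈ Finsupp.supported R R A)
    (h : ∀ v ∈ A, F (Finsupp.single v 1) = G (Finsupp.single v 1)) : F x = G x := by
  rw [Finsupp.supported_eq_span_single] at hx
  have : Set.EqOn F G ((fun v => Finsupp.single v (1 : R)) '' A) := by
    rintro _ ⟨v, hv, rfl⟩
    exact h v hv
  exact LinearMap.eqOn_span this hx

/-- The sign of the face opposite to an apex. -/
def apexSign (E : Finset (Fin n)) (i : Fin n) : ℕ := (E.filter fun e => i < e).card

variable (𝓕 R) in
/-- The coboundary of functions on cells. -/
noncomputable def coboundary : (Cell 𝓕 → R) →ₗ[R] (Cell 𝓕 → R) where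
  toFun f c := (-1) ^ c.apexes.card *
      eval f c.simplex c.apexes c.simplex.dim (tupleBoundary R _ (vertices c.simplex.dim)) +
    ∑ i ∈ c.apexes, (-1) ^ apexSign c.apexes i *
      val f c.simplex (c.apexes.erase i) (vertices c.simplex.dim)
  map_add' f g := by
    funext c
    simp only [eval_add, val_add, mul_add, Finset.sum_add_distrib, Pi.add_apply]
    abel
  map_smul' r f := by
    funext c
    simp only [eval_smul, val_smul, Pi.smul_apply, smul_eq_mul, RingHom.id_apply, mul_add,
      Finset.mul_sum]
    congr 1
    · ring
    · exact Finset.sum_congr rfl fun i _ => by ring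

lemma coboundary_apply (c : Cell 𝓕) : coboundary 𝓕 R f c = (-1) ^ c.apexes.card *
      eval f c.simplex c.apexes c.simplex.dim (tupleBoundary R _ (vertices c.simplex.dim)) +
    ∑ i ∈ c.apexes, (-1) ^ apexSign c.apexes i *
      val f c.simplex (c.apexes.erase i) (vertices c.simplex.dim) := rfl

lemma val_eq_zero_of_forall_ne {i : Fin (n + 1)} (hi : Marked E i) {v : Fin q → Spx σ.dim}
    (h : ∀ k, wt σ.weight (v k) ≠ i) : val f σ E v = 0 :=
  val_of_not_isLegal fun hl => let ⟨k, hk⟩ := hl.2 i hi; h k hk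

/-- This shows that the value zero on illegal tuples is coherent. A monotone illegal tuple misses
some weight `i` outside `E`; all its faces miss it too, and `i` remains outside `E` when an apex is
removed, so every term on the right vanishes. -/
lemma val_coboundary {v : Fin (q + 1) → Spx σ.dim} (hv : Monotone (wt σ.weight ∘ v)) :
    val (coboundary 𝓕 R f) σ E v =
      (-1) ^ E.card * eval f σ E q (tupleBoundary R q v) +
        ∑ i ∈ E, (-1) ^ apexSign E i * val f σ (E.erase i) v := by
  by_cases h : IsLegal σ.weight E v
  · rw [val_of_isLegal h, coboundary_apply]
    dsimp only [Cell.ofTuple]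
    rw [eval_comp]
    simp only [val_comp]
    change _ * eval f σ E q (pushforward R (aff v) q (tupleBoundary R q (vertices q))) +
      ∑ i ∈ E, _ * val f σ _ (aff v ∘ vertices q) = _
    rw [pushforward_tupleBoundary, aff_comp_vertices]
  · have : ∃ i, Marked E i ∧ ∀ k, wt σ.weight (v k) ≠ i := by
      by_contra! H
      exact h ⟨hv, H⟩
    obtain ⟨i, hi, hne⟩ := this
    rw [val_of_not_isLegal h, tupleBoundary_eq_sum, map_sum, Finset.sum_eq_zero, mul_zero,
      Finset.sum_eq_zero, add_zero]
    · exact fun e _ => by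
        rw [val_eq_zero_of_forall_ne (hi.mono (Finset.erase_subset e E)) hne, mul_zero]
    · exact fun j _ => by
        rw [map_smul, eval_single,
          val_eq_zero_of_forall_ne (v := v ∘ j.succAbove) hi fun k => hne _, smul_zero]

lemma eval_coboundary {x : TupleChain R (Spx σ.dim) (q + 1)}
    (hx : x ∈ Finsupp.supported R R {v | Monotone (wt σ.weight ∘ v)}) :
    eval (coboundary 𝓕 R f) σ E (q + 1) x =
      (-1) ^ E.card * eval f σ E q (boundary R q x) +
        ∑ i ∈ E, (-1) ^ apexSign E i * eval f σ (E.erase i) (q + 1) x := by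
  have := linearMap_eq_of_mem_supported (F := eval (coboundary 𝓕 R f) σ E (q + 1))
    (G := (-1 : R) ^ E.card • (eval f σ E q ∘ₗ boundary R q) +
      ∑ i ∈ E, (-1 : R) ^ apexSign E i • eval f σ (E.erase i) (q + 1)) hx fun v hv => by
        rw [eval_single, val_coboundary hv]
        simp
  rw [this]
  simp

lemma single_mem_monotone {v : Fin q → Spx σ.dim} (hv : Monotone (wt σ.weight ∘ v)) :
    (Finsupp.single v 1 : TupleChain R (Spx σ.dim) q) ∈
      Finsupp.supported R R {v | Monotone (wt σ.weight ∘ v)} :=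
  Finsupp.single_mem_supported R _ hv

lemma tupleBoundary_mem_monotone {v : Fin (q + 1) → Spx σ.dim}
    (hv : Monotone (wt σ.weight ∘ v)) : tupleBoundary R q v ∈
      Finsupp.supported R R {v | Monotone (wt σ.weight ∘ v)} :=
  map_tupleBoundary_mem_supported R LinearMap.id v fun j =>
    single_mem_monotone (hv.comp (Fin.strictMono_succAbove j).monotone)

lemma eval_coboundary_tupleBoundary {v : Fin (q + 1) → Spx σ.dim}
    (hv : Monotone (wt σ.weight ∘ v)) :
    eval (coboundary 𝓕 R f) σ E q (tupleBoundary R q v) =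
      ∑ i ∈ E, (-1) ^ apexSign E i * eval f σ (E.erase i) q (tupleBoundary R q v) := by
  cases q with
  | zero => simp [eval_zero]
  | succ q =>
    rw [eval_coboundary (tupleBoundary_mem_monotone hv), ← boundary_single, boundary_boundary,
      map_zero, mul_zero, zero_add]

lemma apexSign_swap {i j : Fin n} (hi : i ∈ E) (hj : j ∈ E) (hij : i ≠ j) :
    (-1 : R) ^ apexSign E i * (-1) ^ apexSign (E.erase i) j =
      -((-1) ^ apexSign E j * (-1) ^ apexSign (E.erase j) i) := by
  have key : ∀ i j : Fin n, i ∈ E → j ∈ E → i < j →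
      apexSign (E.erase i) j = apexSign E j ∧ apexSign E i = apexSign (E.erase j) i + 1 := by
    intro i j hi hj hij
    unfold apexSign
    rw [Finset.filter_erase, Finset.filter_erase, Finset.erase_eq_of_notMem (by simp [hij.le]),
      Finset.card_erase_add_one (by simp [hj, hij])]
    exact ⟨rfl, rfl⟩
  rcases lt_or_gt_of_ne hij with h | h
  · obtain ⟨h1, h2⟩ := key i j hi hj h
    rw [h1, h2, pow_succ]; ring
  · obtain ⟨h1, h2⟩ := key j i hj hi h
    rw [h1, h2, pow_succ]; ring

/-- The mixed terms cancel because removing an apex changes `(-1) ^ E.card`, the terms with two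
apexes cancel in pairs, and those with two vertices by `∂∂ = 0`. -/
lemma coboundary_coboundary (f : Cell 𝓕 → R) : coboundary 𝓕 R (coboundary 𝓕 R f) = 0 := by
  funext c
  rw [coboundary_apply, eval_coboundary_tupleBoundary c.isLegal_vertices.1]
  simp only [val_coboundary c.isLegal_vertices.1, mul_add, Finset.sum_add_distrib, Finset.mul_sum]
  rw [← add_assoc, ← Finset.sum_add_distrib, Finset.sum_eq_zero, zero_add, Finset.sum_sigma']
  · refine Finset.sum_involution (fun p _ => ⟨p.2, p.1⟩) ?_ ?_ ?_ ?_
    · rintro ⟨i, j⟩ hp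
      simp only [Finset.mem_sigma, Finset.mem_erase] at hp
      dsimp only
      rw [Finset.erase_right_comm (a := j) (b := i), ← mul_assoc, ← mul_assoc,
        apexSign_swap hp.1 hp.2.2 hp.2.1.symm]
      ring
    · rintro ⟨i, j⟩ hp _ he
      simp only [Finset.mem_sigma, Finset.mem_erase] at hp
      simp only [Sigma.mk.injEq, heq_eq_eq] at he
      exact hp.2.1 he.1
    · rintro ⟨i, j⟩ hp
      simp only [Finset.mem_sigma, Finset.mem_erase] at hp ⊢
      exact ⟨hp.2.2, hp.2.1.symm, hp.1⟩
    · rintro ⟨i, j⟩ _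
      rfl
  · intro i hi
    rw [← Finset.card_erase_add_one hi, pow_succ]
    ring

/-! #### The homotopy operator attached to numbers of subdivisions -/

variable (R) in
/-- The `k`-th iterated subdivision of a simplex, relative to the vertices of weight `< t`. -/
noncomputable def RegularSimplex.subdivision (σ : RegularSimplex 𝓕) (t k : ℕ) :
    TupleChain R (Spx σ.dim) (σ.dim + 1) :=
  iterSubdiv R (relData σ.weight t) k _ (Finsupp.single (vertices σ.dim) 1)

variable (R) in
/-- The homotopy between a simplex and its `k`-th iterated subdivision. -/
noncomputable def RegularSimplex.homotopy (σ : RegularSimplex 𝓕) (t k : ℕ) :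
    TupleChain R (Spx σ.dim) (σ.dim + 2) :=
  iterHomotopy R (relData σ.weight t) k _ (Finsupp.single (vertices σ.dim) 1)

variable (R) in
/-- The operator on functions on cells given by the homotopies between the simplex of a cell `c`
and its `N c`-th iterated subdivision. -/
noncomputable def homotopyOp (t : ℕ) (N : Cell 𝓕 → ℕ) : (Cell 𝓕 → R) →ₗ[R] (Cell 𝓕 → R) where
  toFun f c := (-1) ^ c.apexes.card *
    eval f c.simplex c.apexes _ (c.simplex.homotopy R t (N c))
  map_add' f g := by
    funext c
    simp only [eval_add, mul_add, Pi.add_apply]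
  map_smul' r f := by
    funext c
    simp only [eval_smul, Pi.smul_apply, smul_eq_mul, RingHom.id_apply]
    ring

variable {t : ℕ} {N : Cell 𝓕 → ℕ}

lemma homotopyOp_apply (c : Cell 𝓕) : homotopyOp R t N f c = (-1) ^ c.apexes.card *
    eval f c.simplex c.apexes _ (c.simplex.homotopy R t (N c)) := rfl

lemma neg_one_pow_mul_self (k : ℕ) : (-1 : R) ^ k * (-1) ^ k = 1 := by
  rw [← mul_pow]; simp

lemma iterHomotopy_mem_supported {P : Type*} {S : SubdivisionData P} (M : ℕ) {q : ℕ}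
    (v : Fin q → P) : iterHomotopy R S M q (Finsupp.single v 1) ∈
      Finsupp.supported R R {u | ∃ k < M, ∃ v', IterPiece S k v v' ∧ HomotopyPiece S v' u} := by
  rw [iterHomotopy, LinearMap.sum_apply]
  refine Submodule.sum_mem _ fun k hk => ?_
  rw [LinearMap.comp_apply]
  refine map_mem_supported R _ (iterSubdiv_mem_supported R k v) fun u hu => ?_
  refine Finsupp.supported_mono (fun u' hu' => ?_) (subdivHomotopy_mem_supported R u)
  exact ⟨k, Finset.mem_range.1 hk, u, hu, hu'⟩

lemma iterHomotopy_mem_monotone (M : ℕ) {q : ℕ} {v : Fin q → Spx σ.dim}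
    (hv : Monotone (wt σ.weight ∘ v)) :
    iterHomotopy R (relData σ.weight t) M q (Finsupp.single v 1) ∈
      Finsupp.supported R R {v | Monotone (wt σ.weight ∘ v)} := by
  refine Finsupp.supported_mono ?_ (iterHomotopy_mem_supported M v)
  rintro u ⟨k, -, v', h1, h2⟩
  exact h2.monotone (h1.monotone hv)

lemma iterSubdiv_zero (S : SubdivisionData (Spx q)) (M : ℕ) (x : TupleChain R (Spx q) 0) :
    iterHomotopy R S M 0 x = 0 := by
  simp [iterHomotopy, subdivHomotopy]

/-- The value of the homotopy operator for a constant number of subdivisions. -/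
lemma val_homotopyOp_const (M : ℕ) {v : Fin q → Spx σ.dim} (hv : Monotone (wt σ.weight ∘ v)) :
    val (homotopyOp R t (fun _ => M) f) σ E v = (-1) ^ E.card *
      eval f σ E (q + 1) (iterHomotopy R (relData σ.weight t) M q (Finsupp.single v 1)) := by
  cases q with
  | zero => rw [iterSubdiv_zero, map_zero, mul_zero]; rfl
  | succ q =>
    by_cases h : IsLegal σ.weight E v
    · rw [val_of_isLegal h, homotopyOp_apply]
      dsimp only [Cell.ofTuple, RegularSimplex.homotopy]
      rw [eval_comp]
      change _ * eval f σ E _ (pushforward R (aff v) _ (iterHomotopy R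
        (relData (fun k => wt σ.weight (v k)) t) M _ (Finsupp.single (vertices q) 1))) = _
      rw [pushforward_iterHomotopy R (isSubdivisionMap_aff σ.weight t v), pushforward_single,
        aff_comp_vertices]
    -- For an illegal tuple both sides vanish, since homotopy pieces carry no weight that the tuple
    -- does not have.
    · have : ∃ i, Marked E i ∧ ∀ k, wt σ.weight (v k) ≠ i := by
        by_contra! H
        exact h ⟨hv, H⟩
      obtain ⟨i, hi, hne⟩ := this
      rw [val_of_not_isLegal h, eval_eq_zero (iterHomotopy_mem_supported M v), mul_zero]
      rintro u ⟨k, -, v', h1, h2⟩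
      refine val_eq_zero_of_forall_ne hi fun k hk => ?_
      obtain ⟨l, hl⟩ := h2.exists_wt_eq k
      obtain ⟨l', hl'⟩ := h1.exists_wt_eq l
      exact hne l' (hl'.trans (hl.trans hk))

/-- For a constant number of subdivisions, the homotopy operator is a homotopy between the
identity and the iterated subdivision. -/
lemma homotopyOp_const (M : ℕ) (c : Cell 𝓕) :
    coboundary 𝓕 R (homotopyOp R t (fun _ => M) f) c +
      homotopyOp R t (fun _ => M) (coboundary 𝓕 R f) c =
    f c - eval f c.simplex c.apexes _ (c.simplex.subdivision R t M) := by
  have hv := c.isLegal_vertices.1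
  have h1 : eval (homotopyOp R t (fun _ => M) f) c.simplex c.apexes _
      (tupleBoundary R _ (vertices c.simplex.dim)) = (-1) ^ c.apexes.card *
      eval f c.simplex c.apexes _ (iterHomotopy R (relData c.simplex.weight t) M _
        (tupleBoundary R _ (vertices c.simplex.dim))) := by
    have := linearMap_eq_of_mem_supported
      (F := eval (homotopyOp R t (fun _ => M) f) c.simplex c.apexes c.simplex.dim)
      (G := (-1 : R) ^ c.apexes.card • (eval f c.simplex c.apexes _ ∘ₗ
        iterHomotopy R (relData c.simplex.weight t) M _))
      (tupleBoundary_mem_monotone (R := R) hv) fun v hv => by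
        rw [eval_single, val_homotopyOp_const M hv]; rfl
    rw [this]; rfl
  have h2 := boundary_iterHomotopy R (S := relData c.simplex.weight t) M
    (Finsupp.single (vertices c.simplex.dim) 1)
  rw [boundary_single] at h2
  have h3 := congrArg (eval f c.simplex c.apexes _) h2
  rw [map_add, map_sub, eval_single, val_vertices] at h3
  rw [coboundary_apply, h1, homotopyOp_apply, RegularSimplex.homotopy,
    eval_coboundary (iterHomotopy_mem_monotone M hv), mul_add, ← mul_assoc, ← mul_assoc,
    neg_one_pow_mul_self, one_mul, one_mul, RegularSimplex.subdivision, ← h3, Finset.mul_sum,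
    add_add_add_comm, add_comm (eval f c.simplex c.apexes _ _)]
  -- Only terms with an apex removed are left; they cancel because the sign of the operator is
  -- `(-1)` to the number of apexes.
  refine (add_eq_left).2 ?_
  rw [← Finset.sum_add_distrib]
  refine Finset.sum_eq_zero fun i hi => ?_
  rw [val_homotopyOp_const M hv, ← Finset.card_erase_add_one hi, pow_succ]
  ring

/-- The codimension one faces of a cell. -/
inductive Cell.Face (c : Cell 𝓕) : Cell 𝓕 → Prop
  | vertex {q : ℕ} (j : Fin (c.simplex.dim + 1)) (f : Fin (q + 1) ↪ Fin (c.simplex.dim + 1))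
      (hf : ∀ l, l ≠ j ↔ ∃ k, f k = l)
      (h : IsLegal c.simplex.weight c.apexes (vertices _ ∘ f)) :
      Face c (Cell.ofTuple c.simplex c.apexes (vertices _ ∘ f) h)
  | apex (i : Fin n) (hi : i ∈ c.apexes) (h) : Face c ⟨c.simplex, c.apexes.erase i, h⟩

lemma coboundary_eq_zero {c : Cell 𝓕} (h : ∀ c', c.Face c' → f c' = 0) :
    coboundary 𝓕 R f c = 0 := by
  rw [coboundary_apply, tupleBoundary_eq_sum, map_sum, Finset.sum_eq_zero, mul_zero,
    Finset.sum_eq_zero, add_zero]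
  · intro i hi
    rw [val_eq_zero, mul_zero]
    intro hl
    rw [Cell.ofTuple_vertices _ _ _ fun i' hi' => by
      obtain ⟨j, hj⟩ := hl.2 i' hi'
      exact ⟨j, (wt_vertices j).symm.trans hj⟩]
    exact h _ (.apex i hi _)
  · intro j _
    rw [map_smul, eval_single]
    have : ∀ (q : ℕ) (f' : Fin q ↪ Fin (c.simplex.dim + 1)) (_ : ∀ l, l ≠ j ↔ ∃ k, f' k = l),
        val f c.simplex c.apexes (vertices _ ∘ f') = 0 := by
      intro q f' hf'
      cases q with
      | zero => rfl
      | succ q => exact val_eq_zero fun hl => h _ (.vertex j f' hf' hl)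
    have h1 := this _ j.succAboveEmb fun l => by
      simp
    exact (congrArg _ h1).trans (smul_zero _)

end Cells

end BlownUp

namespace BlownUp

variable {X : Type*} [TopologicalSpace X] {n : ℕ} {𝓕 : Filtration X n}

/-! ### Cells that are small up to some level -/

section Small

variable (𝒰 : Set (Set X))

/-- The part of weight at most `i` of the simplex `σ` is `𝒰`-small. -/
def LevelSmall (σ : RegularSimplex 𝓕) (i : Fin (n + 1)) : Prop :=
  ∃ U ∈ 𝒰, ∀ x : Spx σ.dim, wt σ.weight x ≤ i → σ.map x ∈ U

/-- The cells `c` such that the part of weight at most `i` of their simplex is small for some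
`i ≥ t - 1` not used as an apex. All the cells are allowed for `t = 0`. -/
def PartlySmall : ℕ → Cell 𝓕 → Prop
  | 0, _ => True
  | t + 1, c => ∃ i : Fin (n + 1), t ≤ (i : ℕ) ∧ Marked c.apexes i ∧ LevelSmall 𝒰 c.simplex i

/-- The size of the `k`-th subdivision of the part of weight at most `i` of a simplex. -/
noncomputable def meshBound (σ : RegularSimplex 𝓕) (i : Fin (n + 1)) (k : ℕ) : ℝ :=
  (1 - 1 / (countLE σ.weight i (vertices σ.dim) : ℝ)) ^ k

/-- The affine simplices of weight at most `i` which are as small as those of the `k`-th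
subdivision, and meet the face of weight less than `t` if `t ≠ 0`, are `𝒰`-small. -/
def GoodAt (t : ℕ) (σ : RegularSimplex 𝓕) (i : Fin (n + 1)) (k : ℕ) : Prop :=
  ∀ (q : ℕ) (v : Fin q → Spx σ.dim), (∀ a, wt σ.weight (v a) ≤ i) →
    (∀ a b, Close σ.weight t (meshBound σ i k) (v a) (v b)) →
    (∃ a, t = 0 ∨ (wt σ.weight (v a) : ℕ) < t) →
    ∃ U ∈ 𝒰, ∀ x, Spanned v x → σ.map x ∈ U

/-- A number `k` of subdivisions which makes a cell small. -/
def Good (t : ℕ) (c : Cell 𝓕) (k : ℕ) : Prop :=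
  ∃ i : Fin (n + 1), t ≤ (i : ℕ) ∧ Marked c.apexes i ∧ GoodAt 𝒰 t c.simplex i k

/-- The least number of subdivisions which makes a cell small. -/
noncomputable def subdivNumber (t : ℕ) (c : Cell 𝓕) : ℕ := sInf {k | Good 𝒰 t c k}

variable {𝒰} {σ : RegularSimplex 𝓕} {c c' : Cell 𝓕} {t k : ℕ} {i : Fin (n + 1)}

lemma PartlySmall.of_succ (h : PartlySmall 𝒰 (t + 1) c) : PartlySmall 𝒰 t c := by
  cases t with
  | zero => trivial
  | succ t =>
    obtain ⟨i, h1, h2⟩ := h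
    exact ⟨i, by omega, h2⟩

lemma countLE_vertices_pos (h : ∃ j, σ.weight j = i) :
    1 ≤ countLE σ.weight i (vertices σ.dim) := by
  obtain ⟨j, hj⟩ := h
  have := Finset.single_le_sum (f := fun k => if wt σ.weight (vertices σ.dim k) ≤ i then 1 else 0)
    (fun _ _ => Nat.zero_le _) (Finset.mem_univ j)
  simpa [wt_vertices, hj, countLE] using this

lemma meshBound_base_mem (N : ℕ) : 0 ≤ 1 - 1 / (N : ℝ) ∧ 1 - 1 / (N : ℝ) ≤ 1 := by
  rcases Nat.eq_zero_or_pos N with h | h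
  -- With `1 / 0 = 0` the factor is `1`.
  · simp [h]
  · have h1 : (1 : ℝ) ≤ N := by exact_mod_cast h
    have h2 : 1 / (N : ℝ) ≤ 1 := by rw [div_le_one (by linarith)]; exact h1
    have h3 : 0 ≤ 1 / (N : ℝ) := by positivity
    constructor <;> linarith

lemma meshBound_base_mono {N N' : ℕ} (hN : 1 ≤ N) (h : N ≤ N') :
    1 - 1 / (N : ℝ) ≤ 1 - 1 / (N' : ℝ) := by
  have h1 : (1 : ℝ) ≤ N := by exact_mod_cast hN
  have h2 : (N : ℝ) ≤ N' := by exact_mod_cast h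
  have := one_div_le_one_div_of_le (by linarith) h2
  linarith

/-- Goodness is a condition on all affine simplices below a mesh, rather than on the actual pieces;
this makes it monotone in `k`. -/
lemma GoodAt.of_le {l : ℕ} (h : GoodAt 𝒰 t σ i k) (hkl : k ≤ l) : GoodAt 𝒰 t σ i l := by
  intro q v h1 h2 h3
  refine h q v h1 (fun a b => (h2 a b).mono ?_) h3
  exact pow_le_pow_of_le_one (meshBound_base_mem _).1 (meshBound_base_mem _).2 hkl

lemma Good.of_le {l : ℕ} (h : Good 𝒰 t c k) (hkl : k ≤ l) : Good 𝒰 t c l := by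
  obtain ⟨i, h1, h2, h3⟩ := h
  exact ⟨i, h1, h2, h3.of_le hkl⟩

lemma countLE_mono {m q : ℕ} {w : Fin (m + 1) → Fin (n + 1)} {i i' : Fin (n + 1)} (h : i' ≤ i)
    (v : Fin q → Spx m) : countLE w i' v ≤ countLE w i v := by
  refine Finset.sum_le_sum fun k _ => ?_
  split_ifs with h1 h2 h2
  · exact le_rfl
  · exact absurd (h1.trans h) h2
  · simp
  · exact le_rfl

/-- Fewer vertices contract faster. The existence of a vertex of weight `i'` excludes the count `0`,
for which the factor would be `1`. Thus the lowest admissible level alone decides goodness. -/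
lemma GoodAt.of_level_le {i' : Fin (n + 1)} (h : GoodAt 𝒰 t σ i k) (hi : i' ≤ i)
    (hex : ∃ j, σ.weight j = i') : GoodAt 𝒰 t σ i' k := by
  intro q v h1 h2 h3
  refine h q v (fun a => (h1 a).trans hi) (fun a b => (h2 a b).mono ?_) h3
  exact pow_le_pow_left₀ (meshBound_base_mem _).1
    (meshBound_base_mono (countLE_vertices_pos hex) (countLE_mono hi _)) _

lemma LevelSmall.goodAt (h : LevelSmall 𝒰 σ i) (t k : ℕ) : GoodAt 𝒰 t σ i k := by
  obtain ⟨U, hU, h⟩ := h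
  exact fun q v h1 _ _ => ⟨U, hU, fun x hx => h x (hx.wt_le h1)⟩

/-- Cells that are already small are not subdivided; this is why the final operator fixes their
values. -/
lemma subdivNumber_eq_zero (h : PartlySmall 𝒰 (t + 1) c) : subdivNumber 𝒰 t c = 0 := by
  obtain ⟨i, h1, h2, h3⟩ := h
  exact Nat.sInf_eq_zero.2 (Or.inl ⟨i, h1, h2, h3.goodAt t 0⟩)

/-! #### Existence of good numbers of subdivisions -/

lemma exists_meshBound_le {δ : ℝ} (hδ : 0 < δ) (h : ∃ j, σ.weight j = i) :
    ∃ k, meshBound σ i k ≤ δ := by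
  have h1 : (1 : ℝ) ≤ countLE σ.weight i (vertices σ.dim) := by
    exact_mod_cast countLE_vertices_pos h
  have h2 : 1 - 1 / (countLE σ.weight i (vertices σ.dim) : ℝ) < 1 := by
    have : 0 < 1 / (countLE σ.weight i (vertices σ.dim) : ℝ) := by positivity
    linarith
  obtain ⟨k, hk⟩ := exists_pow_lt_of_lt_one hδ h2
  exact ⟨k, hk.le⟩

lemma exists_goodAt_zero (h𝒰 : ∀ U ∈ 𝒰, IsOpen U) (hcover : ⋃₀ 𝒰 = Set.univ)
    (h : ∃ j, σ.weight j = i) : ∃ k, GoodAt 𝒰 0 σ i k := by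
  obtain ⟨δ, hδ, H⟩ := lebesgue_number_lemma_of_metric_sUnion (s := (Set.univ : Set (Spx σ.dim)))
    (c := (fun U => σ.map ⁻¹' U) '' 𝒰) isCompact_univ
    (by rintro _ ⟨U, hU, rfl⟩; exact (h𝒰 U hU).preimage σ.map.continuous)
    (by
      intro x _
      have : σ.map x ∈ ⋃₀ 𝒰 := hcover ▸ Set.mem_univ _
      obtain ⟨U, hU, hx⟩ := this
      exact ⟨_, ⟨U, hU, rfl⟩, hx⟩)
  -- The mesh gives a weak inequality and the balls are open, hence half of the Lebesgue number. For
  -- `t = 0` all coordinates are controlled.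
  obtain ⟨k, hk⟩ := exists_meshBound_le (half_pos hδ) h
  refine ⟨k, fun q v _ h2 ⟨a, _⟩ => ?_⟩
  obtain ⟨_, ⟨U, hU, rfl⟩, hb⟩ := H (v a) (Set.mem_univ _)
  refine ⟨U, hU, fun x hx => hb ?_⟩
  have hc := hx.close fun b => (h2 b a).mono hk
  rw [Metric.mem_ball]
  refine lt_of_le_of_lt ?_ (half_lt_self hδ)
  rw [Subtype.dist_eq, dist_pi_le_iff (half_pos hδ).le]
  exact fun j => hc j (Nat.zero_le _)

/-- The mass `F` of the coordinates of weight greater than `s` vanishes exactly on the face of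
weight at most `s`, which maps into `U`. By compactness `F < δ` still implies membership in `U`, and
a fine simplex touching that face satisfies it. -/
lemma exists_goodAt_succ (h𝒰 : ∀ U ∈ 𝒰, IsOpen U) {s : Fin (n + 1)} (hs : LevelSmall 𝒰 σ s)
    (h : ∃ j, σ.weight j = i) : ∃ k, GoodAt 𝒰 (s + 1) σ i k := by
  obtain ⟨U, hU, hs⟩ := hs
  let F : Spx σ.dim → ℝ := fun x => ∑ j, if s < σ.weight j then x j else 0
  have hF : Continuous F := by
    refine continuous_finsetSum _ fun j _ => ?_
    split_ifs
    · exact (continuous_apply j).comp continuous_subtype_val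
    · exact continuous_const
  have hF0 : ∀ x j, s < σ.weight j → x j ≤ F x := fun x j hj => by
    have := Finset.single_le_sum (f := fun j => if s < σ.weight j then x j else 0)
      (fun j _ => by split_ifs <;> simp) (Finset.mem_univ j)
    simpa [hj] using this
  have hδ : ∃ δ > 0, ∀ x : Spx σ.dim, F x < δ → σ.map x ∈ U := by
    have hK : IsCompact (σ.map ⁻¹' U)ᶜ :=
      ((h𝒰 U hU).preimage σ.map.continuous).isClosed_compl.isCompact
    rcases (σ.map ⁻¹' U)ᶜ.eq_empty_or_nonempty with he | hne
    · refine ⟨1, one_pos, fun x _ => ?_⟩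
      by_contra hx
      exact (Set.eq_empty_iff_forall_notMem.1 he x) hx
    · obtain ⟨x₀, hx₀, hmin⟩ := hK.exists_isMinOn hne hF.continuousOn
      refine ⟨F x₀, ?_, fun x hx => ?_⟩
      · by_contra! hle
        refine hx₀ (hs x₀ (wt_le_iff.2 fun j hj => ?_))
        by_contra! hlt
        exact hj (le_antisymm ((hF0 x₀ j hlt).trans hle) (stdSimplex.zero_le x₀ j))
      · by_contra hxU
        exact absurd (hmin hxU) (not_le.2 hx)
  obtain ⟨δ, hδ, H⟩ := hδ
  have hd : (0 : ℝ) < σ.dim + 2 := by positivity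
  -- There are `dim + 1` coordinates; dividing by `dim + 2` makes the final inequality strict.
  obtain ⟨k, hk⟩ := exists_meshBound_le (div_pos hδ hd) h
  refine ⟨k, fun q v _ h2 ⟨a, ha⟩ => ⟨U, hU, fun x hx => H x ?_⟩⟩
  have hc := hx.close fun b => (h2 b a).mono hk
  have ha : (wt σ.weight (v a) : ℕ) < s + 1 := by simpa using ha
  have hle : ∀ j, (if s < σ.weight j then x j else 0) ≤ δ / (σ.dim + 2) := by
    intro j
    split_ifs with hj
    · have h0 : v a j = 0 := by
        by_contra hne
        have := wt_le_iff.1 (le_refl (wt σ.weight (v a))) j hne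
        rw [Fin.le_def] at this
        rw [Fin.lt_def] at hj
        omega
      have := hc j (by rw [Fin.lt_def] at hj; omega)
      rw [h0, sub_zero] at this
      exact (le_abs_self _).trans this
    · positivity
  calc F x ≤ ∑ _j : Fin (σ.dim + 1), δ / (σ.dim + 2) := Finset.sum_le_sum fun j _ => hle j
    _ = (σ.dim + 1) * (δ / (σ.dim + 2)) := by simp
    _ < δ := by
      rw [← mul_div_assoc, div_lt_iff₀ hd]
      nlinarith

lemma exists_good (h𝒰 : ∀ U ∈ 𝒰, IsOpen U) (hcover : ⋃₀ 𝒰 = Set.univ) (ht : t ≤ n)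
    (hc : PartlySmall 𝒰 t c) : ∃ k, Good 𝒰 t c k := by
  have hl := marked_last c.apexes
  cases t with
  | zero =>
    obtain ⟨k, hk⟩ := exists_goodAt_zero h𝒰 hcover (c.legal _ hl)
    exact ⟨k, _, Nat.zero_le _, hl, hk⟩
  | succ t =>
    obtain ⟨i, h1, h2, h3⟩ := hc
    -- If the small level is exactly `t`, the top level `n`, which is never an apex, is made good;
    -- if it is larger, no subdivision is needed.
    rcases h1.eq_or_lt with rfl | h1
    · obtain ⟨k, hk⟩ := exists_goodAt_succ h𝒰 h3 (c.legal _ hl)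
      exact ⟨k, _, by simpa using ht, hl, hk⟩
    · exact ⟨0, i, h1, h2, h3.goodAt _ _⟩

lemma good_of_subdivNumber_le (h : ∃ k, Good 𝒰 t c k) (hk : subdivNumber 𝒰 t c ≤ k) :
    Good 𝒰 t c k :=
  (show Good 𝒰 t c (subdivNumber 𝒰 t c) from Nat.sInf_mem h).of_le hk

lemma not_good_of_lt (hk : k < subdivNumber 𝒰 t c) : ¬ Good 𝒰 t c k :=
  Nat.notMem_of_lt_sInf hk

/-! #### Subdivided cells are small -/

lemma LevelSmall.comp (h : LevelSmall 𝒰 σ i) {q : ℕ} (v : Fin (q + 1) → Spx σ.dim) (hm hr) :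
    LevelSmall 𝒰 (σ.comp v hm hr) i := by
  obtain ⟨U, hU, h⟩ := h
  refine ⟨U, hU, fun x hx => h (aff v x) ?_⟩
  rw [wt_aff]
  exact hx

lemma PartlySmall.ofTuple (hc : PartlySmall 𝒰 t c) {q : ℕ} (v : Fin (q + 1) → Spx c.simplex.dim)
    (h : IsLegal c.simplex.weight c.apexes v) :
    PartlySmall 𝒰 t (Cell.ofTuple c.simplex c.apexes v h) := by
  cases t with
  | zero => trivial
  | succ t =>
    obtain ⟨i, h1, h2, h3⟩ := hc
    exact ⟨i, h1, h2, h3.comp v _ _⟩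

lemma PartlySmall.face (hc : PartlySmall 𝒰 t c) (h : c.Face c') : PartlySmall 𝒰 t c' := by
  cases h with
  | vertex j f hf h => exact hc.ofTuple _ h
  | apex e he h =>
    cases t with
    | zero => trivial
    | succ t =>
      obtain ⟨i, h1, h2, h3⟩ := hc
      exact ⟨i, h1, h2.mono (Finset.erase_subset _ _), h3⟩

lemma close_vertices {m : ℕ} {w : Fin (m + 1) → Fin (n + 1)} (x y : Spx m) :
    Close w t 1 x y := fun j _ => by
  have h1 := stdSimplex.zero_le x j
  have h2 := stdSimplex.le_one x j
  have h3 := stdSimplex.zero_le y j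
  have h4 := stdSimplex.le_one y j
  rw [abs_le]
  constructor <;> linarith

/-- If enough subdivisions have been made, all the affine simplices contained in a piece of the
subdivision give small cells. -/
lemma partlySmall_of_good (hc : PartlySmall 𝒰 t c) (hk : Good 𝒰 t c k)
    {u' : Fin (c.simplex.dim + 1) → Spx c.simplex.dim}
    (hu' : IterPiece (relData c.simplex.weight t) k (vertices _) u') {q : ℕ}
    {u : Fin (q + 1) → Spx c.simplex.dim} (hu : ∀ a, Spanned u' (u a))
    (hw : ∀ a, ∃ b, wt c.simplex.weight (u' b) = wt c.simplex.weight (u a))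
    (h : IsLegal c.simplex.weight c.apexes u) :
    PartlySmall 𝒰 (t + 1) (Cell.ofTuple c.simplex c.apexes u h) := by
  by_cases hs : PartlySmall 𝒰 (t + 1) c
  · exact hs.ofTuple u h
  obtain ⟨i, hti, hi, hgood⟩ := hk
  -- Legality provides a vertex of the weight of each non-apex: level `i` itself when `t = 0`;
  -- otherwise the level just below the stage, which is a small non-apex level since `c` is not yet
  -- small in the new sense.
  have ha : ∃ a, wt c.simplex.weight (u' a) ≤ i ∧
      (t = 0 ∨ (wt c.simplex.weight (u' a) : ℕ) < t) := by
    cases t with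
    | zero =>
      obtain ⟨a, ha⟩ := h.2 i hi
      obtain ⟨b, hb⟩ := hw a
      exact ⟨b, (hb.trans ha).le, Or.inl rfl⟩
    | succ t =>
      obtain ⟨s, h1, h2, h3⟩ := hc
      have hst : (s : ℕ) = t := by
        by_contra hne
        exact hs ⟨s, by omega, h2, h3⟩
      obtain ⟨a, ha⟩ := h.2 s h2
      obtain ⟨b, hb⟩ := hw a
      refine ⟨b, ?_, Or.inr ?_⟩
      · rw [hb, ha, Fin.le_def]; omega
      · rw [hb, ha]; omega
  obtain ⟨a₀, ha₀, ha₀'⟩ := ha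
  have hclose := hu'.close (N := countLE c.simplex.weight i (vertices c.simplex.dim))
    (countLE_vertices_pos (c.legal i hi)) zero_le_one le_rfl
    fun a b _ _ => close_vertices _ _
  rw [mul_one] at hclose
  classical
  -- Vertices beyond level `i`, whose mesh is not controlled, are replaced by `u' a₀`. Points of
  -- weight at most `i` have zero coefficients there, so they remain spanned.
  let v : Fin (c.simplex.dim + 1) → Spx c.simplex.dim := fun a =>
    if wt c.simplex.weight (u' a) ≤ i then u' a else u' a₀
  have hv : ∀ a, ∃ b, v a = u' b ∧ wt c.simplex.weight (u' b) ≤ i := fun a => by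
    by_cases hle : wt c.simplex.weight (u' a) ≤ i
    · exact ⟨a, if_pos hle, hle⟩
    · exact ⟨a₀, if_neg hle, ha₀⟩
  obtain ⟨U, hU, H⟩ := hgood _ v
    (fun a => by obtain ⟨b, h1, h2⟩ := hv a; rw [h1]; exact h2)
    (fun a b => by
      obtain ⟨a', h1, h2⟩ := hv a
      obtain ⟨b', h3, h4⟩ := hv b
      rw [h1, h3]
      exact hclose a' b' h2 h4)
    ⟨a₀, by rwa [show v a₀ = u' a₀ from if_pos ha₀]⟩
  refine ⟨i, hti, hi, U, hU, fun x hx => H _ ?_⟩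
  have hx' : wt c.simplex.weight (aff u x) ≤ i := by rw [wt_aff]; exact hx
  obtain ⟨y, hy0, hy1, hy⟩ := (spanned_aff u x).trans hu
  refine ⟨y, hy0, hy1, fun j => ?_⟩
  refine (hy j).trans (Finset.sum_congr rfl fun a _ => ?_)
  by_cases hya : y a = 0
  · rw [hya, zero_mul, zero_mul]
  · rw [show v a = u' a from if_pos ((wt_le_iff_of_eq_sum hy0 hy).1 hx' a hya)]

/-! #### Comparison of a cell with its faces -/

section Face

variable {m q : ℕ} {w : Fin (m + 1) → Fin (n + 1)} (f : Fin (q + 1) ↪ Fin (m + 1))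

lemma aff_vertices_apply_emb (x : Spx q) (k : Fin (q + 1)) :
    aff (vertices m ∘ f) x (f k) = x k := by
  simp [aff_apply, vertices, Pi.single_apply]

lemma aff_vertices_apply_of_notMem (x : Spx q) {l : Fin (m + 1)} (h : ∀ k, f k ≠ l) :
    aff (vertices m ∘ f) x l = 0 := by
  simp only [aff_apply]
  refine Finset.sum_eq_zero fun k _ => ?_
  simp [vertices, (h k).symm]

lemma close_aff_vertices {ε : ℝ} {x y : Spx q}
    (h : Close (fun k => wt w (vertices m (f k))) t ε x y) (hε : 0 ≤ ε) :
    Close w t ε (aff (vertices m ∘ f) x) (aff (vertices m ∘ f) y) := by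
  intro l hl
  by_cases hk : ∃ k, f k = l
  · obtain ⟨k, rfl⟩ := hk
    rw [aff_vertices_apply_emb, aff_vertices_apply_emb]
    exact h k (by simpa only [wt_vertices] using hl)
  · push Not at hk
    rw [aff_vertices_apply_of_notMem f _ hk, aff_vertices_apply_of_notMem f _ hk]
    simpa using hε

lemma close_of_aff_vertices {ε : ℝ} {x y : Spx q}
    (h : Close w t ε (aff (vertices m ∘ f) x) (aff (vertices m ∘ f) y)) :
    Close (fun k => wt w (vertices m (f k))) t ε x y := by
  intro k hk
  have := h (f k) (by simpa only [wt_vertices] using hk)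
  rwa [aff_vertices_apply_emb, aff_vertices_apply_emb] at this

variable {f} {j : Fin (m + 1)}

lemma sum_eq_add_sum_emb (hf : ∀ l, l ≠ j ↔ ∃ k, f k = l) {M : Type*}
    [AddCommMonoid M] (g : Fin (m + 1) → M) :
    ∑ l, g l = g j + ∑ k, g (f k) := by
  classical
  have : (Finset.univ : Finset (Fin (q + 1))).map f = Finset.univ.erase j := by
    ext l
    simp [hf l]
  rw [← Finset.add_sum_erase _ _ (Finset.mem_univ j), ← this, Finset.sum_map]

lemma exists_aff_vertices_eq (hf : ∀ l, l ≠ j ↔ ∃ k, f k = l) {x : Spx m}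
    (hx : x j = 0) :
    ∃ x' : Spx q, aff (vertices m ∘ f) x' = x := by
  refine ⟨⟨fun k => x (f k), fun k => stdSimplex.zero_le x _, ?_⟩, ?_⟩
  · have := stdSimplex.sum_eq_one x
    rwa [sum_eq_add_sum_emb hf, hx, zero_add] at this
  · ext l
    by_cases hl : l = j
    · subst hl
      rw [aff_vertices_apply_of_notMem, hx]
      exact fun k hk => (hf l).2 ⟨k, hk⟩ rfl
    · obtain ⟨k, rfl⟩ := (hf l).1 hl
      rw [aff_vertices_apply_emb]
      rfl

lemma countLE_vertices_face (hf : ∀ l, l ≠ j ↔ ∃ k, f k = l)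
    (i : Fin (n + 1)) : countLE w i (vertices m) =
    (if w j ≤ i then 1 else 0) + countLE w i (vertices m ∘ f) := by
  unfold countLE
  rw [sum_eq_add_sum_emb hf]
  simp only [wt_vertices, Function.comp_apply]

lemma countLE_comp (v : Fin (q + 1) → Spx m) (i : Fin (n + 1)) :
    countLE (fun k => wt w (v k)) i (vertices q) = countLE w i v := by
  simp only [countLE, wt_vertices]

end Face

lemma meshBound_nonneg (σ : RegularSimplex 𝓕) (i : Fin (n + 1)) (k : ℕ) : 0 ≤ meshBound σ i k :=
  pow_nonneg (meshBound_base_mem _).1 k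

/-- A face has no more vertices up to level `i`, hence a smaller mesh bound, and it still has one of
weight `i`. So faces never need more subdivisions than the cell. -/
lemma GoodAt.comp_face {q : ℕ} {j : Fin (σ.dim + 1)} {f : Fin (q + 1) ↪ Fin (σ.dim + 1)}
    (hf : ∀ l, l ≠ j ↔ ∃ k, f k = l) (h : GoodAt 𝒰 t σ i k) (hm hr)
    (hex : ∃ k, wt σ.weight (vertices σ.dim (f k)) = i) :
    GoodAt 𝒰 t (σ.comp (vertices _ ∘ f) hm hr) i k := by
  have hpos := countLE_vertices_pos (σ := σ.comp (vertices _ ∘ f) hm hr) hex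
  have hbound : meshBound (σ.comp (vertices _ ∘ f) hm hr) i k ≤ meshBound σ i k := by
    refine pow_le_pow_left₀ (meshBound_base_mem _).1 (meshBound_base_mono hpos ?_) _
    rw [countLE_vertices_face hf]
    exact (countLE_comp (vertices _ ∘ f) i).le.trans (Nat.le_add_left _ _)
  intro p v h1 h2 ⟨a, ha⟩
  have hwt : ∀ a, wt σ.weight (aff (vertices _ ∘ f) (v a)) =
      wt (σ.comp (vertices _ ∘ f) hm hr).weight (v a) := fun a => wt_aff _ _
  obtain ⟨U, hU, H⟩ := h p (aff (vertices _ ∘ f) ∘ v) (fun a => (hwt a).trans_le (h1 a))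
    (fun a b => close_aff_vertices f ((h2 a b).mono hbound) (meshBound_nonneg _ _ _))
    ⟨a, ha.imp_right fun h => by rwa [Function.comp_apply, hwt]⟩
  exact ⟨U, hU, fun x hx => H _ (hx.map _)⟩

/-- When the omitted vertex lies beyond `i`, the part of weight at most `i` and the mesh bound are
unchanged, so goodness goes back from the face. -/
lemma GoodAt.of_comp_face {q : ℕ} {j : Fin (σ.dim + 1)} {f : Fin (q + 1) ↪ Fin (σ.dim + 1)}
    (hf : ∀ l, l ≠ j ↔ ∃ k, f k = l) {hm hr}
    (h : GoodAt 𝒰 t (σ.comp (vertices _ ∘ f) hm hr) i k) (hj : i < σ.weight j) :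
    GoodAt 𝒰 t σ i k := by
  have hbound : meshBound σ i k = meshBound (σ.comp (vertices _ ∘ f) hm hr) i k := by
    unfold meshBound
    rw [countLE_vertices_face hf, if_neg (not_le.2 hj), zero_add]
    congr 4
    exact (countLE_comp (vertices _ ∘ f) i).symm
  have hpull : ∀ x : Spx σ.dim, wt σ.weight x ≤ i → ∃ x' : Spx q, aff (vertices _ ∘ f) x' = x :=
    fun x hx => exists_aff_vertices_eq hf (by
      by_contra hne
      exact absurd (wt_le_iff.1 hx j hne) (not_le.2 hj))
  intro p v h1 h2 ⟨a, ha⟩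
  choose v' hv' using fun a => hpull (v a) (h1 a)
  have hwt : ∀ a, wt (σ.comp (vertices _ ∘ f) hm hr).weight (v' a) = wt σ.weight (v a) :=
    fun a => by rw [← hv' a, wt_aff]
  obtain ⟨U, hU, H⟩ := h p v' (fun a => (hwt a).trans_le (h1 a))
    (fun a b => close_of_aff_vertices f (by rw [hv', hv', ← hbound]; exact h2 a b))
    ⟨a, ha.imp_right fun h => by rwa [hwt]⟩
  refine ⟨U, hU, fun x hx => ?_⟩
  obtain ⟨x', hx'⟩ := hpull x (hx.wt_le h1)
  rw [← hx']
  refine H x' ?_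
  obtain ⟨y, hy0, hy1, hy⟩ := hx
  refine ⟨y, hy0, hy1, fun l => ?_⟩
  have := hy (f l)
  rw [← hx', aff_vertices_apply_emb] at this
  rw [this]
  refine Finset.sum_congr rfl fun a _ => ?_
  rw [← hv' a, aff_vertices_apply_emb]

lemma Good.face (h : Good 𝒰 t c k) (hc : c.Face c') : Good 𝒰 t c' k := by
  obtain ⟨i, h1, h2, h3⟩ := h
  cases hc with
  | vertex j f hf h => exact ⟨i, h1, h2, h3.comp_face hf _ _ (h.2 i h2)⟩
  | apex e he h => exact ⟨i, h1, h2.mono (Finset.erase_subset _ _), h3⟩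

/-- The number of vertices and apexes of a cell in the factors of index greater than `i`. -/
noncomputable def degreeAbove (i : Fin n) (c : Cell 𝓕) : ℕ :=
  (c.simplex.dim + 1 - countLE c.simplex.weight i.castSucc (vertices _)) + apexSign c.apexes i

lemma degreeAbove_ofTuple (i : Fin n) (E : Finset (Fin n)) {q : ℕ}
    (v : Fin (q + 1) → Spx σ.dim) (h) : degreeAbove i (Cell.ofTuple σ E v h) =
      (q + 1 - countLE σ.weight i.castSucc v) + apexSign E i := by
  unfold degreeAbove
  rw [← countLE_comp v]

lemma exists_face_emb {m q : ℕ} {j : Fin (m + 1)} {f : Fin (q + 1) ↪ Fin (m + 1)}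
    (hf : ∀ l, l ≠ j ↔ ∃ k, f k = l) : m = q + 1 := by
  have := sum_eq_add_sum_emb hf fun _ => (1 : ℕ)
  simp at this
  omega

lemma degreeAbove_vertex_face (i : Fin n) {q : ℕ} {j : Fin (c.simplex.dim + 1)}
    {f : Fin (q + 1) ↪ Fin (c.simplex.dim + 1)} (hf : ∀ l, l ≠ j ↔ ∃ k, f k = l) (h) :
    degreeAbove i c = degreeAbove i (Cell.ofTuple c.simplex c.apexes (vertices _ ∘ f) h) +
      if i.castSucc < c.simplex.weight j then 1 else 0 := by
  have h1 := exists_face_emb hf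
  have h2 := countLE_vertices_face (w := c.simplex.weight) hf i.castSucc
  have h3 := countLE_le (w := c.simplex.weight) i.castSucc (vertices _ ∘ f)
  rw [degreeAbove_ofTuple, degreeAbove, h2]
  rcases lt_or_ge i.castSucc (c.simplex.weight j) with h4 | h4
  · rw [if_neg (not_le.2 h4), if_pos h4]; omega
  · rw [if_pos h4, if_neg (not_lt.2 h4)]; omega

lemma apexSign_erase {E : Finset (Fin n)} {e : Fin n} (he : e ∈ E) (i : Fin n) :
    apexSign E i = apexSign (E.erase e) i + if i < e then 1 else 0 := by
  unfold apexSign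
  rw [Finset.filter_erase]
  split_ifs with h
  · rw [Finset.card_erase_add_one (by simp [he, h])]
  · rw [Finset.erase_eq_of_notMem (by simp [h]), add_zero]

lemma Cell.Face.degreeAbove_le (h : c.Face c') (i : Fin n) :
    degreeAbove i c ≤ degreeAbove i c' + 1 := by
  cases h with
  | vertex j f hf h =>
    rw [degreeAbove_vertex_face i hf h]
    split_ifs <;> omega
  | apex e he h =>
    unfold degreeAbove
    dsimp only
    rw [apexSign_erase he i]
    split_ifs <;> omega

/-- The number of subdivisions only depends on the part of a cell up to a level `i ≥ t` which is
not used as an apex. -/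
lemma Cell.Face.degreeAbove_le_of_not_good (h : c.Face c') (hc' : Good 𝒰 t c' k)
    (hc : ¬ Good 𝒰 t c k) {i : Fin n} (hi : i ∉ c.apexes) (hti : t ≤ (i : ℕ)) :
    degreeAbove i c ≤ degreeAbove i c' := by
  obtain ⟨i₀, h1, h2, h3⟩ := hc'
  have hmi := marked_castSucc.2 hi
  cases h with
  | vertex j f hf h =>
    rw [degreeAbove_vertex_face i hf h]
    split_ifs with hj
    · exfalso
      -- Goodness holds at the smaller of `i₀` and `i`, both at least `t`; the vertex lost lies
      -- beyond it, so `c` would be good too.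
      rcases le_total i₀ i.castSucc with hle | hle
      · exact hc ⟨i₀, h1, h2, h3.of_comp_face hf (hle.trans_lt hj)⟩
      · exact hc ⟨i.castSucc, hti, hmi,
          (h3.of_level_le hle (h.2 _ hmi)).of_comp_face hf hj⟩
    · exact le_rfl
  | apex e he h =>
    have hd : degreeAbove i c = degreeAbove i ⟨c.simplex, c.apexes.erase e, h⟩ +
        if i < e then 1 else 0 := by
      unfold degreeAbove
      dsimp only
      rw [apexSign_erase he i, add_assoc]
    rw [hd]
    split_ifs with hie
    · exfalso
      -- If `i₀ ≤ i < e`, the level `i₀` is not the removed apex and is admissible for `c`;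
      -- otherwise the level `i` is.
      rcases le_total i₀ i.castSucc with hle | hle
      · refine hc ⟨i₀, h1, fun e' he' => ?_, h3⟩
        by_cases hee : e' = e
        · subst hee
          exact (hle.trans_lt (Fin.castSucc_lt_castSucc_iff.2 hie)).ne'
        · exact h2 e' (Finset.mem_erase.2 ⟨hee, he'⟩)
      · exact hc ⟨i.castSucc, hti, hmi, h3.of_level_le hle (c.legal _ hmi)⟩
    · exact le_rfl

/-! #### The cells that the operators refer to -/

/-- `c'` lies in `c`, and its perverse degrees are not smaller than those of `c`. -/
structure Cell.Below (c c' : Cell 𝓕) : Prop where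
  image : c'.simplex.image ⊆ c.simplex.image
  apexes : c'.apexes ⊆ c.apexes
  degree : ∀ i, i ∉ c.apexes → degreeAbove i c ≤ degreeAbove i c'

lemma Cell.Below.refl (c : Cell 𝓕) : c.Below c := ⟨subset_rfl, subset_rfl, fun _ _ => le_rfl⟩

lemma Cell.Below.trans {c'' : Cell 𝓕} (h : c.Below c') (h' : c'.Below c'') : c.Below c'' :=
  ⟨h'.image.trans h.image, h'.apexes.trans h.apexes, fun i hi =>
    (h.degree i hi).trans (h'.degree i fun hi' => hi (h.apexes hi'))⟩

lemma image_comp_subset (σ : RegularSimplex 𝓕) {q : ℕ} (v : Fin (q + 1) → Spx σ.dim) (hm hr) :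
    (σ.comp v hm hr).image ⊆ σ.image := by
  rintro _ ⟨x, rfl⟩
  exact ⟨aff v x, rfl⟩

lemma Cell.Face.image_subset (h : c.Face c') : c'.simplex.image ⊆ c.simplex.image := by
  cases h with
  | vertex j f hf h => exact image_comp_subset _ _ _ _
  | apex e he h => exact subset_rfl

lemma Cell.Face.apexes_subset (h : c.Face c') : c'.apexes ⊆ c.apexes := by
  cases h with
  | vertex j f hf h => exact subset_rfl
  | apex e he h => exact Finset.erase_subset _ _

lemma below_of_iterPiece {u : Fin (c.simplex.dim + 1) → Spx c.simplex.dim}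
    (hu : IterPiece (relData c.simplex.weight t) k (vertices _) u) (h) :
    c.Below (Cell.ofTuple c.simplex c.apexes u h) := by
  refine ⟨image_comp_subset _ _ _ _, subset_rfl, fun i _ => ?_⟩
  rw [degreeAbove_ofTuple]
  have := hu.countLE_le i.castSucc
  unfold degreeAbove
  omega

/-- The extra `1` for `i < t` is what offsets the vertex or apex lost in passing to a face. -/
lemma degreeAbove_le_of_homotopyPiece {u' : Fin (c.simplex.dim + 1) → Spx c.simplex.dim}
    {u : Fin (c.simplex.dim + 2) → Spx c.simplex.dim}
    (hu' : IterPiece (relData c.simplex.weight t) k (vertices _) u')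
    (hu : HomotopyPiece (relData c.simplex.weight t) u' u) (h) (i : Fin n) :
    degreeAbove i c + (if (i : ℕ) < t then 1 else 0) ≤
      degreeAbove i (Cell.ofTuple c.simplex c.apexes u h) := by
  rw [degreeAbove_ofTuple]
  have h1 := hu'.countLE_le i.castSucc
  have h2 := hu.countLE_le i.castSucc
  have h3 := countLE_le (w := c.simplex.weight) i.castSucc (vertices c.simplex.dim)
  unfold degreeAbove
  split_ifs with hi
  · have h4 := hu.countLE_le_of_lt (i := i.castSucc) hi
    omega
  · omega

lemma below_of_homotopyPiece {u' : Fin (c.simplex.dim + 1) → Spx c.simplex.dim}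
    {u : Fin (c.simplex.dim + 2) → Spx c.simplex.dim}
    (hu' : IterPiece (relData c.simplex.weight t) k (vertices _) u')
    (hu : HomotopyPiece (relData c.simplex.weight t) u' u) (h) :
    c.Below (Cell.ofTuple c.simplex c.apexes u h) :=
  ⟨image_comp_subset _ _ _ _, subset_rfl, fun i _ =>
    (Nat.le_add_right _ _).trans (degreeAbove_le_of_homotopyPiece hu' hu h i)⟩

end Small

end BlownUp

namespace BlownUp

variable {X : Type*} [TopologicalSpace X] {n : ℕ} {𝓕 : Filtration X n}

/-! ### Making cells small -/

section Operators

variable {R : Type*} [CommRing R] {𝒰 : Set (Set X)} {t : ℕ} {c : Cell 𝓕} {f : Cell 𝓕 → R}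

variable (R 𝓕 𝒰) in
/-- One step of the subdivision of the cells into small cells. -/
noncomputable def subdivOp (t : ℕ) : (Cell 𝓕 → R) →ₗ[R] (Cell 𝓕 → R) :=
  LinearMap.id - coboundary 𝓕 R ∘ₗ homotopyOp R t (subdivNumber 𝒰 t) -
    homotopyOp R t (subdivNumber 𝒰 t) ∘ₗ coboundary 𝓕 R

lemma sub_subdivOp (f : Cell 𝓕 → R) : f - subdivOp 𝓕 R 𝒰 t f =
    coboundary 𝓕 R (homotopyOp R t (subdivNumber 𝒰 t) f) +
      homotopyOp R t (subdivNumber 𝒰 t) (coboundary 𝓕 R f) := by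
  simp only [subdivOp, LinearMap.sub_apply, LinearMap.comp_apply, LinearMap.id_apply]
  abel

/-- Freezing the number of subdivisions at its value for `c` gives the plain subdivision and does
not change `Tδ` at `c`. The error is a coboundary, which is read off on the faces of `c`. -/
lemma subdivOp_apply (f : Cell 𝓕 → R) (c : Cell 𝓕) : subdivOp 𝓕 R 𝒰 t f c =
    eval f c.simplex c.apexes _ (c.simplex.subdivision R t (subdivNumber 𝒰 t c)) +
      coboundary 𝓕 R (homotopyOp R t (fun _ => subdivNumber 𝒰 t c) f -
        homotopyOp R t (subdivNumber 𝒰 t) f) c := by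
  have h1 := homotopyOp_const (R := R) (f := f) (t := t) (subdivNumber 𝒰 t c) c
  have h2 : homotopyOp R t (fun _ => subdivNumber 𝒰 t c) (coboundary 𝓕 R f) c =
    homotopyOp R t (subdivNumber 𝒰 t) (coboundary 𝓕 R f) c := rfl
  have h3 := congrFun (sub_subdivOp (𝒰 := 𝒰) (t := t) f) c
  rw [Pi.sub_apply, Pi.add_apply] at h3
  rw [map_sub, Pi.sub_apply]
  linear_combination h2 - h1 - h3

lemma homotopyOp_eq_zero {N : Cell 𝓕 → ℕ} {c : Cell 𝓕}
    (h : ∀ k < N c, ∀ u', IterPiece (relData c.simplex.weight t) k (vertices _) u' →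
      ∀ u (_ : HomotopyPiece (relData c.simplex.weight t) u' u)
        (hu : IsLegal c.simplex.weight c.apexes u),
        f (Cell.ofTuple c.simplex c.apexes u hu) = 0) :
    homotopyOp R t N f c = 0 := by
  rw [homotopyOp_apply, RegularSimplex.homotopy, eval_eq_zero (iterHomotopy_mem_supported _ _),
    mul_zero]
  rintro u ⟨k, hk, u', h1, h2⟩
  exact val_eq_zero fun hl => h k hk u' h1 u h2 hl

/-- The homotopies are sums over `k`; their difference only contains the terms from `N c` to `M c -
1`, for which `k` is good for a face but not for the cell. -/
lemma homotopyOp_sub_eq_zero {N M : Cell 𝓕 → ℕ} {c : Cell 𝓕} (hNM : N c ≤ M c)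
    (h : ∀ k, N c ≤ k → k < M c →
      ∀ u', IterPiece (relData c.simplex.weight t) k (vertices _) u' →
      ∀ u (_ : HomotopyPiece (relData c.simplex.weight t) u' u)
        (hu : IsLegal c.simplex.weight c.apexes u),
        f (Cell.ofTuple c.simplex c.apexes u hu) = 0) :
    (homotopyOp R t M f - homotopyOp R t N f) c = 0 := by
  rw [Pi.sub_apply, homotopyOp_apply, homotopyOp_apply, ← mul_sub, ← map_sub]
  simp only [RegularSimplex.homotopy, iterHomotopy, ← LinearMap.sub_apply]
  rw [← Finset.sum_Ico_eq_sub (fun k => subdivHomotopy R (relData c.simplex.weight t) _ ∘ₗ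
    iterSubdiv R (relData c.simplex.weight t) k _) hNM, LinearMap.sum_apply, map_sum, Finset.sum_eq_zero, mul_zero]
  intro k hk
  rw [Finset.mem_Ico] at hk
  rw [LinearMap.comp_apply]
  have hmem := map_mem_supported R
    (subdivHomotopy R (relData c.simplex.weight t) (c.simplex.dim + 1))
    (iterSubdiv_mem_supported R (S := relData c.simplex.weight t) k (vertices c.simplex.dim))
    (B := {u | ∃ u', IterPiece (relData c.simplex.weight t) k (vertices _) u' ∧
      HomotopyPiece (relData c.simplex.weight t) u' u}) fun v hv =>
        Finsupp.supported_mono (show {u | HomotopyPiece (relData c.simplex.weight t) v u} ⊆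
          {u | ∃ u', IterPiece (relData c.simplex.weight t) k (vertices _) u' ∧
            HomotopyPiece (relData c.simplex.weight t) u' u} from fun u hu => ⟨v, hv, hu⟩)
          (subdivHomotopy_mem_supported R v)
  refine eval_eq_zero hmem ?_
  rintro u ⟨u', h1, h2⟩
  exact val_eq_zero fun hl => h k hk.1 hk.2 u' h1 u h2 hl

lemma subdivNumber_face_le (h𝒰 : ∀ U ∈ 𝒰, IsOpen U) (hcover : ⋃₀ 𝒰 = Set.univ) (ht : t ≤ n)
    (hc : PartlySmall 𝒰 t c) {c' : Cell 𝓕} (h : c.Face c') :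
    subdivNumber 𝒰 t c' ≤ subdivNumber 𝒰 t c :=
  Nat.sInf_le ((good_of_subdivNumber_le (exists_good h𝒰 hcover ht hc) le_rfl).face h)

/-- The subdivision of a cell which is already small is trivial. -/
lemma subdivOp_apply_of_small (h : PartlySmall 𝒰 (t + 1) c) : subdivOp 𝓕 R 𝒰 t f c = f c := by
  rw [subdivOp_apply, subdivNumber_eq_zero h, coboundary_eq_zero, add_zero]
  · exact (eval_single _).trans (val_vertices c)
  · intro c' hc'
    exact homotopyOp_sub_eq_zero (subdivNumber_eq_zero (h.face hc')).le fun k _ hk =>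
      absurd hk (Nat.not_lt_zero k)

/-- This is where locality is proved: the pieces of the subdivision of `c` and the correction terms
on its faces all lie in cells that are small in the new sense and below `c`. -/
lemma subdivOp_eq_zero (h𝒰 : ∀ U ∈ 𝒰, IsOpen U) (hcover : ⋃₀ 𝒰 = Set.univ) (ht : t ≤ n)
    (hc : PartlySmall 𝒰 t c)
    (h : ∀ c', PartlySmall 𝒰 (t + 1) c' → c.Below c' → f c' = 0) :
    subdivOp 𝓕 R 𝒰 t f c = 0 := by
  have hex := exists_good h𝒰 hcover ht hc
  rw [subdivOp_apply, coboundary_eq_zero, add_zero]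
  · refine eval_eq_zero (iterSubdiv_mem_supported R _ _) fun u hu => val_eq_zero fun hl => ?_
    exact h _ (partlySmall_of_good hc (good_of_subdivNumber_le hex le_rfl) hu
      (spanned_apply u) (fun a => ⟨a, rfl⟩) hl) (below_of_iterPiece hu hl)
  · intro c' hc'
    have hps := hc.face hc'
    have hex' := exists_good h𝒰 hcover ht hps
    refine homotopyOp_sub_eq_zero (subdivNumber_face_le h𝒰 hcover ht hc hc') ?_
    intro k hk hk' u' hu' u hu hl
    have hgood := good_of_subdivNumber_le hex' hk
    refine h _ (partlySmall_of_good hps hgood hu' hu.spanned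
      (fun a => hu.exists_wt_eq a) hl)
      ⟨(image_comp_subset _ _ _ _).trans hc'.image_subset, hc'.apexes_subset, fun i hi => ?_⟩
    have h1 := degreeAbove_le_of_homotopyPiece hu' hu hl i
    -- For `i < t` the face loses at most one and the homotopy gains one. For `i ≥ t` the face loses
    -- nothing beyond `i`, because `k` is good for `c'` and not for `c`.
    by_cases hit : (i : ℕ) < t
    · have h2 := hc'.degreeAbove_le i
      rw [if_pos hit] at h1
      exact h2.trans h1
    · rw [if_neg hit] at h1
      exact (hc'.degreeAbove_le_of_not_good hgood (not_good_of_lt hk') hi (not_lt.1 hit)).trans h1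

lemma homotopyOp_subdivNumber_eq_zero (hc : PartlySmall 𝒰 t c) {N : Cell 𝓕 → ℕ}
    (h : ∀ c', PartlySmall 𝒰 t c' → c.Below c' → f c' = 0) : homotopyOp R t N f c = 0 :=
  homotopyOp_eq_zero fun _ _ _ hu' _ hu hl => h _ (hc.ofTuple _ hl)
    (below_of_homotopyPiece hu' hu hl)

/-- There is an operator on functions on cells, homotopic to the identity, such that its values
only depend on the values at the small cells below, and which does not change those. -/
lemma exists_subdivision (R : Type*) [CommRing R] (h𝒰 : ∀ U ∈ 𝒰, IsOpen U)
    (hcover : ⋃₀ 𝒰 = Set.univ) (t : ℕ) (ht : t ≤ n + 1) :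
    ∃ Φ Ψ : (Cell 𝓕 → R) →ₗ[R] (Cell 𝓕 → R),
      (∀ f, f - Φ f = coboundary 𝓕 R (Ψ f) + Ψ (coboundary 𝓕 R f)) ∧
      (∀ f c, PartlySmall 𝒰 t c → Φ f c = f c) ∧
      (∀ f c, (∀ c', PartlySmall 𝒰 t c' → c.Below c' → f c' = 0) → Φ f c = 0) ∧
      ∀ f c, (∀ c', c.Below c' → f c' = 0) → Ψ f c = 0 := by
  induction t with
  | zero =>
    refine ⟨LinearMap.id, 0, fun f => by simp, fun f c _ => rfl, fun f c h => ?_, fun _ _ _ => rfl⟩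
    exact h c trivial (.refl c)
  | succ t ih =>
    obtain ⟨Φ, Ψ, h1, h2, h3, h4⟩ := ih (by omega)
    have hcomm : ∀ f, Φ (coboundary 𝓕 R f) = coboundary 𝓕 R (Φ f) := fun f => by
      have e1 := h1 (coboundary 𝓕 R f)
      have e2 := congrArg (coboundary 𝓕 R) (h1 f)
      rw [map_sub, map_add, coboundary_coboundary, zero_add] at e2
      rw [coboundary_coboundary, map_zero, add_zero, ← e2] at e1
      exact sub_right_injective e1
    -- With `Σ` the new step, `id - ΦΣ = (id - Φ) + Φ(id - Σ)`, and `Φ` commutes with the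
    -- coboundary. `Φ` stands on the left because it reads its argument only at cells that are
    -- `PartlySmall` at level `t`, where the new step is controlled.
    refine ⟨Φ ∘ₗ subdivOp 𝓕 R 𝒰 t, Ψ + Φ ∘ₗ homotopyOp R t (subdivNumber 𝒰 t),
      fun f => ?_, fun f c hc => ?_, fun f c h => ?_, fun f c h => ?_⟩
    · have e1 := congrArg Φ (sub_subdivOp (𝒰 := 𝒰) (t := t) f)
      rw [map_sub, map_add, hcomm] at e1
      simp only [LinearMap.comp_apply, LinearMap.add_apply, map_add]
      rw [add_add_add_comm, ← h1, ← e1, sub_add_sub_cancel]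
    · exact (h2 _ c hc.of_succ).trans (subdivOp_apply_of_small hc)
    · refine h3 _ c fun c' hc' hcc' => ?_
      exact subdivOp_eq_zero h𝒰 hcover (by omega) hc' fun c'' hc'' hcc'' =>
        h c'' hc'' (hcc'.trans hcc'')
    · rw [LinearMap.add_apply, Pi.add_apply, h4 f c h, zero_add]
      refine h3 _ c fun c' hc' hcc' => ?_
      exact homotopyOp_subdivNumber_eq_zero hc' fun c'' _ hcc'' => h c'' (hcc'.trans hcc'')

lemma partlySmall_iff_mem_small : PartlySmall 𝒰 (n + 1) c ↔ c.simplex ∈ small 𝓕 𝒰 := by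
  constructor
  · rintro ⟨i, h1, -, U, hU, h⟩
    refine ⟨U, hU, ?_⟩
    rintro _ ⟨x, rfl⟩
    exact h x (Fin.le_def.2 ((wt _ x).is_le.trans h1))
  · rintro ⟨U, hU, h⟩
    exact ⟨Fin.last n, le_rfl, marked_last _, U, hU, fun x _ => h ⟨x, rfl⟩⟩

end Operators

end BlownUp

namespace BlownUp

/-! ### Comparison with cochains -/

section Faces

variable {m n k : ℕ}

/-- The face of a blow up with the given vertices and apexes. -/
def faceOf (s : Finset (Fin (m + 1))) (E : Finset (Fin n)) : Finset (Vertex m n) :=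
  (s.disjSum E).map toLex.toEmbedding

@[simp] lemma realVertex_mem_faceOf {s : Finset (Fin (m + 1))} {E : Finset (Fin n)}
    {j : Fin (m + 1)} : realVertex n j ∈ faceOf s E ↔ j ∈ s := by
  simp [faceOf, realVertex]

@[simp] lemma virtualVertex_mem_faceOf {s : Finset (Fin (m + 1))} {E : Finset (Fin n)}
    {e : Fin n} : virtualVertex m e ∈ faceOf s E ↔ e ∈ E := by
  simp [faceOf, virtualVertex]

lemma vertex_cases {p : Vertex m n → Prop} (v : Vertex m n) (h1 : ∀ j, p (realVertex n j))
    (h2 : ∀ e, p (virtualVertex m e)) : p v := by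
  rcases v with j | e
  · exact h1 j
  · exact h2 e

/-- The vertices of a face of a blow up. -/
def realPart (c : Finset (Vertex m n)) : Finset (Fin (m + 1)) :=
  Finset.univ.filter fun j => realVertex n j ∈ c

/-- The apexes of a face of a blow up. -/
def virtualPart (c : Finset (Vertex m n)) : Finset (Fin n) :=
  Finset.univ.filter fun e => virtualVertex m e ∈ c

@[simp] lemma mem_realPart {c : Finset (Vertex m n)} {j : Fin (m + 1)} :
    j ∈ realPart c ↔ realVertex n j ∈ c := by simp [realPart]

@[simp] lemma mem_virtualPart {c : Finset (Vertex m n)} {e : Fin n} :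
    e ∈ virtualPart c ↔ virtualVertex m e ∈ c := by simp [virtualPart]

lemma vertexFinset_ext {c d : Finset (Vertex m n)} (h1 : ∀ j, realVertex n j ∈ c ↔ realVertex n j ∈ d)
    (h2 : ∀ e, virtualVertex m e ∈ c ↔ virtualVertex m e ∈ d) : c = d :=
  Finset.ext fun v => vertex_cases (p := fun v => v ∈ c ↔ v ∈ d) v h1 h2

@[simp] lemma faceOf_parts (c : Finset (Vertex m n)) : faceOf (realPart c) (virtualPart c) = c :=
  vertexFinset_ext (by simp) (by simp)

@[simp] lemma realPart_faceOf (s : Finset (Fin (m + 1))) (E : Finset (Fin n)) :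
    realPart (faceOf s E) = s := by ext; simp

@[simp] lemma virtualPart_faceOf (s : Finset (Fin (m + 1))) (E : Finset (Fin n)) :
    virtualPart (faceOf s E) = E := by ext; simp

lemma faceOf_erase_real (s : Finset (Fin (m + 1))) (E : Finset (Fin n)) (j : Fin (m + 1)) :
    (faceOf s E).erase (realVertex n j) = faceOf (s.erase j) E :=
  vertexFinset_ext (by simp [realVertex]) (by simp [realVertex, virtualVertex])

lemma faceOf_erase_virtual (s : Finset (Fin (m + 1))) (E : Finset (Fin n)) (e : Fin n) :
    (faceOf s E).erase (virtualVertex m e) = faceOf s (E.erase e) :=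
  vertexFinset_ext (by simp [realVertex, virtualVertex]) (by simp [virtualVertex])

lemma sum_faceOf {M : Type*} [AddCommMonoid M] (s : Finset (Fin (m + 1))) (E : Finset (Fin n))
    (g : Vertex m n → M) :
    ∑ v ∈ faceOf s E, g v = ∑ j ∈ s, g (realVertex n j) + ∑ e ∈ E, g (virtualVertex m e) := by
  rw [faceOf, Finset.sum_map, Finset.sum_disjSum]; rfl

lemma card_filter_faceOf (s : Finset (Fin (m + 1))) (E : Finset (Fin n)) (p : Vertex m n → Prop)
    [DecidablePred p] : ((faceOf s E).filter p).card =
      (s.filter fun j => p (realVertex n j)).card +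
        (E.filter fun e => p (virtualVertex m e)).card := by
  simp only [Finset.card_filter, sum_faceOf]

variable (w : Fin (m + 1) → Fin (n + 1))

/-- The number of vertices of a face after a given vertex. -/
def afterCount (c : Finset (Vertex m n)) (v : Vertex m n) : ℕ := (c.filter fun u => v < u).card

lemma afterCount_real (E : Finset (Fin n)) (j : Fin (m + 1)) :
    afterCount (faceOf Finset.univ E) (realVertex n j) = (m - j) + E.card := by
  rw [afterCount, card_filter_faceOf]
  congr 1
  · have : (Finset.univ.filter fun i : Fin (m + 1) => realVertex n j < realVertex n i) =
        Finset.Ioi j := by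
      ext i
      simp [realVertex]
    rw [this, Fin.card_Ioi]
    omega
  · have : (E.filter fun e => realVertex n j < virtualVertex m e) = E :=
      Finset.filter_true_of_mem fun e _ => Sum.Lex.inl_lt_inr _ _
    rw [this]

lemma afterCount_virtual (E : Finset (Fin n)) (e : Fin n) :
    afterCount (faceOf (Finset.univ : Finset (Fin (m + 1))) E) (virtualVertex m e) =
      apexSign E e := by
  have : (Finset.univ.filter fun j => virtualVertex m e < realVertex n j) = ∅ :=
    Finset.filter_false_of_mem fun j _ => Sum.Lex.not_inr_lt_inl
  rw [afterCount, card_filter_faceOf, this, Finset.card_empty, zero_add, apexSign]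
  congr 1
  ext i
  simp [virtualVertex]

/-- The sign exponent of the change of orientation between a product of simplices and their
join. -/
def twist (c : Finset (Vertex m n)) : ℕ :=
  ∑ u ∈ c, (factor w u : ℕ) +
    ∑ u ∈ c, (c.filter fun u' => u < u' ∧ factor w u < factor w u').card

lemma card_filter_erase {α : Type*} [DecidableEq α] {s : Finset α} {a : α} (ha : a ∈ s)
    (p : α → Prop) [DecidablePred p] :
    (s.filter p).card = ((s.erase a).filter p).card + if p a then 1 else 0 := by
  rw [Finset.filter_erase]
  split_ifs with h
  · rw [Finset.card_erase_add_one (by simp [ha, h])]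
  · rw [Finset.erase_eq_of_notMem (by simp [h]), add_zero]

lemma twist_erase {c : Finset (Vertex m n)} {v : Vertex m n} (hv : v ∈ c) :
    twist w c = twist w (c.erase v) + factor w v +
      (c.filter fun u => v < u ∧ factor w v < factor w u).card +
      (c.filter fun u => u < v ∧ factor w u < factor w v).card := by
  unfold twist
  rw [← Finset.add_sum_erase _ _ hv, ← Finset.add_sum_erase _ (fun u =>
    (c.filter fun u' => u < u' ∧ factor w u < factor w u').card) hv]
  have h1 : ∑ u ∈ c.erase v, (c.filter fun u' => u < u' ∧ factor w u < factor w u').card =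
      ∑ u ∈ c.erase v, ((c.erase v).filter fun u' => u < u' ∧ factor w u < factor w u').card +
      ((c.erase v).filter fun u => u < v ∧ factor w u < factor w v).card := by
    rw [Finset.card_filter (fun u => u < v ∧ factor w u < factor w v), ← Finset.sum_add_distrib]
    exact Finset.sum_congr rfl fun u _ => card_filter_erase hv _
  have h2 := card_filter_erase hv fun u => u < v ∧ factor w u < factor w v
  simp only [lt_irrefl, false_and, if_false, add_zero] at h2
  rw [h1, h2]
  omega

lemma sum_factorDim_add {c : Finset (Vertex m n)} (hc : ∀ i, ∃ v ∈ c, factor w v = i)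
    (s : Finset (Fin (n + 1))) :
    ∑ i ∈ s, factorDim w c i + s.card = (c.filter fun v => factor w v ∈ s).card := by
  have h1 : ∀ i ∈ s, factorDim w c i + 1 = (c.filter fun v => factor w v = i).card := by
    intro i _
    obtain ⟨v, hv, hvi⟩ := hc i
    have : 0 < (c.filter fun v => factor w v = i).card :=
      Finset.card_pos.2 ⟨v, by simp [hv, hvi]⟩
    unfold factorDim
    omega
  rw [Finset.card_eq_sum_ones s, ← Finset.sum_add_distrib, Finset.sum_congr rfl h1,
    Finset.card_eq_sum_card_fiberwise (s := c.filter fun v => factor w v ∈ s) (f := factor w)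
      (t := s) fun v hv => (Finset.mem_filter.1 hv).2]
  refine Finset.sum_congr rfl fun i hi => ?_
  rw [Finset.filter_filter]
  congr 1
  ext v
  simp only [Finset.mem_filter]
  exact ⟨fun h => ⟨h.1, h.2 ▸ hi, h.2⟩, fun h => ⟨h.1, h.2.2⟩⟩

lemma isFace_iff {c : Finset (Vertex m n)} :
    IsFace w k c ↔ (∀ i, ∃ v ∈ c, factor w v = i) ∧ c.card = k + n + 1 := by
  refine and_congr_right fun hc => ?_
  have := sum_factorDim_add w hc Finset.univ
  simp at this
  omega

/-- On nonempty factors the dimension is the number of vertices minus one, so the Koszul part of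
`signExp` counts the vertices in earlier factors minus the index of the factor. Sorting the vertices
by position and by factor relative to `v`, each class is counted an even number of times. Hence
`twist` turns the product sign into the join sign. -/
lemma even_signExp {c : Finset (Vertex m n)} (hc : ∀ i, ∃ v ∈ c, factor w v = i) {v : Vertex m n}
    (hv : v ∈ c) :
    Even (signExp w c v + afterCount c v + twist w c + twist w (c.erase v)) := by
  have h1 := sum_factorDim_add w hc (Finset.univ.filter fun i => i < factor w v)
  have h2 : (Finset.univ.filter fun i => i < factor w v).card = (factor w v : ℕ) := by
    have : (Finset.univ.filter fun i => i < factor w v) = Finset.Iio (factor w v) := by ext; simp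
    rw [this, Fin.card_Iio]
  simp only [Finset.mem_filter, Finset.mem_univ, true_and] at h1
  have h3 : (c.filter fun u => factor w u < factor w v).card =
      (c.filter fun u => u < v ∧ factor w u < factor w v).card +
      (c.filter fun u => v < u ∧ factor w u < factor w v).card := by
    rw [← Finset.card_union_of_disjoint, ← Finset.filter_or]
    · congr 1
      ext u
      simp only [Finset.mem_filter]
      refine and_congr_right fun _ => ⟨fun h => ?_, fun h => by tauto⟩
      rcases lt_trichotomy u v with h' | h' | h'
      · exact Or.inl ⟨h', h⟩
      · exact absurd h (by rw [h']; exact lt_irrefl _)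
      · exact Or.inr ⟨h', h⟩
    · rw [Finset.disjoint_filter]
      exact fun u _ h h' => lt_asymm h.1 h'.1
  have h4 : afterCount c v = (c.filter fun u => factor w u = factor w v ∧ v < u).card +
      (c.filter fun u => v < u ∧ factor w u < factor w v).card +
      (c.filter fun u => v < u ∧ factor w v < factor w u).card := by
    unfold afterCount
    rw [← Finset.card_union_of_disjoint, ← Finset.filter_or, ← Finset.card_union_of_disjoint,
      ← Finset.filter_or]
    · congr 1
      ext u
      simp only [Finset.mem_filter]
      refine and_congr_right fun _ => ⟨fun h => ?_, fun h => by tauto⟩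
      rcases lt_trichotomy (factor w u) (factor w v) with h' | h' | h' <;> tauto
    · rw [Finset.disjoint_filter]
      intro u _ h h'
      rcases h with h | h
      · exact h'.2.ne h.1.symm
      · exact lt_asymm h.2 h'.2
    · rw [Finset.disjoint_filter]
      exact fun u _ h h' => h'.2.ne h.1
  have h5 := twist_erase w hv
  unfold signExp
  rw [Nat.even_iff]
  omega

lemma neg_one_pow_signExp {R : Type*} [CommRing R] {c : Finset (Vertex m n)}
    (hc : ∀ i, ∃ v ∈ c, factor w v = i) {v : Vertex m n} (hv : v ∈ c) :
    (-1 : R) ^ signExp w c v * (-1) ^ twist w (c.erase v) =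
      (-1) ^ twist w c * (-1) ^ afterCount c v := by
  rw [← pow_add, ← pow_add]
  obtain ⟨r, hr⟩ := even_signExp w hc hv
  rcases neg_one_pow_eq_or R (signExp w c v + twist w (c.erase v)) with h | h <;>
  rcases neg_one_pow_eq_or R (twist w c + afterCount c v) with h' | h'
  · rw [h, h']
  · have : (-1 : R) ^ (signExp w c v + twist w (c.erase v)) *
        (-1) ^ (twist w c + afterCount c v) = 1 := by
      rw [← pow_add, show signExp w c v + twist w (c.erase v) + (twist w c + afterCount c v) =
        r + r by omega, ← two_mul, pow_mul]; simp
    rw [h, one_mul] at this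
    rw [h, this]
  · have : (-1 : R) ^ (signExp w c v + twist w (c.erase v)) *
        (-1) ^ (twist w c + afterCount c v) = 1 := by
      rw [← pow_add, show signExp w c v + twist w (c.erase v) + (twist w c + afterCount c v) =
        r + r by omega, ← two_mul, pow_mul]; simp
    rw [h', mul_one] at this
    rw [h', this]
  · rw [h, h']

variable {w} {m' : ℕ}

lemma twist_map (f : Fin (m' + 1) ↪o Fin (m + 1)) (c : Finset (Vertex m' n)) :
    twist w (c.map (vertexMap n f)) = twist (fun j => w (f j)) c := by
  unfold twist
  simp only [Finset.sum_map, Finset.filter_map, Finset.card_map, Function.comp_def,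
    factor_vertexMap, vertexMap_lt]

lemma map_faceOf (f : Fin (m' + 1) ↪o Fin (m + 1)) (s : Finset (Fin (m' + 1)))
    (E : Finset (Fin n)) :
    (faceOf s E).map (vertexMap n f) = faceOf (s.map f.toEmbedding) E := by
  have h1 : ∀ j, vertexMap n f (realVertex n j) = realVertex n (f j) := fun _ => rfl
  have h2 : ∀ e, vertexMap n f (virtualVertex m' e) = virtualVertex m e := fun _ => rfl
  refine vertexFinset_ext (fun j => ?_) fun e => ?_
  · simp only [Finset.mem_map, realVertex_mem_faceOf]
    constructor
    · rintro ⟨v, hv, hvj⟩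
      revert hv hvj
      refine vertex_cases (p := fun v => v ∈ faceOf s E → vertexMap n f v = _ → _) v
        (fun i hi hij => ?_) fun e _ he => ?_
      · rw [h1] at hij
        exact ⟨i, realVertex_mem_faceOf.1 hi, Sum.inl_injective (toLex.injective hij)⟩
      · rw [h2] at he
        exact absurd (toLex.injective he) Sum.inr_ne_inl
    · rintro ⟨i, hi, rfl⟩
      exact ⟨realVertex n i, realVertex_mem_faceOf.2 hi, rfl⟩
  · simp only [Finset.mem_map, virtualVertex_mem_faceOf]
    constructor
    · rintro ⟨v, hv, hve⟩
      revert hv hve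
      refine vertex_cases (p := fun v => v ∈ faceOf s E → vertexMap n f v = _ → _) v
        (fun i _ hi => ?_) fun e' he' he => ?_
      · rw [h1] at hi
        exact absurd (toLex.injective hi) Sum.inl_ne_inr
      · rw [h2] at he
        exact Sum.inr_injective (toLex.injective he) ▸ virtualVertex_mem_faceOf.1 he'
    · exact fun he => ⟨virtualVertex m' e, virtualVertex_mem_faceOf.2 he, rfl⟩

end Faces

end BlownUp

namespace BlownUp

variable {X : Type*} [TopologicalSpace X] {n : ℕ} {𝓕 : Filtration X n}

/-! ### Functions on cells evaluated at faces of a blow up. -/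

section FaceVal

variable {R : Type*} [CommRing R] {σ : RegularSimplex 𝓕} {m k : ℕ}

/-- All the factors of the product described by a set of vertices are nonempty. -/
def Nonvoid (w : Fin (m + 1) → Fin (n + 1)) (c : Finset (Vertex m n)) : Prop :=
  ∀ i, ∃ v ∈ c, factor w v = i

lemma nonvoid_faceOf_iff {w : Fin (m + 1) → Fin (n + 1)} {s : Finset (Fin (m + 1))}
    {E : Finset (Fin n)} :
    Nonvoid w (faceOf s E) ↔ ∀ i, Marked E i → ∃ j ∈ s, w j = i := by
  refine forall_congr' fun i => ⟨fun ⟨v, hv, hvi⟩ hi => ?_, fun h => ?_⟩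
  · revert hv hvi
    refine vertex_cases (p := fun v => v ∈ faceOf s E → factor w v = i → _) v
      (fun j hj hji => ⟨j, realVertex_mem_faceOf.1 hj, hji⟩) fun e he hei =>
        absurd hei (hi e (virtualVertex_mem_faceOf.1 he))
  · by_cases hi : Marked E i
    · obtain ⟨j, hj, hji⟩ := h hi
      exact ⟨realVertex n j, realVertex_mem_faceOf.2 hj, hji⟩
    · unfold Marked at hi
      push Not at hi
      obtain ⟨e, he, hei⟩ := hi
      exact ⟨virtualVertex m e, virtualVertex_mem_faceOf.2 he, hei⟩

lemma isFace_iff_nonvoid {w : Fin (m + 1) → Fin (n + 1)} {c : Finset (Vertex m n)} :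
    IsFace w k c ↔ Nonvoid w c ∧ c.card = k + n + 1 := isFace_iff w

lemma Nonvoid.lt_card {w : Fin (m + 1) → Fin (n + 1)} {c : Finset (Vertex m n)}
    (h : Nonvoid w c) : n < c.card := by
  have := ((isFace_iff (k := ∑ i, factorDim w c i) w).1 ⟨h, rfl⟩).2
  omega

/-- The value of a function on cells at a face of the blow up of a simplex, zero for sets of
vertices which do not describe a product of nonempty faces. -/
noncomputable def faceVal (f : Cell 𝓕 → R) (σ : RegularSimplex 𝓕)
    (c : Finset (Vertex σ.dim n)) : R :=
  val f σ (virtualPart c) (vertices σ.dim ∘ (realPart c).orderEmbOfFin rfl)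

lemma faceVal_faceOf (f : Cell 𝓕 → R) {s : Finset (Fin (σ.dim + 1))} (E : Finset (Fin n)) {q : ℕ}
    {e : Fin q → Fin (σ.dim + 1)} (he : StrictMono e) (hs : ∀ j, j ∈ s ↔ ∃ k, e k = j) :
    faceVal f σ (faceOf s E) = val f σ E (vertices σ.dim ∘ e) := by
  have hc : s.card = q := by
    have : s = Finset.univ.map ⟨e, he.injective⟩ := by
      ext j
      simp [hs]
    rw [this, Finset.card_map, Finset.card_univ, Fintype.card_fin]
  subst hc
  have := Finset.orderEmbOfFin_unique rfl (fun x => (hs _).2 ⟨x, rfl⟩) he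
  subst this
  unfold faceVal
  rw [virtualPart_faceOf]
  have : ∀ t (_ : t = s), val f σ E (vertices σ.dim ∘ t.orderEmbOfFin rfl) =
      val f σ E (vertices σ.dim ∘ s.orderEmbOfFin rfl) := by
    rintro t rfl
    rfl
  exact this _ (realPart_faceOf _ _)

lemma faceVal_cell (f : Cell 𝓕 → R) (c : Cell 𝓕) :
    faceVal f c.simplex (faceOf Finset.univ c.apexes) = f c := by
  rw [faceVal_faceOf f _ (e := id) strictMono_id (by simp), Function.comp_id, val_vertices]

lemma Cell.nonvoid (c : Cell 𝓕) : Nonvoid c.simplex.weight (faceOf Finset.univ c.apexes) :=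
  nonvoid_faceOf_iff.2 fun i hi =>
    let ⟨j, hj⟩ := c.legal i hi
    ⟨j, Finset.mem_univ j, hj⟩

lemma RegularSimplex.face_eq_comp (σ : RegularSimplex 𝓕) {m' : ℕ}
    (f : Fin (m' + 1) ↪o Fin (σ.dim + 1)) (hf) (hm hr) :
    σ.face f hf = σ.comp (vertices _ ∘ f) hm hr :=
  RegularSimplex.eq_of_map_eq rfl (fun x => congrArg σ.map (aff_vertices_comp f x).symm)
    fun j => (wt_vertices (f j)).symm

lemma val_face (g : Cell 𝓕 → R) {m' : ℕ} (f : Fin (m' + 1) ↪o Fin (σ.dim + 1)) (hf)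
    (E : Finset (Fin n)) {q : ℕ} (e : Fin q → Fin (m' + 1)) :
    val g (σ.face f hf) E (vertices m' ∘ e) = val g σ E (vertices σ.dim ∘ f ∘ e) := by
  have hm : Monotone (wt σ.weight ∘ vertices σ.dim ∘ f) :=
    σ.monotone_wt_vertices.comp f.monotone
  have hr : ∃ k, wt σ.weight ((vertices σ.dim ∘ f) k) = Fin.last n := by
    obtain ⟨k, hk⟩ := hf
    exact ⟨k, (wt_vertices _).trans hk⟩
  -- `face` and `comp` give simplices that are only propositionally equal, so the statement is
  -- generalised over the simplex before substituting.
  have key : ∀ (τ : RegularSimplex 𝓕) (_ : τ = σ.comp (vertices _ ∘ f) hm hr)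
      (hd : m' = τ.dim), val g τ E (vertices τ.dim ∘ fun k => (hd ▸ e k : Fin (τ.dim + 1))) =
        val g σ E (vertices σ.dim ∘ f ∘ e) := by
    rintro _ rfl hd
    have := val_comp (f := g) (E := E) hm hr (vertices m' ∘ e)
    refine this.trans ?_
    rw [← Function.comp_assoc, aff_comp_vertices]
    rfl
  exact key _ (σ.face_eq_comp f hf hm hr) rfl

lemma faceVal_face (g : Cell 𝓕 → R) {m' : ℕ} (f : Fin (m' + 1) ↪o Fin (σ.dim + 1)) (hf)
    (c : Finset (Vertex m' n)) :
    faceVal g (σ.face f hf) c = faceVal g σ (c.map (vertexMap n f)) := by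
  conv_rhs => rw [← faceOf_parts c, map_faceOf]
  rw [faceVal_faceOf (e := f ∘ (realPart c).orderEmbOfFin rfl) g _
    (f.strictMono.comp (OrderEmbedding.strictMono _))]
  · exact val_face g f hf _ _
  · intro j
    simp only [Finset.mem_map, Function.comp_apply]
    constructor
    · rintro ⟨i, hi, rfl⟩
      have : i ∈ Set.range ((realPart c).orderEmbOfFin rfl) := by
        rw [Finset.range_orderEmbOfFin]; exact hi
      obtain ⟨k, rfl⟩ := this
      exact ⟨k, rfl⟩
    · rintro ⟨k, rfl⟩
      exact ⟨_, Finset.orderEmbOfFin_mem _ rfl k, rfl⟩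

/-- A face of the blow up of a simplex is a cell on a face of this simplex. -/
lemma exists_cell {c : Finset (Vertex σ.dim n)} (hc : Nonvoid σ.weight c) :
    ∃ (m' : ℕ) (f : Fin (m' + 1) ↪o Fin (σ.dim + 1)) (hf : ∃ j, σ.weight (f j) = Fin.last n)
      (h : ∀ i, Marked (virtualPart c) i → ∃ j, (σ.face f hf).weight j = i),
      c = (faceOf Finset.univ (virtualPart c)).map (vertexMap n f) ∧
      ∀ g : Cell 𝓕 → R, faceVal g σ c = g ⟨σ.face f hf, virtualPart c, h⟩ := by
  rw [← faceOf_parts c, nonvoid_faceOf_iff] at hc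
  obtain ⟨j₀, hj₀, hw₀⟩ := hc _ (marked_last _)
  obtain ⟨m', hm'⟩ := Nat.exists_eq_succ_of_ne_zero (Finset.card_ne_zero_of_mem hj₀)
  have hrange : ∀ j ∈ realPart c, ∃ k, (realPart c).orderEmbOfFin hm' k = j := by
    intro j hj
    have : j ∈ Set.range ((realPart c).orderEmbOfFin hm') := by
      rw [Finset.range_orderEmbOfFin]; exact hj
    exact this
  have hf : ∃ j, σ.weight ((realPart c).orderEmbOfFin hm' j) = Fin.last n := by
    obtain ⟨k, hk⟩ := hrange _ hj₀
    exact ⟨k, hk ▸ hw₀⟩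
  have h : ∀ i, Marked (virtualPart c) i →
      ∃ j, (σ.face ((realPart c).orderEmbOfFin hm') hf).weight j = i := by
    intro i hi
    obtain ⟨j, hj, hji⟩ := hc i hi
    obtain ⟨k, hk⟩ := hrange _ hj
    exact ⟨k, (congrArg σ.weight hk).trans hji⟩
  have hmap : c = (faceOf Finset.univ (virtualPart c)).map
      (vertexMap n ((realPart c).orderEmbOfFin hm')) := by
    rw [map_faceOf]
    have : Finset.univ.map ((realPart c).orderEmbOfFin hm').toEmbedding = realPart c := by
      ext j
      simp only [Finset.mem_map, Finset.mem_univ, true_and]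
      exact ⟨fun ⟨k, hk⟩ => hk ▸ Finset.orderEmbOfFin_mem _ hm' k, hrange j⟩
    rw [this, faceOf_parts]
  refine ⟨m', _, hf, h, hmap, fun g => ?_⟩
  conv_lhs => rw [hmap]
  rw [← faceVal_face g _ hf]
  exact faceVal_cell g ⟨_, _, h⟩

lemma faceVal_eq_zero (f : Cell 𝓕 → R) {c : Finset (Vertex σ.dim n)}
    (hc : ¬ Nonvoid σ.weight c) : faceVal f σ c = 0 := by
  refine val_of_not_isLegal fun h => hc ?_
  rw [← faceOf_parts c, nonvoid_faceOf_iff]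
  intro i hi
  obtain ⟨k, hk⟩ := h.2 i hi
  exact ⟨_, Finset.orderEmbOfFin_mem _ rfl k, (wt_vertices _).symm.trans hk⟩

lemma afterCount_map {m' : ℕ} (f : Fin (m' + 1) ↪o Fin (m + 1)) (c : Finset (Vertex m' n))
    (v : Vertex m' n) :
    afterCount (c.map (vertexMap n f)) (vertexMap n f v) = afterCount c v := by
  unfold afterCount
  rw [Finset.filter_map, Finset.card_map]
  simp only [Function.comp_def, vertexMap_lt]

/-- Apexes come after all real vertices, so the two kinds of terms together form the simplicial
coboundary of a single join. -/
lemma coboundary_eq_sum (f : Cell 𝓕 → R) (c : Cell 𝓕) :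
    coboundary 𝓕 R f c = ∑ v ∈ faceOf Finset.univ c.apexes,
      (-1) ^ afterCount (faceOf Finset.univ c.apexes) v *
        faceVal f c.simplex ((faceOf Finset.univ c.apexes).erase v) := by
  rw [coboundary_apply, sum_faceOf, tupleBoundary_eq_sum, map_sum, Finset.mul_sum]
  congr 1
  · refine Finset.sum_congr rfl fun j _ => ?_
    rw [map_smul, eval_single, afterCount_real, faceOf_erase_real, smul_eq_mul, ← mul_assoc,
      ← pow_add, add_comm c.apexes.card,
      faceVal_faceOf (e := j.succAbove) f _ (Fin.strictMono_succAbove j)]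
    intro l
    simp [← Set.mem_range, Fin.range_succAbove]
  · refine Finset.sum_congr rfl fun e _ => ?_
    rw [afterCount_virtual, faceOf_erase_virtual,
      faceVal_faceOf (e := id) f _ strictMono_id (by simp), Function.comp_id]

lemma faceVal_coboundary (f : Cell 𝓕 → R) {c : Finset (Vertex σ.dim n)}
    (hc : Nonvoid σ.weight c) :
    faceVal (coboundary 𝓕 R f) σ c =
      ∑ v ∈ c, (-1) ^ afterCount c v * faceVal f σ (c.erase v) := by
  obtain ⟨m', φ, hf, h, hmap, hval⟩ := exists_cell (R := R) hc
  have key : ∀ (d : Finset (Vertex m' n)) (v : Vertex m' n),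
      (-1) ^ afterCount d v * faceVal f (σ.face φ hf) (d.erase v) =
        (-1) ^ afterCount (d.map (vertexMap n φ)) (vertexMap n φ v) *
          faceVal f σ ((d.map (vertexMap n φ)).erase (vertexMap n φ v)) := by
    intro d v
    rw [afterCount_map, ← Finset.map_erase, ← faceVal_face f φ hf]
  rw [hval, coboundary_eq_sum]
  conv_rhs => rw [hmap, Finset.sum_map]
  exact Finset.sum_congr rfl fun v _ => key _ v

end FaceVal

/-! #### Cochains and functions on cells -/

section Compare

variable {R : Type*} [CommRing R] {P Q : Set (RegularSimplex 𝓕)} {k : ℕ}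

lemma coeff_of_isFace {m : ℕ} {w : Fin (m + 1) → Fin (n + 1)} {ω : SimplexCochain R w k}
    {c : Finset (Vertex m n)} (h : IsFace w k c) : coeff ω c = ω ⟨c, h⟩ := dif_pos h

lemma coeff_of_not_isFace {m : ℕ} {w : Fin (m + 1) → Fin (n + 1)} {ω : SimplexCochain R w k}
    {c : Finset (Vertex m n)} (h : ¬ IsFace w k c) : coeff ω c = 0 := dif_neg h

open Classical in
variable (R P k) in
/-- The function on cells given by a cochain. -/
noncomputable def toCells : cochains R P k →ₗ[R] (Cell 𝓕 → R) where
  toFun ω c := if h : c.simplex ∈ P then (-1) ^ twist c.simplex.weight (faceOf Finset.univ c.apexes)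
    * coeff (ω.1 ⟨c.simplex, h⟩) (faceOf Finset.univ c.apexes) else 0
  map_add' ω η := by
    funext c
    simp only [Pi.add_apply]
    split_ifs with h
    · rw [← mul_add]
      congr 1
      unfold coeff
      split_ifs
      · rfl
      · rw [add_zero]
    · rw [add_zero]
  map_smul' r ω := by
    funext c
    simp only [Pi.smul_apply, smul_eq_mul, RingHom.id_apply]
    split_ifs with h
    · rw [mul_left_comm]
      congr 1
      unfold coeff
      split_ifs
      · rfl
      · rw [mul_zero]
    · rw [mul_zero]

lemma toCells_of_mem (ω : cochains R P k) {c : Cell 𝓕} (h : c.simplex ∈ P) :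
    toCells R P k ω c = (-1) ^ twist c.simplex.weight (faceOf Finset.univ c.apexes) *
      coeff (ω.1 ⟨c.simplex, h⟩) (faceOf Finset.univ c.apexes) := dif_pos h

lemma toCells_of_notMem (ω : cochains R P k) {c : Cell 𝓕} (h : c.simplex ∉ P) :
    toCells R P k ω c = 0 := dif_neg h

lemma faceVal_add (f g : Cell 𝓕 → R) (σ : RegularSimplex 𝓕) (c : Finset (Vertex σ.dim n)) :
    faceVal (f + g) σ c = faceVal f σ c + faceVal g σ c := val_add _

lemma faceVal_smul (r : R) (f : Cell 𝓕 → R) (σ : RegularSimplex 𝓕)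
    (c : Finset (Vertex σ.dim n)) : faceVal (r • f) σ c = r * faceVal f σ c := val_smul _ _

variable (R P k) in
/-- The cochain given by a function on cells. -/
noncomputable def fromCells : (Cell 𝓕 → R) →ₗ[R] cochains R P k where
  toFun f := ⟨fun σ c => (-1) ^ twist σ.1.weight c.1 * faceVal f σ.1 c.1, fun σ m' φ hf hP => by
    funext c
    change (-1) ^ twist _ _ * faceVal f σ.1 _ = (-1) ^ twist _ _ * faceVal f (σ.1.face φ hf) _
    rw [twist_map, faceVal_face]
    rfl⟩
  map_add' f g := by
    ext1; funext σ c
    change _ * faceVal (f + g) _ _ = _ * faceVal f _ _ + _ * faceVal g _ _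
    rw [faceVal_add, mul_add]
  map_smul' r f := by
    ext1; funext σ c
    change _ * faceVal (r • f) _ _ = r * (_ * faceVal f _ _)
    rw [faceVal_smul, mul_left_comm]

lemma fromCells_apply (f : Cell 𝓕 → R) (σ : P) (c : Face σ.1.weight k) :
    (fromCells R P k f).1 σ c = (-1) ^ twist σ.1.weight c.1 * faceVal f σ.1 c.1 := rfl

lemma coeff_fromCells (f : Cell 𝓕 → R) (σ : P) {c : Finset (Vertex σ.1.dim n)}
    (hc : IsFace σ.1.weight k c) :
    coeff ((fromCells R P k f).1 σ) c = (-1) ^ twist σ.1.weight c * faceVal f σ.1 c :=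
  coeff_of_isFace hc

/-- A set of simplices is closed under regular faces. -/
def FaceClosed (P : Set (RegularSimplex 𝓕)) : Prop :=
  ∀ σ ∈ P, ∀ (m' : ℕ) (f : Fin (m' + 1) ↪o Fin (σ.dim + 1))
    (hf : ∃ j, σ.weight (f j) = Fin.last n), σ.face f hf ∈ P

lemma faceClosed_univ : FaceClosed (Set.univ : Set (RegularSimplex 𝓕)) :=
  fun _ _ _ _ _ => Set.mem_univ _

lemma image_face_subset (σ : RegularSimplex 𝓕) {m' : ℕ} (f : Fin (m' + 1) ↪o Fin (σ.dim + 1))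
    (hf) : (σ.face f hf).image ⊆ σ.image := by
  rintro _ ⟨x, rfl⟩
  exact ⟨stdSimplex.map f x, rfl⟩

lemma faceClosed_small (𝒰 : Set (Set X)) : FaceClosed (small 𝓕 𝒰) := by
  rintro σ ⟨U, hU, h⟩ m' f hf
  exact ⟨U, hU, (image_face_subset σ f hf).trans h⟩

/-- Each face of a blow up is a cell on a regular face of the simplex; compatibility of the cochain
then determines the coefficient from that cell. Closure of `P` under faces is needed for this. -/
lemma coeff_eq (hP : FaceClosed P) (ω : cochains R P k) (σ : P) (c : Finset (Vertex σ.1.dim n)) :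
    coeff (ω.1 σ) c = (-1) ^ twist σ.1.weight c * faceVal (toCells R P k ω) σ.1 c := by
  by_cases hc : Nonvoid σ.1.weight c
  · obtain ⟨m', φ, hf, h, hmap, hval⟩ := exists_cell (R := R) hc
    have hmem := hP σ.1 σ.2 m' φ hf
    rw [hval, toCells_of_mem ω hmem]
    conv_lhs => rw [hmap, coeff_map, ω.2 σ m' φ hf hmem]
    have : twist σ.1.weight c = twist (σ.1.face φ hf).weight
        (faceOf Finset.univ (virtualPart c)) := by
      conv_lhs => rw [hmap, twist_map]
      rfl
    rw [this]
    exact ((mul_assoc _ _ _).symm.trans ((congrArg (· * _) (neg_one_pow_mul_self _)).trans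
      (one_mul _))).symm
  · rw [faceVal_eq_zero _ hc, mul_zero, coeff_of_not_isFace fun h => hc h.1]

lemma fromCells_toCells (hP : FaceClosed P) (ω : cochains R P k) :
    fromCells R P k (toCells R P k ω) = ω := by
  ext1; funext σ c
  rw [fromCells_apply, ← coeff_eq hP ω σ c.1, coeff_of_isFace c.2]

lemma toCells_fromCells (f : Cell 𝓕 → R) {c : Cell 𝓕} (hc : c.simplex ∈ P)
    (h : IsFace c.simplex.weight k (faceOf Finset.univ c.apexes)) :
    toCells R P k (fromCells R P k f) c = f c := by
  rw [toCells_of_mem _ hc, coeff_fromCells _ _ h, faceVal_cell, ← mul_assoc,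
    neg_one_pow_mul_self, one_mul]

lemma toCells_eq_zero (ω : cochains R P k) {c : Cell 𝓕}
    (h : ¬ IsFace c.simplex.weight k (faceOf Finset.univ c.apexes)) : toCells R P k ω c = 0 := by
  by_cases hc : c.simplex ∈ P
  · rw [toCells_of_mem ω hc, coeff_of_not_isFace h, mul_zero]
  · exact toCells_of_notMem ω hc

/-- The cochain of a function on cells only depends, at a simplex, on the cells of its faces. -/
lemma fromCells_apply_congr {f g : Cell 𝓕 → R} {σ : RegularSimplex 𝓕} (hP : σ ∈ P) (hQ : σ ∈ Q)
    (h : ∀ c : Cell 𝓕, (∃ (m' : ℕ) (φ : Fin (m' + 1) ↪o Fin (σ.dim + 1))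
      (hf : ∃ j, σ.weight (φ j) = Fin.last n), c.simplex = σ.face φ hf) → f c = g c) :
    (fromCells R P k f).1 ⟨σ, hP⟩ = (fromCells R Q k g).1 ⟨σ, hQ⟩ := by
  funext c
  obtain ⟨m', φ, hf, hl, -, hval⟩ := exists_cell (R := R) c.2.1
  rw [fromCells_apply, fromCells_apply]
  congr 1
  exact (hval f).trans ((h _ ⟨m', φ, hf, rfl⟩).trans (hval g).symm)

/-- The sign `twist` exchanges the differential of the tensor product for the coboundary of the
join. -/
lemma diff_fromCells (f : Cell 𝓕 → R) :
    diff P k (fromCells R P k f) = fromCells R P (k + 1) (coboundary 𝓕 R f) := by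
  ext1; funext σ c
  have hn : Nonvoid σ.1.weight c.1 := c.2.1
  rw [fromCells_apply, faceVal_coboundary f hn, Finset.mul_sum]
  refine Finset.sum_congr rfl fun v hv => ?_
  rw [← mul_assoc, ← neg_one_pow_signExp σ.1.weight hn hv, mul_assoc]
  congr 1
  by_cases h : Nonvoid σ.1.weight (c.1.erase v)
  · exact coeff_fromCells f σ (isFace_of_erase c.2 hv ⟨h, rfl⟩)
  · rw [faceVal_eq_zero _ h, mul_zero, coeff_of_not_isFace fun h' => h h'.1]

/-- The claim is restricted to cells over `P`: outside `P` the function is extended by zero, and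
this extension need not be compatible with the coboundary. -/
lemma coboundary_toCells (hP : FaceClosed P) (ω : cochains R P k) {c : Cell 𝓕}
    (hc : c.simplex ∈ P) :
    coboundary 𝓕 R (toCells R P k ω) c = toCells R P (k + 1) (diff P k ω) c := by
  conv_rhs => rw [← fromCells_toCells hP ω, diff_fromCells]
  by_cases h : IsFace c.simplex.weight (k + 1) (faceOf Finset.univ c.apexes)
  · rw [toCells_fromCells _ hc h]
  -- In the wrong dimension both sides vanish: no codimension one face has dimension `k`.
  · rw [toCells_eq_zero _ h, coboundary_eq_sum]
    refine Finset.sum_eq_zero fun v hv => ?_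
    have h1 := coeff_eq hP ω ⟨c.simplex, hc⟩ ((faceOf Finset.univ c.apexes).erase v)
    rw [coeff_of_not_isFace] at h1
    · have h2 := congrArg ((-1 : R) ^ twist c.simplex.weight
        ((faceOf Finset.univ c.apexes).erase v) * ·) h1
      dsimp only at h2
      rw [← mul_assoc, neg_one_pow_mul_self, one_mul, mul_zero] at h2
      rw [← h2, mul_zero]
    · intro h'
      refine h (isFace_iff_nonvoid.2 ⟨c.nonvoid, ?_⟩)
      have := (isFace_iff_nonvoid.1 h').2
      rw [← Finset.card_erase_add_one hv, this]
      ring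

/-- A face of dimension `0` has one vertex in each factor, and removing any vertex empties a factor.
-/
lemma fromCells_zero_coboundary (f : Cell 𝓕 → R) :
    fromCells R P 0 (coboundary 𝓕 R f) = 0 := by
  ext1; funext σ c
  rw [fromCells_apply, faceVal_coboundary f c.2.1, Finset.sum_eq_zero, mul_zero]
  · rfl
  · intro v hv
    rw [faceVal_eq_zero, mul_zero]
    intro h
    have h1 := h.lt_card
    have h2 := (isFace_iff_nonvoid.1 c.2).2
    rw [Finset.card_erase_of_mem hv, h2] at h1
    omega

lemma toCells_restrict (h : P ⊆ Q) (ω : cochains R Q k) {c : Cell 𝓕} (hc : c.simplex ∈ P) :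
    toCells R P k (restrictCochains R h k ω) c = toCells R Q k ω c := by
  rw [toCells_of_mem _ hc, toCells_of_mem _ (h hc)]
  rfl

end Compare

end BlownUp

namespace BlownUp

variable {X : Type*} [TopologicalSpace X] {n : ℕ} {𝓕 : Filtration X n}

/-! ### Perverse degrees of cells -/

section Allowable

variable {σ : RegularSimplex 𝓕}

lemma map_mem_level_iff {x : Spx σ.dim} {i : Fin (n + 1)} :
    σ.map x ∈ 𝓕.level i ↔ wt σ.weight x ≤ i :=
  (σ.map_mem_level i x).trans wt_le_iff.symm

lemma map_mem_piece_iff {x : Spx σ.dim} {i : Fin (n + 1)} :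
    σ.map x ∈ 𝓕.piece i ↔ wt σ.weight x = i := by
  simp only [Filtration.piece, Set.mem_sdiff, Set.mem_iUnion, map_mem_level_iff, exists_prop,
    not_exists, not_and, not_le]
  constructor
  · rintro ⟨h1, h2⟩
    by_contra hne
    exact lt_irrefl _ (h2 _ (lt_of_le_of_ne h1 hne))
  · rintro rfl
    exact ⟨le_rfl, fun _ h => h⟩

/-- The part of a simplex in a difference of successive levels lies in a single stratum. -/
lemma Stratum.map_mem (S : Stratum 𝓕) {x y : Spx σ.dim} (hx : σ.map x ∈ S.carrier)
    (hy : wt σ.weight y = S.dim) : σ.map y ∈ S.carrier := by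
  obtain ⟨a, ha, hS⟩ := S.exists_eq
  have hxp : σ.map x ∈ 𝓕.piece S.dim := connectedComponentIn_subset _ a (hS ▸ hx)
  have hwx := map_mem_piece_iff.1 hxp
  -- All points of the segment from `x` to `y` have the same weight, so its image is a connected
  -- subset of one difference of levels.
  have hw : ∀ z : Spx 1, wt σ.weight (aff ![x, y] z) = S.dim := by
    intro z
    refine eq_of_forall_ge_iff fun j => ?_
    rw [wt_aff_le_iff]
    constructor
    · intro h
      obtain ⟨k, hk⟩ := exists_apply_ne_zero z
      have := h k hk
      fin_cases k
      · exact hwx ▸ this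
      · exact hy ▸ this
    · intro h k _
      fin_cases k
      · exact hwx.trans_le h
      · exact hy.trans_le h
  have hconn : IsPreconnected (Set.range fun z : Spx 1 => σ.map (aff ![x, y] z)) := by
    have : PreconnectedSpace (Spx 1) :=
      isPreconnected_iff_preconnectedSpace.1 (convex_stdSimplex ℝ (Fin 2)).isPreconnected
    exact isPreconnected_range (σ.map.continuous.comp (continuous_aff _))
  have hmem : ∀ k, σ.map (![x, y] k) ∈ Set.range fun z : Spx 1 => σ.map (aff ![x, y] z) :=
    fun k => ⟨vertices 1 k, congrArg σ.map (congrFun (aff_comp_vertices ![x, y]) k)⟩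
  have hsub : (Set.range fun z : Spx 1 => σ.map (aff ![x, y] z)) ⊆ 𝓕.piece S.dim := by
    rintro _ ⟨z, rfl⟩
    exact map_mem_piece_iff.2 (hw z)
  rw [hS] at hx ⊢
  rw [connectedComponentIn_eq hx]
  exact hconn.subset_connectedComponentIn (hmem 0) hsub (hmem 1)

/-- A face of a simplex with a vertex of weight `S.dim` meets the stratum `S` if the simplex
does. -/
lemma Stratum.inter_nonempty {τ : RegularSimplex 𝓕} (S : Stratum 𝓕)
    (hτ : τ.image ⊆ σ.image) (hS : (σ.image ∩ S.carrier).Nonempty)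
    (h : ∃ j, τ.weight j = S.dim) : (τ.image ∩ S.carrier).Nonempty := by
  obtain ⟨_, ⟨x, rfl⟩, hx⟩ := hS
  obtain ⟨j, hj⟩ := h
  obtain ⟨y, hy⟩ := hτ ⟨vertices _ j, rfl⟩
  refine ⟨_, ⟨vertices _ j, rfl⟩, ?_⟩
  rw [← hy]
  refine S.map_mem hx (map_mem_piece_iff.1 ?_)
  rw [hy, map_mem_piece_iff, wt_vertices, hj]

variable {c c' : Cell 𝓕}

/-- The perverse degree and `degreeAbove` differ by the number of factors beyond `i`, which does not
depend on the cell; so comparing one compares the other. -/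
lemma sum_factorDim_cell (i : Fin n) (c : Cell 𝓕) :
    ∑ j ∈ Finset.univ.filter fun j => i.castSucc < j,
        factorDim c.simplex.weight (faceOf Finset.univ c.apexes) j +
      (Finset.univ.filter fun j : Fin (n + 1) => i.castSucc < j).card = degreeAbove i c := by
  rw [sum_factorDim_add _ c.nonvoid, card_filter_faceOf, degreeAbove, apexSign]
  congr 1
  · have h1 := Finset.card_filter_add_card_filter_not (s := Finset.univ)
      fun j => c.simplex.weight j ≤ i.castSucc
    rw [Finset.card_univ, Fintype.card_fin] at h1
    have h2 : countLE c.simplex.weight i.castSucc (vertices _) =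
        (Finset.univ.filter fun j => c.simplex.weight j ≤ i.castSucc).card := by
      rw [Finset.card_filter]
      simp only [countLE, wt_vertices]
    have h3 : (Finset.univ.filter fun j => factor c.simplex.weight (realVertex n j) ∈
        Finset.univ.filter fun j => i.castSucc < j) =
        Finset.univ.filter fun j => ¬ c.simplex.weight j ≤ i.castSucc := by
      ext j
      simp [factor, realVertex]
    rw [h2, h3]
    omega
  · congr 1
    ext e
    simp [factor, virtualVertex]

lemma Cell.Below.faceDegree_le (h : c.Below c') {i : Fin n} (hi : i ∉ c.apexes) :
    faceDegree c.simplex.weight i (faceOf Finset.univ c.apexes) ≤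
      faceDegree c'.simplex.weight i (faceOf Finset.univ c'.apexes) := by
  have hi' : i ∉ c'.apexes := fun hi' => hi (h.apexes hi')
  have h1 := h.degree i hi
  rw [← sum_factorDim_cell, ← sum_factorDim_cell] at h1
  unfold faceDegree
  rw [if_neg (mt virtualVertex_mem_faceOf.1 hi), if_neg (mt virtualVertex_mem_faceOf.1 hi'),
    WithBot.coe_le_coe, WithTop.coe_le_coe, Nat.cast_le]
  exact Nat.le_of_add_le_add_right h1

/-- The cells at which allowable cochains vanish. -/
def Cell.IsForbidden (p : Perversity 𝓕) (c : Cell 𝓕) : Prop :=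
  ∃ (S : Stratum 𝓕) (h : S.dim ≠ Fin.last n), (c.simplex.image ∩ S.carrier).Nonempty ∧
    ¬ faceDegree c.simplex.weight (S.dim.castPred h) (faceOf Finset.univ c.apexes) ≤ p.toFun S

lemma notMem_of_not_faceDegree_le {m : ℕ} {w : Fin (m + 1) → Fin (n + 1)} {i : Fin n}
    {d : Finset (Vertex m n)} {a : ExtInt} (h : ¬ faceDegree w i d ≤ a) :
    virtualVertex m i ∉ d := fun hi => h (by rw [faceDegree, if_pos hi]; exact bot_le)

/-- Since the perverse degree of `c` is not `-∞`, the index of `S` is not an apex of `c`, nor of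
`c'`. Legality then gives `c'` a vertex of that weight, so `c'` meets `S`, and its perverse degree
is at least that of `c`. -/
lemma Cell.IsForbidden.of_below {p : Perversity 𝓕} (hc : c.IsForbidden p) (h : c.Below c') :
    c'.IsForbidden p := by
  obtain ⟨S, hS, hne, hp⟩ := hc
  have hi : S.dim.castPred hS ∉ c.apexes := fun hi =>
    notMem_of_not_faceDegree_le hp (virtualVertex_mem_faceOf.2 hi)
  refine ⟨S, hS, S.inter_nonempty h.image hne ?_, fun hp' => hp ((h.faceDegree_le hi).trans hp')⟩
  refine c'.legal _ fun e he hei => hi (h.apexes ?_)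
  have : S.dim.castPred hS = e := by
    rw [← Fin.castSucc_inj, Fin.castSucc_castPred, hei]
  rwa [this]

variable {R : Type*} [CommRing R] {P : Set (RegularSimplex 𝓕)} {k : ℕ} {p : Perversity 𝓕}

lemma IsAllowable.toCells_eq_zero {ω : cochains R P k} (h : IsAllowable p ω)
    (hc : c.IsForbidden p) : toCells R P k ω c = 0 := by
  by_cases hP : c.simplex ∈ P
  · obtain ⟨S, hS, hne, hp⟩ := hc
    by_cases hk : IsFace c.simplex.weight k (faceOf Finset.univ c.apexes)
    · rw [toCells_of_mem ω hP, coeff_of_isFace hk]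
      by_contra h0
      exact hp ((isAllowable_iff p ω).1 h S hS ⟨c.simplex, hP⟩ hne ⟨_, hk⟩ (right_ne_zero_of_mul h0))
    · exact BlownUp.toCells_eq_zero ω hk
  · exact toCells_of_notMem ω hP

lemma faceDegree_map {m m' : ℕ} (w : Fin (m + 1) → Fin (n + 1)) (f : Fin (m' + 1) ↪o Fin (m + 1))
    (i : Fin n) {d : Finset (Vertex m' n)} :
    faceDegree w i (d.map (vertexMap n f)) = faceDegree (fun j => w (f j)) i d := by
  have : virtualVertex m i ∈ d.map (vertexMap n f) ↔ virtualVertex m' i ∈ d := by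
    rw [← faceOf_parts d, map_faceOf, virtualVertex_mem_faceOf, virtualVertex_mem_faceOf]
  simp only [faceDegree, factorDim_map, this]

/-- A coefficient at a face of the blow up is the value at a cell on a smaller simplex. That simplex
must still meet `S`, which holds because the index of `S` is not an apex and so is the weight of one
of its vertices. -/
lemma isAllowable_fromCells {f : Cell 𝓕 → R} (h : ∀ c : Cell 𝓕, c.IsForbidden p → f c = 0) :
    IsAllowable p (fromCells R P k f) := by
  rw [isAllowable_iff]
  intro S hS σ hne c hc
  by_contra hp
  refine hc ?_
  obtain ⟨m', φ, hf, hl, hmap, hval⟩ := exists_cell (R := R) c.2.1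
  have hi := notMem_of_not_faceDegree_le hp
  rw [fromCells_apply, hval, h, mul_zero]
  refine ⟨S, hS, S.inter_nonempty (image_face_subset _ _ _) hne (hl _ ?_), ?_⟩
  · intro e he hei
    have : S.dim.castPred hS = e := by
      rw [← Fin.castSucc_inj, Fin.castSucc_castPred, hei]
    rw [this] at hi
    exact hi (mem_virtualPart.1 he)
  · rw [hmap, faceDegree_map] at hp
    exact hp

end Allowable

/-! ### Extension of small cochains -/

section Extension

variable (p : Perversity 𝓕) (R : Type*) [CommRing R] {𝒰 : Set (Set X)}

/-- `A` extends a small cochain by zero as a function on cells and applies the subdivision operator,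
which ignores the values at cells that are not small; `B` is the corresponding homotopy. -/
lemma exists_extension (h𝒰 : ∀ U ∈ 𝒰, IsOpen U) (hcover : ⋃₀ 𝒰 = Set.univ) :
    ∃ (A : ∀ k, cochains R (small 𝓕 𝒰) k →ₗ[R] cochains R (Set.univ : Set (RegularSimplex 𝓕)) k)
      (B : ∀ k, cochains R (Set.univ : Set (RegularSimplex 𝓕)) (k + 1) →ₗ[R]
        cochains R (Set.univ : Set (RegularSimplex 𝓕)) k),
      (∀ k ω, diff _ k (A k ω) = A (k + 1) (diff _ k ω)) ∧
      (∀ k ω, restrictCochains R (Set.subset_univ _) k (A k ω) = ω) ∧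
      (∀ ω, B 0 (diff _ 0 ω) = ω - A 0 (restrictCochains R (Set.subset_univ _) 0 ω)) ∧
      (∀ k ω, diff _ k (B k ω) + B (k + 1) (diff _ (k + 1) ω) =
        ω - A (k + 1) (restrictCochains R (Set.subset_univ _) (k + 1) ω)) ∧
      (∀ k ω, IsAllowable p ω → IsAllowable p (A k ω)) ∧
      (∀ k ω, IsAllowable p ω → IsAllowable p (B k ω)) ∧
      ∀ (K : Set X) (k : ℕ) (ω : cochains R (small 𝓕 𝒰) k),
        (∀ σ : small 𝓕 𝒰, σ.1.image ∩ K = ∅ → ω.1 σ = 0) →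
        ∀ σ : (Set.univ : Set (RegularSimplex 𝓕)), σ.1.image ∩ K = ∅ → (A k ω).1 σ = 0 := by
  obtain ⟨Φ, Ψ, hΦΨ, hsmall, hΦ, hΨ⟩ := exists_subdivision R h𝒰 hcover (n + 1) le_rfl (𝓕 := 𝓕)
  simp only [partlySmall_iff_mem_small] at hsmall hΦ
  have hcomm : ∀ f, coboundary 𝓕 R (Φ f) = Φ (coboundary 𝓕 R f) := by
    intro f
    have h1 := congrArg (coboundary 𝓕 R) (hΦΨ f)
    have h2 := hΦΨ (coboundary 𝓕 R f)
    rw [map_sub, map_add, coboundary_coboundary, zero_add] at h1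
    rw [coboundary_coboundary, map_zero, add_zero] at h2
    exact (sub_right_inj.1 (h1.trans h2.symm))
  have hcongr : ∀ f g, (∀ c, c.simplex ∈ small 𝓕 𝒰 → f c = g c) → Φ f = Φ g := by
    intro f g h
    rw [← sub_eq_zero, ← map_sub]
    funext c
    exact hΦ _ c fun c' hc' _ => sub_eq_zero.2 (h c' hc')
  have hρ : ∀ k (ω : cochains R (Set.univ : Set (RegularSimplex 𝓕)) k),
      Φ (toCells R _ k (restrictCochains R (Set.subset_univ (small 𝓕 𝒰)) k ω)) =
        Φ (toCells R _ k ω) :=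
    fun k ω => hcongr _ _ fun c hc => toCells_restrict _ ω hc
  have huniv : ∀ k (ω : cochains R (Set.univ : Set (RegularSimplex 𝓕)) k),
      coboundary 𝓕 R (toCells R _ k ω) = toCells R _ (k + 1) (diff _ k ω) :=
    fun k ω => funext fun c => coboundary_toCells faceClosed_univ ω (Set.mem_univ _)
  refine ⟨fun k => fromCells R _ k ∘ₗ Φ ∘ₗ toCells R _ k,
    fun k => fromCells R _ k ∘ₗ Ψ ∘ₗ toCells R _ (k + 1), fun k ω => ?_, fun k ω => ?_,
    fun ω => ?_, fun k ω => ?_, fun k ω hω => ?_, fun k ω hω => ?_, fun K k ω hω σ hσ => ?_⟩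
  · simp only [LinearMap.comp_apply]
    rw [diff_fromCells, hcomm]
    congr 1
    -- Extension by zero commutes with the coboundary only at small cells, and `Φ` sees no others.
    exact hcongr _ _ fun c hc => coboundary_toCells (faceClosed_small 𝒰) ω hc
  · conv_rhs => rw [← fromCells_toCells (faceClosed_small 𝒰) ω]
    ext1; funext σ
    refine fromCells_apply_congr (Set.mem_univ σ.1) σ.2 ?_
    rintro c ⟨m', φ, hf, hc⟩
    refine hsmall _ c ?_
    rw [hc]
    exact faceClosed_small 𝒰 σ.1 σ.2 m' φ hf
  · simp only [LinearMap.comp_apply]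
    rw [hρ, ← huniv]
    have h1 := congrArg (fromCells R (Set.univ : Set (RegularSimplex 𝓕)) 0)
      (hΦΨ (toCells R _ 0 ω))
    rw [map_sub, map_add, fromCells_zero_coboundary, zero_add,
      fromCells_toCells faceClosed_univ] at h1
    exact h1.symm
  · simp only [LinearMap.comp_apply]
    rw [hρ, ← huniv, diff_fromCells, ← map_add, ← hΦΨ, map_sub, fromCells_toCells faceClosed_univ]
  · exact isAllowable_fromCells fun c hc => hΦ _ c fun c' _ hcc' =>
      hω.toCells_eq_zero (hc.of_below hcc')
  · exact isAllowable_fromCells fun c hc => hΨ _ c fun c' hcc' =>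
      hω.toCells_eq_zero (hc.of_below hcc')
  · have h0 : (fromCells R (Set.univ : Set (RegularSimplex 𝓕)) k 0).1 σ = 0 := by
      rw [map_zero]; rfl
    rw [← h0]
    refine fromCells_apply_congr (Set.mem_univ σ.1) (Set.mem_univ σ.1) ?_
    rintro c ⟨m', φ, hf, hc⟩
    refine hΦ _ c fun c' hc' hcc' => ?_
    rw [toCells_of_mem _ hc', hω ⟨c'.simplex, hc'⟩]
    · rw [coeff]
      split_ifs <;> simp
    · refine Set.eq_empty_of_subset_empty (hσ ▸ Set.inter_subset_inter_left K ?_)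
      refine hcc'.image.trans ?_
      rw [hc]
      exact image_face_subset _ _ _

end Extension

end BlownUp

namespace BlownUp

variable {X : Type*} [TopologicalSpace X] {n : ℕ} {𝓕 : Filtration X n}

/-! ### From allowable cochains to complexes, and the theorem. -/

section Allowable

variable {R : Type*} [CommRing R] {P : Set (RegularSimplex 𝓕)} {k : ℕ} {p : Perversity 𝓕}

lemma IsAllowable.sub {ω η : cochains R P k} (hω : IsAllowable p ω) (hη : IsAllowable p η) :
    IsAllowable p (ω - η) := by
  rw [isAllowable_iff] at hω hη ⊢
  intro S h σ hσ c hc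
  by_cases h0 : ω.1 σ c = 0
  · refine hη S h σ hσ c fun h1 => hc ?_
    change ω.1 σ c - η.1 σ c = 0
    rw [h0, h1, sub_zero]
  · exact hω S h σ hσ c h0

end Allowable

/-- A homotopy of maps of cochain complexes, from maps of degree `-1`. -/
noncomputable def homotopyOfMaps {R : Type*} [CommRing R] {C D : CochainComplex (ModuleCat R) ℕ}
    (f g : C ⟶ D) (b : ∀ k, C.X (k + 1) ⟶ D.X k) (h0 : f.f 0 = C.d 0 1 ≫ b 0 + g.f 0)
    (h : ∀ k, f.f (k + 1) = C.d (k + 1) (k + 2) ≫ b (k + 1) + b k ≫ D.d k (k + 1) + g.f (k + 1)) :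
    Homotopy f g where
  hom i j := if hij : j + 1 = i then eqToHom (by rw [hij]) ≫ b j else 0
  zero i j hij := dif_neg hij
  comm i := by
    rw [Homotopy.dNext_cochainComplex]
    cases i with
    | zero => rw [Homotopy.prevD_zero_cochainComplex]; simpa using h0
    | succ k => rw [Homotopy.prevD_succ_cochainComplex]; simpa using h k

end BlownUp

theorem mainTheorem4 {X : Type*} [TopologicalSpace X] [T2Space X] {n : ℕ}
    (𝓕 : BlownUp.Filtration X n) (p : BlownUp.Perversity 𝓕) (R : Type*) [CommRing R]
    (𝒰 : Set (Set X)) (h𝒰 : ∀ U ∈ 𝒰, IsOpen U) (hcover : ⋃₀ 𝒰 = Set.univ) :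
    (∃ φ : BlownUp.smallComplex R p 𝒰 ⟶ BlownUp.blownUpComplex R p,
      φ ≫ BlownUp.restrictSmall R p 𝒰 = 𝟙 (BlownUp.smallComplex R p 𝒰) ∧
      Nonempty (Homotopy (𝟙 (BlownUp.blownUpComplex R p)) (BlownUp.restrictSmall R p 𝒰 ≫ φ)) ∧
      ∀ (K : Set X) (k : ℕ) (ω : (BlownUp.smallComplex R p 𝒰).X k),
        (∀ (σ : BlownUp.RegularSimplex 𝓕) (hσ : σ ∈ BlownUp.small 𝓕 𝒰),
          σ.image ∩ K = ∅ → BlownUp.value ω σ hσ = 0) →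
        ∀ σ : BlownUp.RegularSimplex 𝓕,
          σ.image ∩ K = ∅ → BlownUp.value (φ.f k ω) σ (Set.mem_univ σ) = 0) ∧
    QuasiIso (BlownUp.restrictSmall R p 𝒰) := by
  open BlownUp in
  suffices H : ∃ φ : smallComplex R p 𝒰 ⟶ blownUpComplex R p,
      φ ≫ restrictSmall R p 𝒰 = 𝟙 (smallComplex R p 𝒰) ∧
      Nonempty (Homotopy (𝟙 (blownUpComplex R p)) (restrictSmall R p 𝒰 ≫ φ)) ∧
      ∀ (K : Set X) (k : ℕ) (ω : (smallComplex R p 𝒰).X k),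
        (∀ (σ : RegularSimplex 𝓕) (hσ : σ ∈ small 𝓕 𝒰), σ.image ∩ K = ∅ → value ω σ hσ = 0) →
        ∀ σ : RegularSimplex 𝓕, σ.image ∩ K = ∅ → value (φ.f k ω) σ (Set.mem_univ σ) = 0 by
    obtain ⟨φ, h1, ⟨h2⟩, h3⟩ := H
    refine ⟨⟨φ, h1, ⟨h2⟩, h3⟩, ?_⟩
    exact (HomotopyEquiv.mk (restrictSmall R p 𝒰) φ h2.symm (Homotopy.ofEq h1)).quasiIso_hom
  obtain ⟨A, B, hA, hρ, h0, hB, hpA, hpB, hK⟩ := exists_extension p R h𝒰 hcover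
  have hAmem : ∀ k, ∀ ω ∈ intersectionCochains R p (small 𝓕 𝒰) k,
      A k ω ∈ intersectionCochains R p Set.univ k := fun k ω hω =>
    ⟨hpA k ω hω.1, by rw [hA]; exact hpA _ _ hω.2⟩
  have hBmem : ∀ k, ∀ ω ∈ intersectionCochains R p Set.univ (k + 1),
      B k ω ∈ intersectionCochains R p Set.univ k := fun k ω hω =>
    ⟨hpB k ω hω.1, by
      -- Allowability of `δBω` follows from the homotopy formula, which expresses it through `ω`,
      -- `Aρω` and `Bδω`.
      rw [eq_sub_of_add_eq (hB k ω)]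
      exact (hω.1.sub (hpA _ _ (hω.1.restrict R _))).sub (hpB _ _ hω.2)⟩
  let φ : smallComplex R p 𝒰 ⟶ blownUpComplex R p :=
    CochainComplex.ofHom (fun k => ModuleCat.ofHom ((A k).restrict (hAmem k))) fun k => by
      rw [intersectionComplex_d, intersectionComplex_d]
      exact ModuleCat.hom_ext (LinearMap.ext fun ω => Subtype.ext (hA k ω.1))
  refine ⟨φ, ?_, ⟨homotopyOfMaps _ _
    (fun k => ModuleCat.ofHom ((B k).restrict (hBmem k))) ?_ fun k => ?_⟩, ?_⟩
  · refine HomologicalComplex.hom_ext _ _ fun k => ModuleCat.hom_ext (LinearMap.ext fun ω => ?_)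
    exact Subtype.ext (hρ k ω.1)
  · rw [intersectionComplex_d]
    refine ModuleCat.hom_ext (LinearMap.ext fun ω => Subtype.ext ?_)
    exact (eq_add_of_sub_eq (h0 ω.1).symm)
  · rw [intersectionComplex_d, intersectionComplex_d]
    refine ModuleCat.hom_ext (LinearMap.ext fun ω => Subtype.ext ?_)
    exact (eq_add_of_sub_eq (hB k ω.1).symm).trans
      (congrArg (· + _) (add_comm _ _))
  · intro K k ω hω σ hσ
    exact hK K k (show intersectionCochains R p (small 𝓕 𝒰) k from ω).1
      (fun τ hτ => hω τ.1 τ.2 hτ) ⟨σ, Set.mem_univ σ⟩ hσ
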